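/- **Setting.** Let $n\ge 3$. One observes i.i.d. pairs $(\phi_i,\eta_i)$, $\eta_i=u(\phi_i^Tx_*)+\sigma\xi_i$, where $\sigma\ge 0$, $\phi_i\in\mathbb R^n$ and $\xi_i\in\mathbb R$ are independent with finite second moments, $\mathbf E\xi_i=0$, $\mathbf E\xi_i^2\le 1$, $\Sigma=\mathbf E\phi_i\phi_i^T\succeq\kappa_\Sigma I$ with $\kappa_\Sigma>0$, $\max_{ij}|\Sigma_{ij}|\le\upsilon$, and $\underline u(t-t')\le u(t)-u(t')\le\overline u(t-t')$ for $t\ge t'$, with known $0<\underline u\le\overline u$. Let $X\subset\mathbb R^n$ be closed and convex with nonempty interior and $x_0\in X$. Put $U(t)=\int_0^tu$, $g(x)=\mathbf E\{U(\phi^Tx)-\phi^Tx\,\eta\}$, $g_*=\min_Xg$, $\nabla G(x,(\phi,\eta))=\phi(u(\phi^Tx)-\eta)$, $\|x\|_\Sigma=\sqrt{x^T\Sigma x}$, and let $\sigma_1(\Sigma)$ be the largest eigenvalue of $\Sigma$. Let $\varkappa,\varkappa',\chi\ge1$, $\nu$, $R$ be reals, $s\le\bar s$ integers, $\bar s\ge1$,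 $\underline\kappa=\underline u\kappa_\Sigma$ and $\varsigma_*^2=\nu\sigma^2$. Let $\mathcal S$ be the set of $x_*\in X$ with at most $s$ nonzero entries and $\|x_*-x_0\|_1\le R$ such that $\|\nabla g(x)-\nabla g(x')\|_\infty\le\nu\|x-x'\|_1$ for $x,x'\in X$ and, for all $x\in X$, $z\in\mathbb R^n$ (with finite expectations), $$\Big(\overline u\,\mathbf E\{\|\phi\|_\infty^2(\phi^T(x-x_*))^2\}^{1/2}+\overline u\sqrt\upsilon\,\|x-x_*\|_\Sigma+\sigma\,\mathbf E\{\|\phi\|_\infty^2\}^{1/2}\Big)^2\le\varkappa\nu(g(x)-g_*)+\varkappa'\varsigma_*^2,$$ $$\underline u^{-1}\overline u\,\mathbf E\{(z^T\phi)^2(\phi^T(x-x_*))^2\}\le\tfrac12\chi\|z\|_2^2\,\sigma_1(\Sigma)\|x-x_*\|_\Sigma^2 .$$ The $\epsilon$-prediction risk of an estimator $\hat x$ is $\mathrm{Risk}_{g,\epsilon}(\hat x)=\inf\{r:\sup_{x_*\in\mathcal S}\mathrm{Prob}\{g(\hat x)-g_*\ge r\}\le\epsilon\}$. **Algorithm 1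 (on $M$ observations).** Let $\vartheta(x)=\frac12e\ln(n)\,n^{(p-1)(2-p)/p}\|x\|_p^2$, $p=1+1/\ln n$, $\Theta=\frac12e^2\ln n$, $V_{y}(x,z)=\vartheta(z-y)-\vartheta(x-y)-\langle\nabla\vartheta(x-y),z-x\rangle$. A stage $(m,\beta)$ started at $y\in X$ runs, on $m$ fresh observations $\omega_i$, $y_i=\mathrm{argmin}_{z\in X}\{\langle\nabla G(y_{i-1},\omega_i),z\rangle+\beta V_y(y_{i-1},z)\}$ from $y_0=y$, and returns $\hat x=\frac1m\sum_{i=1}^my_i$; the next stage is started at a point of $X$ with at most $s$ nonzero entries which is $\|\cdot\|_2$-closest to $\hat x$ (chosen by a measurable rule). The first stage is started at the given $x_0$. One runs $K=\min\{\lfloor M/m_0\rfloor,\overline K\}$ stages $(m_0,2\varkappa\nu)$, where $m_0=\lceil16\underline\kappa^{-1}\bar s(8\Theta\varkappa+1)\nu\rceil$, $\overline K=\max\{1,\lceil\log_2(R^2\underline\kappa\nu\varkappa/(32\varsigma_*^2\bar s\varkappa'))\rceil\}$ ($\overline K=\infty$ if $\sigma=0$), and then stages $(m_k,2^k\nu\varkappa)$,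 $m_k=\lceil512\,\bar s\Theta\nu\varkappa\underline\kappa^{-1}2^k\rceil$, $k=1,\dots,K'$, with the largest $K'\ge 0$ such that $m_1+\dots+m_{K'}\le M-m_0\overline K$ ($K'=0$ if $M<m_0\overline K$). The output is the point $\hat x$ returned by the last stage. **Algorithm 2 (on $2N$ observations, with parameters $L,L'$ and a threshold function $\rho$).** Apply Algorithm 1 to $L$ disjoint subsamples of length $M=\lfloor N/L\rfloor$ of the first $N$ observations, which gives $\hat x^{(1)},\dots,\hat x^{(L)}$; put $r_{ij}=\|\hat x^{(i)}-\hat x^{(j)}\|_2$. Let $\hat\imath$ minimize over $i$ the $(\lfloor L/2\rfloor+1)$-st smallest of the numbers $r_{ij}$, $j\ne i$, and let $\hat I$ be a set of $\lfloor L/2\rfloor+1$ indices of points closest to $\hat x^{(\hat\imath)}$. Split the last $N$ observations into $L'$ subsamples $(\omega^\ell_k)_{k\le m}$ of length $m=\lfloor N/L'\rfloor$, and put $\hat v^\ell_{ji}=\frac1m\sum_{k=1}^m\langle\nabla G(\hat x^{(j)}+\frac{2k-1}{2m}(\hat x^{(i)}-\hat x^{(j)}),\omega^\ell_k),\hat x^{(i)}-\hat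 x^{(j)}\rangle$. Call $i\in\hat I$ admissible if $\mathrm{med}_\ell\,\hat v^\ell_{ji}\le\rho(r_{ij})$ for all $j\in\hat I$, $j\neq i$. The output $\overline x_{2N,1-\epsilon}$ is any $\hat x^{(i)}$ with admissible $i\in\hat I$ if there is one, and $\hat x^{(1)}$ otherwise. **Statement.** For all large enough absolute $\alpha$, and then all large enough $\alpha'$ (how large depends on $\alpha$ only), there are positive constants $c_0,c,C,c_1,C_1$ depending only on $\alpha,\alpha'$, and a threshold function $\rho(r)$, positive for $r>0$, depending only on the known data ($n,u,X,x_0,R,\underline u,\overline u,\kappa_\Sigma,\upsilon,\sigma,s,\bar s,\varkappa,\varkappa',\nu,\chi$) and on $N,\epsilon$, with the following properties. Let $\epsilon\in(0,\frac12]$, $L=\lceil\alpha\ln(1/\epsilon)\rceil$, $L'=\lceil\alpha'\ln(1/\epsilon)\rceil$, and $$N\ge c_0\max\Big\{\frac{\varkappa\nu\bar s}{\underline u\kappa_\Sigma}\ln(1/\epsilon)\ln n,\ \frac{\chi\,\overline u\,\sigma_1(\Sigma)}{\underline u\kappa_\Sigma}\ln(1/\epsilon)\Big\}.$$ (a) The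 output of Algorithm 2 with the thresholds $\rho(r_{ij})$ satisfies $$\mathrm{Risk}_{g,\epsilon}(\overline x_{2N,1-\epsilon})\le C\Big(\frac{\underline u\kappa_\Sigma R^2}{\bar s}\exp\Big\{-\frac{cN\underline u\kappa_\Sigma}{\varkappa\bar s\nu\ln(1/\epsilon)\ln n}\Big\}+\frac{\varkappa'\sigma^2\nu\bar s\ln(1/\epsilon)\ln n}{\underline u\kappa_\Sigma N}\Big).\qquad(*)$$ (b) If moreover $\sigma_1(\Sigma)\le\varkappa'\nu\bar s\ln n$, then $(*)$ also holds for Algorithm 2 with the explicit thresholds $$\rho_{ij}=2r_{ij}\sqrt{\tfrac{\overline u\sigma_1(\Sigma)\chi}{m}}\,\big(\gamma(r_{ij})+\tau_M\big)+2r_{ij}\sigma\sqrt{\tfrac{\sigma_1(\Sigma)}{m}},\quad \gamma(r)=\Big(\Big[4r\sqrt{\tfrac{\chi\overline u\sigma_1(\Sigma)}{m}}+\tau_M\Big]^2+4r\sigma\sqrt{\tfrac{\sigma_1(\Sigma)}{m}}\Big)^{1/2},$$ $$\tau_M^2=\frac{\underline\kappa R^2}{\bar s}\exp\Big\{-\frac{c_1M\underline\kappa}{\Theta\varkappa\bar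 s\nu}\Big\}+C_1\frac{\varsigma_*^2\bar s\varkappa'\Theta}{\underline\kappa M}.$$ -/

import Mathlib

open MeasureTheory ProbabilityTheory

noncomputable section

namespace SparseGLM

/-- `ℝⁿ` with its Euclidean norm. -/
abbrev E (n : ℕ) : Type := EuclideanSpace ℝ (Fin n)

/-! ### Norms, sparsity -/

/-- The `ℓ₁`-norm. -/
def l1Norm {n : ℕ} (x : E n) : ℝ := ∑ i, |x i|

/-- The `ℓ_∞`-norm (the norm of the underlying function `Fin n → ℝ` is the sup norm). -/
def linfNorm {n : ℕ} (x : E n) : ℝ := ‖(WithLp.ofLp x : Fin n → ℝ)‖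

/-- The `ℓ_p`-norm. -/
def lpNorm {n : ℕ} (p : ℝ) (x : E n) : ℝ := (∑ i, |x i| ^ p) ^ (1 / p)

/-- `x` has at most `s` nonvanishing entries. -/
def IsSparse {n : ℕ} (s : ℕ) (x : E n) : Prop :=
  (Finset.univ.filter (fun i => x i ≠ 0)).card ≤ s

/-- `y` is an optimal solution of `min ‖x - z‖₂` over `s`-sparse `z ∈ X`. -/
def IsSparseApprox {n : ℕ} (X : Set (E n)) (s : ℕ) (x y : E n) : Prop :=
  (y ∈ X ∧ IsSparse s y) ∧ ∀ z ∈ X, IsSparse s z → ‖x - y‖ ≤ ‖x - z‖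

/-! ### Second moments of the regressors -/

/-- `Σ = E{φφᵀ}`. -/
def secondMoment {n : ℕ} (μφ : Measure (E n)) : Matrix (Fin n) (Fin n) ℝ :=
  Matrix.of fun i j => ∫ f, f i * f j ∂μφ

/-- `‖x‖_Q = √(xᵀQx)`. -/
def matNorm {n : ℕ} (Q : Matrix (Fin n) (Fin n) ℝ) (x : E n) : ℝ :=
  Real.sqrt (WithLp.ofLp x ⬝ᵥ Q.mulVec (WithLp.ofLp x))

/-- The spectral norm; it is the principal eigenvalue for positive semidefinite `Q`. -/
def sigma1 {n : ℕ} (Q : Matrix (Fin n) (Fin n) ℝ) : ℝ :=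
  ‖Matrix.toEuclideanCLM (n := Fin n) (𝕜 := ℝ) Q‖

/-! ### The data available to the statistician -/

/-- Everything which is known: activation, domain, starting point and numerical parameters. -/
structure Setup (n : ℕ) where
  /-- the activation -/
  u : ℝ → ℝ
  /-- the domain -/
  X : Set (E n)
  /-- the starting point -/
  x₀ : E n
  /-- bound on the `ℓ₁`-distance from the starting point to the signal -/
  R : ℝ
  /-- strong monotonicity constant of the activation -/
  uLo : ℝ
  /-- Lipschitz constant of the activation -/
  uHi : ℝ
  /-- lower bound `κ_Σ` on the spectrum of `Σ` -/
  kap : ℝ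
  /-- bound `υ` on the entries of `Σ` -/
  ups : ℝ
  /-- noise level -/
  sig : ℝ
  /-- sparsity of the signal -/
  s : ℕ
  /-- upper bound on the sparsity -/
  sBar : ℕ
  /-- the constant `ϰ` -/
  vk : ℝ
  /-- the constant `ϰ'` -/
  vk' : ℝ
  /-- the constant `ν` -/
  nu : ℝ
  /-- the constant `χ` -/
  chi : ℝ

/-- Standing assumptions on the known data. -/
structure Setup.Valid {n : ℕ} (S : Setup n) : Prop where
  uLo_pos : 0 < S.uLo
  uLo_le : S.uLo ≤ S.uHi
  u_mono : ∀ t t' : ℝ, t' ≤ t → S.uLo * (t - t') ≤ S.u t - S.u t'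
  u_lip : ∀ t t' : ℝ, t' ≤ t → S.u t - S.u t' ≤ S.uHi * (t - t')
  X_closed : IsClosed S.X
  X_convex : Convex ℝ S.X
  X_solid : (interior S.X).Nonempty
  x₀_mem : S.x₀ ∈ S.X
  kap_pos : 0 < S.kap
  sig_nonneg : 0 ≤ S.sig
  s_le : S.s ≤ S.sBar
  one_le_sBar : 1 ≤ S.sBar
  one_le_vk : 1 ≤ S.vk
  one_le_vk' : 1 ≤ S.vk'
  one_le_chi : 1 ≤ S.chi

/-- The quadratic growth constant `u̲ κ_Σ`. -/
def Setup.kLow {n : ℕ} (S : Setup n) : ℝ := S.uLo * S.kap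

/-- The level `ς_*² = ν σ²` of the noise of the stochastic gradient at the optimum. -/
def Setup.varStar {n : ℕ} (S : Setup n) : ℝ := S.nu * S.sig ^ 2

/-- Assumptions on the laws `μφ` of the regressor and `μξ` of the noise. -/
structure LawAssumptions {n : ℕ} (S : Setup n) (μφ : Measure (E n)) (μξ : Measure ℝ) : Prop where
  probφ : IsProbabilityMeasure μφ
  probξ : IsProbabilityMeasure μξ
  memLpφ : MemLp (fun f : E n => f) 2 μφ
  memLpξ : MemLp (fun e : ℝ => e) 2 μξ
  meanξ : ∫ e, e ∂μξ = 0
  varξ : ∫ e, e ^ 2 ∂μξ ≤ 1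
  lower : (secondMoment μφ - S.kap • (1 : Matrix (Fin n) (Fin n) ℝ)).PosSemidef
  upper : ∀ i j, |secondMoment μφ i j| ≤ S.ups

/-- `(φ_i, ξ_i)`, `i = 0, 1, …`, are i.i.d., with `φ_i ∼ μφ` and `ξ_i ∼ μξ` independent. -/
structure IsIIDSample {n : ℕ} {Ω : Type*} [MeasurableSpace Ω] (P : Measure Ω)
    (φ : ℕ → Ω → E n) (ξ : ℕ → Ω → ℝ) (μφ : Measure (E n)) (μξ : Measure ℝ) : Prop where
  measφ : ∀ i, Measurable (φ i)
  measξ : ∀ i, Measurable (ξ i)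
  indep : iIndepFun (fun i ω => (φ i ω, ξ i ω)) P
  law : ∀ i, P.map (fun ω => (φ i ω, ξ i ω)) = μφ.prod μξ

/-! ### The stochastic optimization problem -/

/-- The response `u(φᵀx_*) + σξ`. -/
def response {n : ℕ} (S : Setup n) (xs : E n) (f : E n) (e : ℝ) : ℝ :=
  S.u (inner ℝ f xs) + S.sig * e

/-- The primitive of the activation. -/
def primitive (u : ℝ → ℝ) (t : ℝ) : ℝ := ∫ r in (0 : ℝ)..t, u r

/-- `g(x) = E{U(φᵀx) - φᵀx η}` when the signal is `xs`. -/
def objective {n : ℕ} (S : Setup n) (μφ : Measure (E n)) (μξ : Measure ℝ) (xs x : E n) : ℝ :=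
  ∫ w : E n × ℝ, (primitive S.u (inner ℝ w.1 x) - inner ℝ w.1 x * response S xs w.1 w.2)
    ∂(μφ.prod μξ)

/-- `g_* = min_{x ∈ X} g(x)`. -/
def optValue {n : ℕ} (S : Setup n) (μφ : Measure (E n)) (μξ : Measure ℝ) (xs : E n) : ℝ :=
  sInf (objective S μφ μξ xs '' S.X)

/-- `∇G(x, (φ, η)) = φ (u(φᵀx) - η)`. -/
def stochGrad {n : ℕ} (u : ℝ → ℝ) (x : E n) (w : E n × ℝ) : E n :=
  (u (inner ℝ w.1 x) - w.2) • w.1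

/-- `∇g` is `ν`-Lipschitz on `X` from the `ℓ₁`- to the `ℓ_∞`-norm. -/
def SmoothCond {n : ℕ} (S : Setup n) (μφ : Measure (E n)) (μξ : Measure ℝ) (xs : E n) : Prop :=
  ∀ x ∈ S.X, ∀ x' ∈ S.X,
    linfNorm (gradient (objective S μφ μξ xs) x - gradient (objective S μφ μξ xs) x')
      ≤ S.nu * l1Norm (x - x')

/-- For all `x ∈ X`,
`(ū E{‖φ‖_∞² (φᵀ(x - x_*))²}^{1/2} + ū υ^{1/2} ‖x - x_*‖_Σ + σ E{‖φ‖_∞²}^{1/2})²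
  ≤ ϰ ν (g(x) - g_*) + ϰ' ς_*²`. -/
def VarianceCond {n : ℕ} (S : Setup n) (μφ : Measure (E n)) (μξ : Measure ℝ) (xs : E n) : Prop :=
  ∀ x ∈ S.X,
    Integrable (fun f : E n => linfNorm f ^ 2 * (inner ℝ f (x - xs)) ^ 2) μφ ∧
    (S.uHi * Real.sqrt (∫ f : E n, linfNorm f ^ 2 * (inner ℝ f (x - xs)) ^ 2 ∂μφ)
        + S.uHi * Real.sqrt S.ups * matNorm (secondMoment μφ) (x - xs)
        + Real.sqrt (∫ f, linfNorm f ^ 2 ∂μφ) * S.sig) ^ 2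
      ≤ S.vk * S.nu * (objective S μφ μξ xs x - optValue S μφ μξ xs) + S.vk' * S.varStar

/-- For all `x ∈ X` and all `z`,
`(ū / u̲) E{(zᵀφ)² (φᵀ(x - x_*))²} ≤ ½ χ ‖z‖₂² σ₁(Σ) ‖x - x_*‖_Σ²`. -/
def FourthMomentCond {n : ℕ} (S : Setup n) (μφ : Measure (E n)) (xs : E n) : Prop :=
  ∀ x ∈ S.X, ∀ z : E n,
    Integrable (fun f : E n => (inner ℝ z f) ^ 2 * (inner ℝ f (x - xs)) ^ 2) μφ ∧
    S.uLo⁻¹ * S.uHi * (∫ f, (inner ℝ z f) ^ 2 * (inner ℝ f (x - xs)) ^ 2 ∂μφ)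
      ≤ 1 / 2 * S.chi * ‖z‖ ^ 2 * sigma1 (secondMoment μφ)
          * matNorm (secondMoment μφ) (x - xs) ^ 2

/-- The signals over which the worst case is taken. -/
def signals {n : ℕ} (S : Setup n) (μφ : Measure (E n)) (μξ : Measure ℝ) : Set (E n) :=
  {xs | xs ∈ S.X ∧ IsSparse S.s xs ∧ l1Norm (xs - S.x₀) ≤ S.R ∧
    SmoothCond S μφ μξ xs ∧ VarianceCond S μφ μξ xs ∧ FourthMomentCond S μφ xs}

/-! ### Stochastic mirror descent -/

/-- The exponent `p = 1 + 1 / ln n`. -/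
def dgfExp (n : ℕ) : ℝ := 1 + 1 / Real.log n

/-- The distance-generating function `ϑ(x) = ½ e ln(n) n^{(p-1)(2-p)/p} ‖x‖_p²`. -/
def dgf {n : ℕ} (x : E n) : ℝ :=
  1 / 2 * Real.exp 1 * Real.log n
    * (n : ℝ) ^ ((dgfExp n - 1) * (2 - dgfExp n) / dgfExp n) * lpNorm (dgfExp n) x ^ 2

/-- The constant `Θ = ½ e² ln n` of quadratic growth of `ϑ`. -/
def Theta (n : ℕ) : ℝ := 1 / 2 * Real.exp 1 ^ 2 * Real.log n

/-- The Bregman divergence `V_{x₀}(x, z)`. -/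
def bregman {n : ℕ} (x₀ x z : E n) : ℝ :=
  dgf (z - x₀) - dgf (x - x₀) - inner ℝ (gradient (dgf (n := n)) (x - x₀)) (z - x)

/-- The proximal mapping `argmin_{z ∈ X} {⟨v, z⟩ + β V_{x₀}(x, z)}`. -/
def prox {n : ℕ} (X : Set (E n)) (β : ℝ) (v x x₀ : E n) : E n :=
  Classical.epsilon fun z =>
    z ∈ X ∧ IsMinOn (fun y : E n => inner ℝ v y + β * bregman x₀ x y) X z

/-- The iterates `x_i` of stochastic mirror descent from `x₀` on observations `w 0, w 1, …`. -/
def smdIter {n : ℕ} (S : Setup n) (β : ℝ) (x₀ : E n) (w : ℕ → E n × ℝ) : ℕ → E n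
  | 0 => x₀
  | i + 1 =>
      prox S.X β (stochGrad S.u (smdIter S β x₀ w i) (w i)) (smdIter S β x₀ w i) x₀

/-- The approximate solution `x̂_m(x₀, β) = (1/m) ∑_{i=1}^m x_i`. -/
def smdAvg {n : ℕ} (S : Setup n) (β : ℝ) (m : ℕ) (x₀ : E n) (w : ℕ → E n × ℝ) : E n :=
  (m : ℝ)⁻¹ • ∑ i ∈ Finset.range m, smdIter S β x₀ w (i + 1)

/-! ### Algorithm 1: multistage stochastic mirror descent for sparse recovery -/

/-- The length `m₀` of a preliminary stage. -/
def m0 {n : ℕ} (S : Setup n) : ℕ :=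
  ⌈16 * S.kLow⁻¹ * S.sBar * (8 * Theta n * S.vk + 1) * S.nu⌉₊

/-- The maximal number of preliminary stages (used for `σ ≠ 0`; it is infinite for `σ = 0`).
At least one preliminary stage is always allowed. -/
def kBar {n : ℕ} (S : Setup n) : ℕ :=
  max 1 ⌈Real.logb 2
    (S.R ^ 2 * S.kLow * S.nu * S.vk / (32 * S.varStar * S.sBar * S.vk'))⌉₊

/-- The length `m_k` of the `k`-th asymptotic stage, `k ≥ 1`. -/
def mAsym {n : ℕ} (S : Setup n) (k : ℕ) : ℕ :=
  ⌈512 * (S.sBar * Theta n * S.nu * S.vk / S.kLow) * 2 ^ k⌉₊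

/-- The number `K` of preliminary stages with `N` observations. -/
def numPrelim {n : ℕ} (S : Setup n) (N : ℕ) : ℕ :=
  if S.sig = 0 then N / m0 S else min (N / m0 S) (kBar S)

/-- The number of asymptotic stages with `N` observations: the largest `k` such that
`m_1 + ⋯ + m_k ≤ N - m₀ K̄` (so `0` if `m_1` exceeds this budget). -/
def numAsym {n : ℕ} (S : Setup n) (N : ℕ) : ℕ :=
  if S.sig = 0 then 0
  else Nat.findGreatest
    (fun k => (∑ i ∈ Finset.range k, mAsym S (i + 1)) ≤ N - m0 S * kBar S) N

/-- Length of stage number `k = 0, 1, …`: the `K` preliminary stages come first. -/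
def stageLen {n : ℕ} (S : Setup n) (N k : ℕ) : ℕ :=
  if k < numPrelim S N then m0 S else mAsym S (k - numPrelim S N + 1)

/-- Stepsize parameter of stage number `k = 0, 1, …`: `2ϰν` in the preliminary phase, and `2^j νϰ`
in the `j`-th asymptotic stage. -/
def stageBeta {n : ℕ} (S : Setup n) (N k : ℕ) : ℝ :=
  if k < numPrelim S N then 2 * S.vk * S.nu
  else 2 ^ (k - numPrelim S N + 1) * S.nu * S.vk

/-- State after `k` stages: the pair of the approximate solution delivered by the last stage and
its sparsification by `sp`. Every stage is run on fresh observations and started from the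
sparsification delivered by the previous one. -/
def stageState {n : ℕ} (S : Setup n) (sp : E n → E n) (N : ℕ) (w : ℕ → E n × ℝ) :
    ℕ → E n × E n
  | 0 => (S.x₀, S.x₀)
  | k + 1 =>
      let x := smdAvg S (stageBeta S N k) (stageLen S N k) (stageState S sp N w k).2
        (fun i => w ((∑ j ∈ Finset.range k, stageLen S N j) + i))
      (x, sp x)

/-- The output `x̂_N` of Algorithm 1. -/
def algOne {n : ℕ} (S : Setup n) (sp : E n → E n) (N : ℕ) (w : ℕ → E n × ℝ) : E n :=
  (stageState S sp N w (numPrelim S N + numAsym S N)).1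

/-! ### Algorithm 2: reliable aggregation -/

/-- The `k`-th smallest of the values `v i`, `i ∈ I` (for `1 ≤ k ≤ card I`). -/
def orderStat {ι : Type*} (I : Finset ι) (v : ι → ℝ) (k : ℕ) : ℝ :=
  sInf {t : ℝ | k ≤ (I.filter (fun i => v i ≤ t)).card}

/-- The median of `v 0, …, v (k - 1)`. -/
def median (k : ℕ) (v : ℕ → ℝ) : ℝ :=
  (orderStat (Finset.range k) v ((k + 1) / 2) + orderStat (Finset.range k) v (k / 2 + 1)) / 2

/-- The `ℓ`-th approximate solution (`ℓ = 0, …, L - 1`): the output of Algorithm 1 on the `ℓ`-th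
subsample, of length `⌊N / L⌋`, of the first `N` observations. -/
def candidate {n : ℕ} (S : Setup n) (sp : E n → E n) (N L : ℕ) (w : ℕ → E n × ℝ) (l : ℕ) : E n :=
  algOne S sp (N / L) (fun i => w (l * (N / L) + i))

/-- The estimate `v̂^ℓ_{ji}` of `g(b) - g(a)`, `a = x̂^{(j)}`, `b = x̂^{(i)}`, from the `ℓ`-th
subsample, of length `m`, of the second sample `w'`; here `t_k = (2k - 1) / (2m)`. -/
def diffEst {n : ℕ} (S : Setup n) (m : ℕ) (w' : ℕ → E n × ℝ) (a b : E n) (l : ℕ) : ℝ :=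
  (m : ℝ)⁻¹ * ∑ k ∈ Finset.range m,
    inner ℝ (stochGrad S.u (a + ((2 * (k + 1 : ℝ) - 1) / (2 * m)) • (b - a)) (w' (l * m + k)))
      (b - a)

/-- `i₀` minimizes over `i` the order statistic of rank `⌊L/2⌋ + 1` of the distances from `x i` to
the other points. -/
def IsCenter {n : ℕ} (L : ℕ) (x : ℕ → E n) (i₀ : ℕ) : Prop :=
  i₀ ∈ Finset.range L ∧ ∀ i ∈ Finset.range L,
    orderStat ((Finset.range L).erase i₀) (fun j => ‖x i₀ - x j‖) (L / 2 + 1)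
      ≤ orderStat ((Finset.range L).erase i) (fun j => ‖x i - x j‖) (L / 2 + 1)

/-- `I` is a set of indices of `⌊L/2⌋ + 1` points closest to `x i₀`. -/
def IsClosestSet {n : ℕ} (L : ℕ) (x : ℕ → E n) (i₀ : ℕ) (I : Finset ℕ) : Prop :=
  I ⊆ Finset.range L ∧ I.card = L / 2 + 1 ∧
    ∀ i ∈ I, ∀ j ∈ Finset.range L, j ∉ I → ‖x i - x i₀‖ ≤ ‖x j - x i₀‖

/-- `max_{j ∈ I, j ≠ i} {med_ℓ v̂^ℓ_{ji} - ρ_{ij}} ≤ 0`, with `ρ_{ij} = ρ(‖x i - x j‖)`. -/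
def IsAdmissible {n : ℕ} (S : Setup n) (L' m : ℕ) (ρ : ℝ → ℝ) (w' : ℕ → E n × ℝ)
    (x : ℕ → E n) (I : Finset ℕ) (i : ℕ) : Prop :=
  ∀ j ∈ I, j ≠ i →
    median L' (fun l => diffEst S m w' (x j) (x i) l) - ρ ‖x i - x j‖ ≤ 0

/-- `xbar` is a possible output of Algorithm 2 on the observations `w 0, …, w (2N - 1)`: the first
`N` observations serve to compute the `L` approximate solutions, the other `N` to compare them by
means of `L'` subsamples of length `⌊N / L'⌋`. -/
def IsAggregate {n : ℕ} (S : Setup n) (sp : E n → E n) (N L L' : ℕ) (ρ : ℝ → ℝ)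
    (w : ℕ → E n × ℝ) (xbar : E n) : Prop :=
  ∃ (i₀ : ℕ) (I : Finset ℕ),
    IsCenter L (candidate S sp N L w) i₀ ∧
    IsClosestSet L (candidate S sp N L w) i₀ I ∧
    ((∃ i ∈ I, IsAdmissible S L' (N / L') ρ (fun k => w (N + k)) (candidate S sp N L w) I i ∧
        xbar = candidate S sp N L w i) ∨
     ((¬ ∃ i ∈ I,
        IsAdmissible S L' (N / L') ρ (fun k => w (N + k)) (candidate S sp N L w) I i) ∧
        xbar = candidate S sp N L w 0))

/-- `τ_M² = (u̲κ_Σ R² / s̄) exp(-c M u̲κ_Σ / (Θ ϰ s̄ ν)) + C ς_*² s̄ ϰ' Θ / (u̲κ_Σ M)`. -/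
def tauSq {n : ℕ} (S : Setup n) (c C : ℝ) (M : ℕ) : ℝ :=
  S.kLow * S.R ^ 2 / S.sBar * Real.exp (-(c * M * S.kLow / (Theta n * S.vk * S.sBar * S.nu)))
    + C * (S.varStar * S.sBar * S.vk' * Theta n / (S.kLow * M))

/-- The function `γ(r)`, where `L₂ = ū σ₁(Σ)`, `ς_* √χ' = σ √σ₁(Σ)`; `σ₁` stands for `σ₁(Σ)` and
`τ` for `τ_M`. -/
def gammaFun {n : ℕ} (S : Setup n) (σ₁ τ : ℝ) (m : ℕ) (r : ℝ) : ℝ :=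
  Real.sqrt ((4 * r * Real.sqrt (S.chi * (S.uHi * σ₁) / m) + τ) ^ 2
    + 4 * r * S.sig * Real.sqrt (σ₁ / m))

/-- The explicit comparison thresholds
`2 r √(L₂ χ / m) (γ(r) + τ_M) + 2 r ς_* √(χ' / m)`. -/
def explicitRho {n : ℕ} (S : Setup n) (σ₁ τ : ℝ) (m : ℕ) (r : ℝ) : ℝ :=
  2 * r * Real.sqrt (S.uHi * σ₁ * S.chi / m) * (gammaFun S σ₁ τ m r + τ)
    + 2 * r * S.sig * Real.sqrt (σ₁ / m)

/-! ### Risk -/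

/-- The observations `(φ_i, η_i)`, `η_i = u(φ_iᵀ x_*) + σ ξ_i`. -/
def observations {n : ℕ} {Ω : Type*} (S : Setup n) (φ : ℕ → Ω → E n) (ξ : ℕ → Ω → ℝ) (xs : E n)
    (ω : Ω) : ℕ → E n × ℝ :=
  fun i => (φ i ω, response S xs (φ i ω) (ξ i ω))

/-- The `ε`-prediction risk
`inf {r : sup_{x_*} Prob{g(x̂) - g_* ≥ r} ≤ ε}` of the estimator `est`. -/
def predictionRisk {n : ℕ} {Ω : Type*} [MeasurableSpace Ω] (S : Setup n) (P : Measure Ω)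
    (φ : ℕ → Ω → E n) (ξ : ℕ → Ω → ℝ) (μφ : Measure (E n)) (μξ : Measure ℝ)
    (est : (ℕ → E n × ℝ) → E n) (ε : ℝ) : ENNReal :=
  sInf {r : ENNReal | (⨆ xs ∈ signals S μφ μξ,
    P {ω | r ≤ ENNReal.ofReal
      (objective S μφ μξ xs (est (observations S φ ξ xs ω)) - optValue S μφ μξ xs)})
      ≤ ENNReal.ofReal ε}

/-- The quantity
`(u̲κ_Σ R²/s̄) exp(-c N u̲κ_Σ / (ϰ s̄ ν ln(1/ε) ln n)) + ϰ' σ² ν s̄ ln(1/ε) ln n / (u̲κ_Σ N)`. -/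
def riskBound {n : ℕ} (S : Setup n) (c ε : ℝ) (N : ℕ) : ℝ :=
  S.kLow * S.R ^ 2 / S.sBar
      * Real.exp (-(c * N * S.kLow / (S.vk * S.sBar * S.nu * Real.log (1 / ε) * Real.log n)))
    + S.vk' * S.sig ^ 2 * S.nu * S.sBar * Real.log (1 / ε) * Real.log n / (S.kLow * N)

end SparseGLM

end

open MeasureTheory ProbabilityTheory

noncomputable section

namespace SparseGLM

/-! ### The activation and its primitive -/

section Activation

variable {n : ℕ} {S : Setup n}

/-! The gradient of g at x is E φ(u(φᵀx) - u(φᵀx_*)). It vanishes at x_*, and the two-sided bound on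
the slope of u pinches g(x) - g_* (the excess) between u̲/2 and ū/2 times ‖x - x_*‖_Σ²
(`objective_bounds`). Hence the excess controls the Euclidean error and, on sparse vectors, the
ℓ₁-error; this closes the loop between consecutive stages.

One stage. The function ϑ is 1-strongly convex in the ℓ₁-norm and at most Θ‖·‖₁²
(`dgf_strongly_convex`, `dgf_le_Theta`). The telescoping argument of mirror descent bounds the mean
excess of the averaged iterate by a multiple of βΘ E‖y - x_*‖₁²/m + ϰ'ς_*²/β (`smd_stage_bound`);
the part of the gradient variance proportional to the excess is absorbed because β ≥ 2ϰν.
Sparsification gives ‖y - x_*‖₁² ≤ 16 s̄/κ̲ times the excess (`l1Norm_sparsified_le`). So a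
preliminary stage halves the gap of the mean squared ℓ₁-error to a noise floor, and an asymptotic
stage, with β and m doubled each time, halves the error bound itself (`prelim_recursion`,
`asym_recursion`). Unrolling gives `algOne_mean_bound`, and Markov's inequality makes one run
accurate to τ_M² except with probability 1/81 (`algOne_tail_bound`).

Aggregation. A Chernoff bound over independent runs leaves fewer than L/4 bad ones with high
probability. A counting argument (`closestSet_geometry`) then shows that Î contains a good point and
that its points are mutually within a constant times τ_M/√κ̲. Euclidean proximity alone would lose
the condition number of Σ, so differences of g are estimated afresh. The midpoint rule has bias of
order 1/m (`midpoint_rule_error`), its variance is proportional to r_ij² times the mean excess plus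
a noise part, and medians over L' subsamples bring the failure probability of one comparison to
(7/8)^L', which survives a union bound over L² pairs (`aggregation_event_bound`).

On this event selection is deterministic: some index is admissible, and every admissible index has
excess at most a constant times the level B, where B is a multiple of the asserted risk bound. For
(a) the threshold is 23B + κ̲r²: a comparison errs by at most a quarter of the two excesses plus 21B
(`cmpErr_le_quarter`, `selection_of_threshold`). For (b) the thresholds replace ‖·‖_Σ by its bound
through σ₁, which is why σ₁ has to be bounded there (`selection_of_explicitRho`). -/

theorem Setup.Valid.uHi_pos (hS : S.Valid) : 0 < S.uHi := hS.uLo_pos.trans_le hS.uLo_le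

theorem Setup.Valid.kLow_pos (hS : S.Valid) : 0 < S.kLow := mul_pos hS.uLo_pos hS.kap_pos

theorem Setup.Valid.abs_u_sub_le (hS : S.Valid) (t t' : ℝ) : |S.u t - S.u t'| ≤ S.uHi * |t - t'| := by
  have hlo := hS.uLo_pos
  rcases le_total t' t with h | h
  · have h1 := hS.u_mono t t' h
    have h2 := hS.u_lip t t' h
    rw [abs_of_nonneg (le_trans (mul_nonneg hlo.le (sub_nonneg.2 h)) h1),
      abs_of_nonneg (sub_nonneg.2 h)]
    exact h2
  · have h1 := hS.u_mono t' t h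
    have h2 := hS.u_lip t' t h
    rw [abs_sub_comm, abs_sub_comm t, abs_of_nonneg (le_trans (mul_nonneg hlo.le (sub_nonneg.2 h)) h1),
      abs_of_nonneg (sub_nonneg.2 h)]
    exact h2

theorem Setup.Valid.continuous_u (hS : S.Valid) : Continuous S.u := by
  have : LipschitzWith S.uHi.toNNReal S.u := by
    refine LipschitzWith.of_dist_le_mul fun t t' => ?_
    rw [Real.dist_eq, Real.dist_eq, Real.coe_toNNReal _ hS.uHi_pos.le]
    exact hS.abs_u_sub_le t t'
  exact this.continuous

theorem Setup.Valid.primitive_expand (hS : S.Valid) (a b : ℝ) :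
    primitive S.u b - primitive S.u a - S.u a * (b - a) = ∫ r in a..b, (S.u r - S.u a) := by
  have hc := hS.continuous_u
  rw [intervalIntegral.integral_sub (hc.intervalIntegrable _ _) (by simp),
    intervalIntegral.integral_const, primitive, primitive,
    intervalIntegral.integral_interval_sub_left (hc.intervalIntegrable _ _)
      (hc.intervalIntegrable _ _)]
  simp [mul_comm]

theorem integral_linear_sub (a b : ℝ) : ∫ r in a..b, (r - a) = (b - a) ^ 2 / 2 := by
  rw [intervalIntegral.integral_sub (by simp) (by simp)]
  simp; ring

/-- The slope bounds on u are integrated from a to b; for b < a both the orientation of the integral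
and the bounds flip, so the result has the same form. -/
theorem Setup.Valid.primitive_bounds (hS : S.Valid) (a b : ℝ) :
    S.uLo / 2 * (b - a) ^ 2 ≤ primitive S.u b - primitive S.u a - S.u a * (b - a) ∧
    primitive S.u b - primitive S.u a - S.u a * (b - a) ≤ S.uHi / 2 * (b - a) ^ 2 := by
  have hc := hS.continuous_u
  have key : ∀ k : ℝ, ∫ r in a..b, k * (r - a) = k / 2 * (b - a) ^ 2 := fun k => by
    rw [intervalIntegral.integral_const_mul, integral_linear_sub]; ring
  rw [hS.primitive_expand, ← key, ← key]
  have i1 : ∀ k : ℝ, ∀ c d, IntervalIntegrable (fun r => k * (r - a)) volume c d := fun k c d =>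
    (by fun_prop : Continuous fun r => k * (r - a)).intervalIntegrable _ _
  have i2 : ∀ c d, IntervalIntegrable (fun r => S.u r - S.u a) volume c d := fun c d =>
    (by fun_prop : Continuous fun r => S.u r - S.u a).intervalIntegrable _ _
  rcases le_total a b with h | h
  · constructor
    · exact intervalIntegral.integral_mono_on h (i1 _ _ _) (i2 _ _) fun r hr => hS.u_mono r a hr.1
    · exact intervalIntegral.integral_mono_on h (i2 _ _) (i1 _ _ _) fun r hr => hS.u_lip r a hr.1
  · rw [intervalIntegral.integral_symm b a, intervalIntegral.integral_symm b a,
      intervalIntegral.integral_symm b a]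
    constructor
    · refine neg_le_neg (intervalIntegral.integral_mono_on h (i2 _ _) (i1 _ _ _) fun r hr => ?_)
      have := hS.u_mono a r hr.2
      linarith
    · refine neg_le_neg (intervalIntegral.integral_mono_on h (i1 _ _ _) (i2 _ _) fun r hr => ?_)
      have := hS.u_lip a r hr.2
      linarith

theorem Setup.Valid.continuous_primitive (hS : S.Valid) : Continuous (primitive S.u) := by
  unfold primitive
  exact intervalIntegral.continuous_primitive (fun a b => hS.continuous_u.intervalIntegrable a b) 0

end Activation

/-! ### Second moments -/

section Moments

variable {n : ℕ} {S : Setup n} {μφ : Measure (E n)} {μξ : Measure ℝ}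

theorem LawAssumptions.memLp_inner (hL : LawAssumptions S μφ μξ) (x : E n) :
    MemLp (fun f : E n => inner ℝ f x) 2 μφ := by
  have := hL.memLpφ.inner_const (𝕜 := ℝ) x
  exact this

theorem LawAssumptions.memLp_coord (hL : LawAssumptions S μφ μξ) (i : Fin n) :
    MemLp (fun f : E n => f i) 2 μφ := by
  have := hL.memLp_inner (EuclideanSpace.single i 1)
  simpa [EuclideanSpace.inner_single_right] using this

theorem LawAssumptions.memLp_u_sub (hS : S.Valid) (hL : LawAssumptions S μφ μξ) (x y : E n) :
    MemLp (fun f : E n => S.u (inner ℝ f x) - S.u (inner ℝ f y)) 2 μφ := by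
  have hc := hS.continuous_u
  have h := (hL.memLp_inner (x - y)).const_mul S.uHi
  refine h.mono (by fun_prop) (Filter.Eventually.of_forall fun f => ?_)
  simp only [Real.norm_eq_abs, abs_mul, abs_of_pos hS.uHi_pos, inner_sub_right]
  exact hS.abs_u_sub_le _ _

theorem LawAssumptions.memLp_u (hS : S.Valid) (hL : LawAssumptions S μφ μξ) (x : E n) :
    MemLp (fun f : E n => S.u (inner ℝ f x)) 2 μφ := by
  have := hL.probφ
  have h := (hL.memLp_u_sub hS x 0).add (memLp_const (S.u 0) (μ := μφ))
  refine h.congr_norm ?_ ?_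
  · have hc := hS.continuous_u
    fun_prop
  · refine Filter.Eventually.of_forall fun f => ?_
    simp

theorem dotProduct_mulVec_eq_integral (hL : LawAssumptions S μφ μξ) (x : E n) :
    WithLp.ofLp x ⬝ᵥ (secondMoment μφ).mulVec (WithLp.ofLp x) = ∫ f, (inner ℝ f x) ^ 2 ∂μφ := by
  have h1 : ∀ f : E n, (inner ℝ f x) ^ 2 = ∑ i, ∑ j, x i * (f i * f j * x j) := fun f => by
    rw [sq, PiLp.inner_apply, Finset.sum_mul_sum]
    refine Finset.sum_congr rfl fun i _ => Finset.sum_congr rfl fun j _ => ?_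
    simp; ring
  have hint : ∀ i j : Fin n, Integrable (fun f : E n => x i * (f i * f j * x j)) μφ := fun i j =>
    (((hL.memLp_coord i).integrable_mul (hL.memLp_coord j)).mul_const _).const_mul _
  simp_rw [h1]
  rw [integral_finsetSum _ (fun i _ => integrable_finsetSum _ fun j _ => hint i j)]
  simp only [dotProduct, Matrix.mulVec, secondMoment, Matrix.of_apply]
  refine Finset.sum_congr rfl fun i _ => ?_
  rw [integral_finsetSum _ (fun j _ => hint i j), Finset.mul_sum]
  refine Finset.sum_congr rfl fun j _ => ?_
  rw [integral_const_mul, integral_mul_const]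

theorem matNorm_sq_eq_integral (hL : LawAssumptions S μφ μξ) (x : E n) :
    matNorm (secondMoment μφ) x ^ 2 = ∫ f, (inner ℝ f x) ^ 2 ∂μφ := by
  unfold matNorm
  rw [dotProduct_mulVec_eq_integral hL, Real.sq_sqrt]
  exact integral_nonneg fun f => sq_nonneg _

theorem matNorm_nonneg (Q : Matrix (Fin n) (Fin n) ℝ) (x : E n) : 0 ≤ matNorm Q x :=
  Real.sqrt_nonneg _

theorem dotProduct_mulVec_eq (hL : LawAssumptions S μφ μξ) (x : E n) :
    WithLp.ofLp x ⬝ᵥ (secondMoment μφ).mulVec (WithLp.ofLp x)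
      = matNorm (secondMoment μφ) x ^ 2 := by
  rw [dotProduct_mulVec_eq_integral hL, matNorm_sq_eq_integral hL]

theorem kap_mul_norm_sq_le (hL : LawAssumptions S μφ μξ) (x : E n) :
    S.kap * ‖x‖ ^ 2 ≤ matNorm (secondMoment μφ) x ^ 2 := by
  have h := hL.lower.dotProduct_mulVec_nonneg (WithLp.ofLp x)
  rw [← dotProduct_mulVec_eq hL]
  rw [Matrix.sub_mulVec, dotProduct_sub, Matrix.smul_mulVec, Matrix.one_mulVec, dotProduct_smul] at h
  have h2 : WithLp.ofLp x ⬝ᵥ WithLp.ofLp x = ‖x‖ ^ 2 := by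
    rw [EuclideanSpace.norm_sq_eq]
    simp [dotProduct, sq]
  simp only [star_trivial, smul_eq_mul, h2] at h
  linarith

theorem matNorm_sq_le_sigma1 (hL : LawAssumptions S μφ μξ) (x : E n) :
    matNorm (secondMoment μφ) x ^ 2 ≤ sigma1 (secondMoment μφ) * ‖x‖ ^ 2 := by
  rw [← dotProduct_mulVec_eq hL]
  have h1 : WithLp.ofLp x ⬝ᵥ (secondMoment μφ).mulVec (WithLp.ofLp x)
      = inner ℝ x (Matrix.toEuclideanCLM (n := Fin n) (𝕜 := ℝ) (secondMoment μφ) x) := by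
    rw [PiLp.inner_apply]
    simp [dotProduct, mul_comm]
  rw [h1]
  calc _ ≤ ‖x‖ * ‖Matrix.toEuclideanCLM (n := Fin n) (𝕜 := ℝ) (secondMoment μφ) x‖ :=
        real_inner_le_norm _ _
    _ ≤ ‖x‖ * (sigma1 (secondMoment μφ) * ‖x‖) := by
        gcongr; exact ContinuousLinearMap.le_opNorm _ _
    _ = _ := by ring

theorem sigma1_nonneg (Q : Matrix (Fin n) (Fin n) ℝ) : 0 ≤ sigma1 Q := norm_nonneg _

end Moments

/-! ### The objective -/

section Objective

variable {n : ℕ} {S : Setup n} {μφ : Measure (E n)} {μξ : Measure ℝ}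

/-- The gradient field `E{φ (u(φᵀx) - u(φᵀx_*))}` of the objective. -/
def gradField (S : Setup n) (μφ : Measure (E n)) (xs x : E n) : E n :=
  ∫ f, (S.u (inner ℝ f x) - S.u (inner ℝ f xs)) • f ∂μφ

theorem gradField_self (xs : E n) : gradField S μφ xs xs = 0 := by simp [gradField]

theorem inner_gradField (hS : S.Valid) (hL : LawAssumptions S μφ μξ) (xs x z : E n) :
    inner ℝ (gradField S μφ xs x) z
      = ∫ f, (S.u (inner ℝ f x) - S.u (inner ℝ f xs)) * inner ℝ f z ∂μφ := by
  have hint : Integrable (fun f : E n => (S.u (inner ℝ f x) - S.u (inner ℝ f xs)) • f) μφ := by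
    have := hL.memLpφ.smul (p := 2) (q := 2) (r := 1) (hL.memLp_u_sub hS x xs)
    exact memLp_one_iff_integrable.1 this
  rw [real_inner_comm, gradField, ← integral_inner hint z]
  refine integral_congr_ae (Filter.Eventually.of_forall fun f => ?_)
  simp only [inner_smul_right, real_inner_comm]

theorem integrable_primitive (hS : S.Valid) (hL : LawAssumptions S μφ μξ) (x : E n) :
    Integrable (fun f : E n => primitive S.u (inner ℝ f x)) μφ := by
  have := hL.probφ
  have h1 : Integrable (fun f : E n => |S.u 0 * inner ℝ f x| + S.uHi / 2 * (inner ℝ f x) ^ 2) μφ :=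
    (((hL.memLp_inner x).integrable one_le_two).const_mul _).abs.add
      ((hL.memLp_inner x).integrable_sq.const_mul _)
  have hc := hS.continuous_primitive
  refine h1.mono' (by fun_prop) (Filter.Eventually.of_forall fun f => ?_)
  obtain ⟨h2, h3⟩ := hS.primitive_bounds 0 (inner ℝ f x)
  have h4 : primitive S.u 0 = 0 := by simp [primitive]
  have h5 : 0 ≤ S.uLo / 2 * (inner ℝ f x - 0) ^ 2 := by
    have := hS.uLo_pos; positivity
  rw [h4] at h2 h3
  simp only [sub_zero] at h2 h3 h5
  rw [Real.norm_eq_abs, abs_le]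
  have h6 := neg_abs_le (S.u 0 * inner ℝ f x)
  have h7 := le_abs_self (S.u 0 * inner ℝ f x)
  have h8 : 0 ≤ S.uHi / 2 * (inner ℝ f x) ^ 2 := by
    have := hS.uHi_pos; positivity
  constructor <;> linarith

theorem integrable_inner_mul_u (hS : S.Valid) (hL : LawAssumptions S μφ μξ) (x xs : E n) :
    Integrable (fun f : E n => inner ℝ f x * S.u (inner ℝ f xs)) μφ :=
  (hL.memLp_inner x).integrable_mul (hL.memLp_u hS xs)

/-- The noise enters only through φᵀx σξ, whose mean is zero because ξ is centred and independent of
φ. -/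
theorem objective_eq (hS : S.Valid) (hL : LawAssumptions S μφ μξ) (xs x : E n) :
    objective S μφ μξ xs x
      = ∫ f, (primitive S.u (inner ℝ f x) - inner ℝ f x * S.u (inner ℝ f xs)) ∂μφ := by
  have := hL.probφ
  have := hL.probξ
  have i1 : Integrable (fun f : E n => primitive S.u (inner ℝ f x)
      - inner ℝ f x * S.u (inner ℝ f xs)) μφ :=
    (integrable_primitive hS hL x).sub (integrable_inner_mul_u hS hL x xs)
  have i2 : Integrable (fun w : E n × ℝ => inner ℝ w.1 x * (S.sig * w.2)) (μφ.prod μξ) :=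
    ((hL.memLp_inner x).integrable one_le_two).mul_prod
      ((hL.memLpξ.integrable one_le_two).const_mul S.sig)
  have h : objective S μφ μξ xs x = ∫ w : E n × ℝ, ((primitive S.u (inner ℝ w.1 x)
      - inner ℝ w.1 x * S.u (inner ℝ w.1 xs)) - inner ℝ w.1 x * (S.sig * w.2)) ∂(μφ.prod μξ) := by
    unfold objective response
    refine integral_congr_ae (Filter.Eventually.of_forall fun w => ?_)
    simp only; ring
  rw [h, integral_sub (i1.comp_fst μξ) i2,
    integral_prod_mul (fun f : E n => inner ℝ f x) (fun e : ℝ => S.sig * e),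
    integral_const_mul, hL.meanξ, mul_zero, mul_zero, sub_zero,
    integral_fun_fst (μ := μφ) (ν := μξ)
      (fun f : E n => primitive S.u (inner ℝ f x) - inner ℝ f x * S.u (inner ℝ f xs))]
  simp

/-- The middle term is the mean of the Bregman divergence of the primitive between φᵀx and φᵀy, so
the scalar bounds integrate to the Σ-norm. Convexity, differentiability and quadratic growth of the
objective are all read off from here. -/
theorem objective_bounds (hS : S.Valid) (hL : LawAssumptions S μφ μξ) (xs x y : E n) :
    S.uLo / 2 * matNorm (secondMoment μφ) (y - x) ^ 2
      ≤ objective S μφ μξ xs y - objective S μφ μξ xs x - inner ℝ (gradField S μφ xs x) (y - x) ∧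
    objective S μφ μξ xs y - objective S μφ μξ xs x - inner ℝ (gradField S μφ xs x) (y - x)
      ≤ S.uHi / 2 * matNorm (secondMoment μφ) (y - x) ^ 2 := by
  have i1 : ∀ x : E n, Integrable (fun f : E n => primitive S.u (inner ℝ f x)
      - inner ℝ f x * S.u (inner ℝ f xs)) μφ := fun x =>
    (integrable_primitive hS hL x).sub (integrable_inner_mul_u hS hL x xs)
  have i2 : Integrable (fun f : E n =>
      (S.u (inner ℝ f x) - S.u (inner ℝ f xs)) * inner ℝ f (y - x)) μφ :=
    (hL.memLp_u_sub hS x xs).integrable_mul (hL.memLp_inner (y - x))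
  have i3 := (hL.memLp_inner (y - x)).integrable_sq
  have h : objective S μφ μξ xs y - objective S μφ μξ xs x
      - inner ℝ (gradField S μφ xs x) (y - x)
      = ∫ f, (primitive S.u (inner ℝ f y) - primitive S.u (inner ℝ f x)
        - S.u (inner ℝ f x) * (inner ℝ f y - inner ℝ f x)) ∂μφ := by
    rw [objective_eq hS hL, objective_eq hS hL, inner_gradField hS hL, ← integral_sub (i1 y) (i1 x),
      ← integral_sub (by exact (i1 y).sub (i1 x)) i2]
    refine integral_congr_ae (Filter.Eventually.of_forall fun f => ?_)
    simp only [inner_sub_right]; ring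
  have i4 : Integrable (fun f : E n => primitive S.u (inner ℝ f y) - primitive S.u (inner ℝ f x)
        - S.u (inner ℝ f x) * (inner ℝ f y - inner ℝ f x)) μφ := by
    refine (((i1 y).sub (i1 x)).sub i2).congr (Filter.Eventually.of_forall fun f => ?_)
    simp only [inner_sub_right, Pi.sub_apply]; ring
  rw [h, matNorm_sq_eq_integral hL, ← integral_const_mul, ← integral_const_mul]
  constructor
  · refine integral_mono (i3.const_mul _) i4 fun f => ?_
    simp only [inner_sub_right]
    exact (hS.primitive_bounds _ _).1
  · refine integral_mono i4 (i3.const_mul _) fun f => ?_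
    simp only [inner_sub_right]
    exact (hS.primitive_bounds _ _).2

/-- The quadratic sandwich makes the remainder O(‖y - x‖²); no differentiation under the integral is
needed. -/
theorem hasGradientAt_objective (hS : S.Valid) (hL : LawAssumptions S μφ μξ) (xs x : E n) :
    HasGradientAt (objective S μφ μξ xs) (gradField S μφ xs x) x := by
  rw [hasGradientAt_iff_isLittleO]
  have hO : (fun y => objective S μφ μξ xs y - objective S μφ μξ xs x
      - inner ℝ (gradField S μφ xs x) (y - x)) =O[nhds x] fun y => ‖y - x‖ ^ 2 := by
    refine Asymptotics.IsBigO.of_bound (S.uHi / 2 * sigma1 (secondMoment μφ))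
      (Filter.Eventually.of_forall fun y => ?_)
    obtain ⟨h1, h2⟩ := objective_bounds hS hL xs x y
    have h3 := matNorm_sq_le_sigma1 hL (y - x)
    have h4 := hS.uLo_pos
    have h5 := hS.uHi_pos
    rw [Real.norm_eq_abs, abs_of_nonneg (le_trans (by positivity) h1), norm_pow, norm_norm,
      mul_assoc]
    exact h2.trans (mul_le_mul_of_nonneg_left h3 (by positivity))
  refine hO.trans_isLittleO ?_
  have h1 : Filter.Tendsto (fun y => y - x) (nhds x) (nhds 0) := by
    have : Continuous fun y : E n => y - x := by fun_prop
    simpa using this.tendsto x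
  exact (Asymptotics.isLittleO_norm_pow_id (E' := E n) one_lt_two).comp_tendsto h1

theorem gradient_objective (hS : S.Valid) (hL : LawAssumptions S μφ μξ) (xs x : E n) :
    gradient (objective S μφ μξ xs) x = gradField S μφ xs x :=
  (hasGradientAt_objective hS hL xs x).gradient

theorem continuous_objective (hS : S.Valid) (hL : LawAssumptions S μφ μξ) (xs : E n) :
    Continuous (objective S μφ μξ xs) :=
  continuous_iff_continuousAt.2 fun x => (hasGradientAt_objective hS hL xs x).continuousAt

/-- The gradient field vanishes at x_*, so the quadratic lower bound makes x_* a minimizer over the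
whole space, hence over X. -/
theorem optValue_eq (hS : S.Valid) (hL : LawAssumptions S μφ μξ) {xs : E n} (hxs : xs ∈ S.X) :
    optValue S μφ μξ xs = objective S μφ μξ xs xs := by
  refine IsLeast.csInf_eq ⟨⟨xs, hxs, rfl⟩, ?_⟩
  rintro _ ⟨y, -, rfl⟩
  have h := (objective_bounds hS hL xs xs y).1
  rw [gradField_self, inner_zero_left, sub_zero] at h
  have h1 : 0 ≤ S.uLo / 2 * matNorm (secondMoment μφ) (y - xs) ^ 2 := by
    have := hS.uLo_pos; positivity
  linarith

/-- The excess `g(x) - g(x_*)` of the objective. -/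
def excess (S : Setup n) (μφ : Measure (E n)) (μξ : Measure ℝ) (xs x : E n) : ℝ :=
  objective S μφ μξ xs x - objective S μφ μξ xs xs

theorem excess_bounds (hS : S.Valid) (hL : LawAssumptions S μφ μξ) (xs x : E n) :
    S.uLo / 2 * matNorm (secondMoment μφ) (x - xs) ^ 2 ≤ excess S μφ μξ xs x ∧
    excess S μφ μξ xs x ≤ S.uHi / 2 * matNorm (secondMoment μφ) (x - xs) ^ 2 := by
  have h := objective_bounds hS hL xs xs x
  rwa [gradField_self, inner_zero_left, sub_zero] at h

theorem excess_nonneg (hS : S.Valid) (hL : LawAssumptions S μφ μξ) (xs x : E n) :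
    0 ≤ excess S μφ μξ xs x := by
  refine le_trans ?_ (excess_bounds hS hL xs x).1
  have := hS.uLo_pos; positivity

theorem norm_sq_le_excess (hS : S.Valid) (hL : LawAssumptions S μφ μξ) (xs x : E n) :
    S.kLow / 2 * ‖x - xs‖ ^ 2 ≤ excess S μφ μξ xs x := by
  refine le_trans ?_ (excess_bounds hS hL xs x).1
  have h1 := kap_mul_norm_sq_le hL (x - xs)
  have := hS.uLo_pos
  calc S.kLow / 2 * ‖x - xs‖ ^ 2 = S.uLo / 2 * (S.kap * ‖x - xs‖ ^ 2) := by
        unfold Setup.kLow; ring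
    _ ≤ _ := by gcongr

theorem continuous_excess (hS : S.Valid) (hL : LawAssumptions S μφ μξ) (xs : E n) :
    Continuous (excess S μφ μξ xs) :=
  (continuous_objective hS hL xs).sub continuous_const

/-- Convexity of the objective in the form of the gradient inequality. -/
theorem objective_gradient_le (hS : S.Valid) (hL : LawAssumptions S μφ μξ) (xs x y : E n) :
    objective S μφ μξ xs x + inner ℝ (gradField S μφ xs x) (y - x) ≤ objective S μφ μξ xs y := by
  have h := (objective_bounds hS hL xs x y).1
  have h1 : 0 ≤ S.uLo / 2 * matNorm (secondMoment μφ) (y - x) ^ 2 := by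
    have := hS.uLo_pos; positivity
  linarith

theorem convexOn_excess (hS : S.Valid) (hL : LawAssumptions S μφ μξ) (xs : E n) :
    ConvexOn ℝ Set.univ (excess S μφ μξ xs) := by
  refine ⟨convex_univ, fun x _ y _ a b ha hb hab => ?_⟩
  have h1 := objective_gradient_le hS hL xs (a • x + b • y) x
  have h2 := objective_gradient_le hS hL xs (a • x + b • y) y
  have e1 : x - (a • x + b • y) = b • (x - y) := by
    have : a = 1 - b := by linarith
    subst this; module
  have e2 : y - (a • x + b • y) = -(a • (x - y)) := by
    have : b = 1 - a := by linarith
    subst this; module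
  rw [e1, inner_smul_right] at h1
  rw [e2, inner_neg_right, inner_smul_right] at h2
  unfold excess
  simp only [smul_eq_mul]
  have h3 := mul_le_mul_of_nonneg_left h1 ha
  have h4 := mul_le_mul_of_nonneg_left h2 hb
  have h5 : ∀ t : ℝ, t = a * t + b * t := fun t => by rw [← add_mul, hab, one_mul]
  have h6 := h5 (objective S μφ μξ xs (a • x + b • y))
  have h7 := h5 (objective S μφ μξ xs xs)
  linarith

end Objective

/-! ### Strong convexity of the squared `ℓ_p`-norm, `1 < p < 2` -/

section PowerFunctions

/-- The concave function t^q lies below its tangent at b (Bernoulli's inequality), and the slope q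
b^(q-1) is at least its value at W ≥ b. -/
theorem rpow_sub_rpow_ge {q W a b : ℝ} (hq0 : 0 ≤ q) (hq1 : q ≤ 1) (ha : 0 ≤ a) (hab : a ≤ b)
    (hbW : b ≤ W) : q * W ^ (q - 1) * (b - a) ≤ b ^ q - a ^ q := by
  rcases hab.eq_or_lt with rfl | hlt
  · simp
  have hb : 0 < b := ha.trans_lt hlt
  have h1 := rpow_one_add_le_one_add_mul_self (s := a / b - 1) (by linarith [div_nonneg ha hb.le])
    hq0 hq1
  rw [add_sub_cancel, Real.div_rpow ha hb.le, div_le_iff₀ (Real.rpow_pos_of_pos hb q)] at h1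
  have h2 : W ^ (q - 1) ≤ b ^ (q - 1) := Real.rpow_le_rpow_of_nonpos hb hbW (by linarith)
  have h3 : b ^ q = b ^ (q - 1) * b := by
    rw [← Real.rpow_add_one hb.ne']; simp
  have h4 : (1 + q * (a / b - 1)) * b ^ q = b ^ q - q * b ^ (q - 1) * (b - a) := by
    rw [h3]; field_simp; ring
  have h5 : q * W ^ (q - 1) * (b - a) ≤ q * b ^ (q - 1) * (b - a) := by
    have : 0 ≤ b - a := by linarith
    gcongr
  linarith

theorem abs_rpow_mul_of_nonneg {p x : ℝ} (hp : 1 < p) (hx : 0 ≤ x) :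
    |x| ^ (p - 2) * x = x ^ (p - 1) := by
  rcases hx.eq_or_lt with rfl | h
  · simp [Real.zero_rpow (by linarith : p - 1 ≠ 0)]
  · rw [abs_of_pos h, ← Real.rpow_add_one h.ne']; ring_nf

/-- For p ≤ 2 the curvature of |t|^p on [-W, W] is smallest at the ends. It is expressed through
increments of the derivative, since for p < 2 the second derivative blows up at 0; an increment
across 0 is split there, using oddness. -/
theorem abs_rpow_deriv_mono {p W a b : ℝ} (hp : 1 < p) (hp2 : p ≤ 2) (ha : -W ≤ a)
    (hab : a ≤ b) (hb : b ≤ W) :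
    p * (p - 1) * W ^ (p - 2) * (b - a) ≤ p * |b| ^ (p - 2) * b - p * |a| ^ (p - 2) * a := by
  have key : ∀ a b : ℝ, 0 ≤ a → a ≤ b → b ≤ W →
      (p - 1) * W ^ (p - 2) * (b - a) ≤ |b| ^ (p - 2) * b - |a| ^ (p - 2) * a := by
    intro a b ha hab hb
    rw [abs_rpow_mul_of_nonneg hp ha, abs_rpow_mul_of_nonneg hp (ha.trans hab)]
    have := rpow_sub_rpow_ge (q := p - 1) (by linarith) (by linarith) ha hab hb
    rwa [show p - 1 - 1 = p - 2 by ring] at this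
  have main : (p - 1) * W ^ (p - 2) * (b - a) ≤ |b| ^ (p - 2) * b - |a| ^ (p - 2) * a := by
    rcases le_total 0 a with h | h
    · exact key a b h hab hb
    · rcases le_total 0 b with h' | h'
      · have h1 := key 0 b le_rfl h' hb
        have h2 := key 0 (-a) le_rfl (by linarith) (by linarith)
        simp only [mul_zero, sub_zero, abs_neg] at h1 h2
        linarith
      · have h2 := key (-b) (-a) (by linarith) (by linarith) (by linarith)
        simp only [abs_neg] at h2
        linarith
  have := mul_le_mul_of_nonneg_left main (by linarith : 0 ≤ p)
  linarith

/-- Subtracting the linear and quadratic terms leaves a function which on [-W, W] is nonincreasing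
before x and nondecreasing after it, by the preceding monotonicity and the mean value theorem. -/
theorem abs_rpow_ge_quadratic {p W x z : ℝ} (hp : 1 < p) (hp2 : p ≤ 2)
    (hx : |x| ≤ W) (hz : |z| ≤ W) :
    |x| ^ p + p * |x| ^ (p - 2) * x * (z - x) + p * (p - 1) / 2 * W ^ (p - 2) * (z - x) ^ 2
      ≤ |z| ^ p := by
  set k := p * (p - 1) * W ^ (p - 2) with hk
  have hd : ∀ t : ℝ, HasDerivAt (fun t : ℝ => |t| ^ p - p * |x| ^ (p - 2) * x * (t - x)
      - k / 2 * (t - x) ^ 2)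
      (p * |t| ^ (p - 2) * t - p * |x| ^ (p - 2) * x - k * (t - x)) t := by
    intro t
    have h1 := (hasDerivAt_abs_rpow t hp)
    have h2 : HasDerivAt (fun t : ℝ => t - x) 1 t := (hasDerivAt_id t).sub_const x
    have h3 := (h1.sub (h2.const_mul (p * |x| ^ (p - 2) * x))).sub ((h2.pow 2).const_mul (k / 2))
    convert! h3 using 1
    simp; ring
  have hc : Continuous (fun t : ℝ => |t| ^ p - p * |x| ^ (p - 2) * x * (t - x)
      - k / 2 * (t - x) ^ 2) := continuous_iff_continuousAt.2 fun t => (hd t).continuousAt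
  rw [abs_le] at hx hz
  have goal : |x| ^ p ≤ |z| ^ p - p * |x| ^ (p - 2) * x * (z - x) - k / 2 * (z - x) ^ 2 := by
    rcases lt_trichotomy x z with h | h | h
    · obtain ⟨c, hc1, hc2⟩ := exists_hasDerivAt_eq_slope _ _ h hc.continuousOn fun t _ => hd t
      have h1 := abs_rpow_deriv_mono hp hp2 (W := W) (a := x) (b := c) (by linarith) hc1.1.le
        (by linarith [hc1.2])
      rw [eq_div_iff (by linarith)] at hc2
      have h2 : 0 ≤ (p * |c| ^ (p - 2) * c - p * |x| ^ (p - 2) * x - k * (c - x)) * (z - x) :=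
        mul_nonneg (by linarith) (by linarith)
      rw [hc2] at h2
      simp at h2
      linarith
    · subst h; simp
    · obtain ⟨c, hc1, hc2⟩ := exists_hasDerivAt_eq_slope _ _ h hc.continuousOn fun t _ => hd t
      have h1 := abs_rpow_deriv_mono hp hp2 (W := W) (a := c) (b := x) (by linarith [hc1.1]) hc1.2.le
        (by linarith)
      rw [eq_div_iff (by linarith)] at hc2
      have h2 : (p * |c| ^ (p - 2) * c - p * |x| ^ (p - 2) * x - k * (c - x)) * (x - z) ≤ 0 :=
        mul_nonpos_of_nonpos_of_nonneg (by linarith) (by linarith)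
      rw [hc2] at h2
      simp at h2
      linarith
  have : k / 2 = p * (p - 1) / 2 * W ^ (p - 2) := by rw [hk]; ring
  rw [this] at goal
  linarith

/-- Hölder's inequality with exponents 2/p and 2/(2-p) for the splitting |d|^p = (W^(p-2) d²)^(p/2)
· (W^p)^((2-p)/2). It converts the coordinatewise curvature into a multiple of the squared ℓ_p-norm.
-/
theorem sum_abs_rpow_le_weighted {ι : Type*} (s : Finset ι) {p : ℝ} (hp : 1 < p) (hp2 : p < 2)
    (W d : ι → ℝ) (hW : ∀ i ∈ s, 0 < W i) :
    (∑ i ∈ s, |d i| ^ p) ^ (2 / p)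
      ≤ (∑ i ∈ s, W i ^ (p - 2) * d i ^ 2) * (∑ i ∈ s, W i ^ p) ^ (2 / p - 1) := by
  have hp0 : 0 < p := by linarith
  have hconj : (2 / p).HolderConjugate (2 / (2 - p)) := by
    rw [Real.holderConjugate_iff]
    constructor
    · rw [lt_div_iff₀ hp0]; linarith
    · have : 2 - p ≠ 0 := by linarith
      field_simp; ring
  have h := Real.inner_le_Lp_mul_Lq_of_nonneg s (f := fun i => (W i ^ (p - 2) * d i ^ 2) ^ (p / 2))
    (g := fun i => (W i ^ p) ^ ((2 - p) / 2)) hconj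
    (fun i hi => by have := hW i hi; positivity) (fun i hi => by have := hW i hi; positivity)
  have e1 : ∀ i ∈ s, (W i ^ (p - 2) * d i ^ 2) ^ (p / 2) * (W i ^ p) ^ ((2 - p) / 2)
      = |d i| ^ p := by
    intro i hi
    have hw := hW i hi
    rw [Real.mul_rpow (by positivity) (by positivity), ← Real.rpow_mul hw.le, ← Real.rpow_mul hw.le,
      ← sq_abs, ← Real.rpow_natCast, ← Real.rpow_mul (abs_nonneg _), mul_right_comm,
      ← Real.rpow_add hw, show (p - 2) * (p / 2) + p * ((2 - p) / 2) = 0 by ring, Real.rpow_zero,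
      one_mul]
    congr 1
    push_cast; ring
  have e2 : ∀ i ∈ s, ((W i ^ (p - 2) * d i ^ 2) ^ (p / 2)) ^ (2 / p) = W i ^ (p - 2) * d i ^ 2 := by
    intro i hi
    have hw := hW i hi
    rw [← Real.rpow_mul (by positivity), show p / 2 * (2 / p) = 1 by field_simp, Real.rpow_one]
  have e3 : ∀ i ∈ s, ((W i ^ p) ^ ((2 - p) / 2)) ^ (2 / (2 - p)) = W i ^ p := by
    intro i hi
    have hw := hW i hi
    have : 2 - p ≠ 0 := by linarith
    rw [← Real.rpow_mul (by positivity), show (2 - p) / 2 * (2 / (2 - p)) = 1 by field_simp,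
      Real.rpow_one]
  rw [Finset.sum_congr rfl e1, Finset.sum_congr rfl e2, Finset.sum_congr rfl e3] at h
  have hA : 0 ≤ ∑ i ∈ s, W i ^ (p - 2) * d i ^ 2 :=
    Finset.sum_nonneg fun i hi => by have := hW i hi; positivity
  have hB : 0 ≤ ∑ i ∈ s, W i ^ p := Finset.sum_nonneg fun i hi => by have := hW i hi; positivity
  have h2 := Real.rpow_le_rpow (Finset.sum_nonneg fun i _ => by positivity) h
    (by positivity : 0 ≤ 2 / p)
  refine h2.trans_eq ?_
  rw [Real.mul_rpow (by positivity) (by positivity), ← Real.rpow_mul hA, ← Real.rpow_mul hB]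
  congr 1
  · rw [show 1 / (2 / p) * (2 / p) = 1 by field_simp, Real.rpow_one]
  · congr 1
    field_simp

/-- A function with a strict linear local minorant at each point of `(0, 1)` lies below its
chord. -/
theorem le_chord_of_local_minorant {k : ℝ → ℝ} (hk : ContinuousOn k (Set.Icc 0 1))
    (h : ∀ t ∈ Set.Ioo (0 : ℝ) 1, ∃ m : ℝ, ∀ᶠ s in nhdsWithin (0 : ℝ) {0}ᶜ, k t + m * s < k (t + s))
    {l : ℝ} (hl : l ∈ Set.Icc (0 : ℝ) 1) : k l ≤ (1 - l) * k 0 + l * k 1 := by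
  set e : ℝ → ℝ := fun t => k t - ((1 - t) * k 0 + t * k 1) with he
  have hec : ContinuousOn e (Set.Icc 0 1) := hk.sub (by fun_prop)
  -- Where the gap to the chord is positive and maximal, a strict linear minorant of the gap would
  -- have to decrease in both directions.
  obtain ⟨t, ht, hmax⟩ := isCompact_Icc.exists_isMaxOn ⟨0, by simp⟩ hec
  have hel : e l ≤ e t := hmax hl
  by_contra! hcon
  have hpos : 0 < e t := lt_of_lt_of_le (by simp only [he]; linarith) hel
  have ht0 : t ≠ 0 := by rintro rfl; simp [he] at hpos
  have ht1 : t ≠ 1 := by rintro rfl; simp [he] at hpos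
  have htI : t ∈ Set.Ioo (0 : ℝ) 1 := ⟨lt_of_le_of_ne ht.1 ht0.symm, lt_of_le_of_ne ht.2 ht1⟩
  obtain ⟨m, hm⟩ := h t htI
  rw [eventually_nhdsWithin_iff, Metric.eventually_nhds_iff] at hm
  obtain ⟨δ, hδ, hm⟩ := hm
  have key : ∀ s : ℝ, |s| < δ → s ≠ 0 → t + s ∈ Set.Icc (0 : ℝ) 1 →
      (m - (k 1 - k 0)) * s < 0 := by
    intro s hs hs0 hts
    have h1 := hm (by simpa using hs) hs0
    have h2 : e (t + s) ≤ e t := hmax hts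
    simp only [he] at h2
    linarith
  set r := min (δ / 2) (min (t / 2) ((1 - t) / 2)) with hr
  have hr0 : 0 < r := by
    have := htI.1; have := htI.2
    refine lt_min (by linarith) (lt_min (by linarith) (by linarith))
  have hrδ : r < δ := lt_of_le_of_lt (min_le_left _ _) (by linarith)
  have hrt : r ≤ t / 2 := (min_le_right _ _).trans (min_le_left _ _)
  have hrt' : r ≤ (1 - t) / 2 := (min_le_right _ _).trans (min_le_right _ _)
  have h1 := key r (by rwa [abs_of_pos hr0]) hr0.ne' ⟨by linarith [ht.1], by linarith [ht.2]⟩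
  have h2 := key (-r) (by rwa [abs_neg, abs_of_pos hr0]) (by linarith)
    ⟨by linarith [ht.1, htI.1], by linarith [ht.2]⟩
  linarith

end PowerFunctions

/-! ### Second-order bounds for the squared ℓ_p-norm along lines. -/

section LpNorm

variable {n : ℕ}

/-- The sum of the `p`-th powers of the moduli of the coordinates. -/
def powSum (p : ℝ) (x : E n) : ℝ := ∑ i, |x i| ^ p

theorem powSum_nonneg (p : ℝ) (x : E n) : 0 ≤ powSum p x :=
  Finset.sum_nonneg fun _ _ => Real.rpow_nonneg (abs_nonneg _) _

theorem powSum_pos {p : ℝ} {x : E n} (hx : x ≠ 0) : 0 < powSum p x := by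
  obtain ⟨i, hi⟩ : ∃ i, x i ≠ 0 := by
    by_contra! h
    exact hx (by ext i; simp [h i])
  exact Finset.sum_pos' (fun _ _ => Real.rpow_nonneg (abs_nonneg _) _)
    ⟨i, Finset.mem_univ i, Real.rpow_pos_of_pos (abs_pos.2 hi) _⟩

theorem powSum_smul (p s : ℝ) (x : E n) : powSum p (s • x) = |s| ^ p * powSum p x := by
  simp [powSum, Finset.mul_sum, abs_mul, Real.mul_rpow]

theorem powSum_zero {p : ℝ} (hp : p ≠ 0) : powSum p (0 : E n) = 0 := by
  simp [powSum, Real.zero_rpow hp]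

theorem lpNorm_sq {p : ℝ} (x : E n) : lpNorm p x ^ 2 = powSum p x ^ (2 / p) := by
  rw [lpNorm, ← powSum, ← Real.rpow_natCast, ← Real.rpow_mul (powSum_nonneg p x)]
  congr 1
  push_cast; ring

theorem differentiable_powSum {p : ℝ} (hp : 1 < p) : Differentiable ℝ (powSum p : E n → ℝ) := by
  unfold powSum
  refine Differentiable.fun_sum fun i _ => ?_
  have h : Differentiable ℝ fun x : E n => x i := by fun_prop
  simpa [Real.norm_eq_abs] using h.norm_rpow hp

theorem differentiable_powSum_rpow {p : ℝ} (hp : 1 < p) (hp2 : p ≤ 2) :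
    Differentiable ℝ (fun x : E n => powSum p x ^ (2 / p)) := fun x =>
  (differentiable_powSum hp x).rpow_const (Or.inr (by rw [le_div_iff₀ (by linarith)]; linarith))

/-- Local second-order lower bound for the squared `ℓ_p`-norm away from the origin. -/
theorem powSum_rpow_local {p : ℝ} (hp : 1 < p) (hp2 : p < 2) {x d : E n} (hx : x ≠ 0) {c : ℝ}
    (hc : c < p - 1) (hd : d ≠ 0) :
    ∃ m : ℝ, ∀ᶠ s in nhdsWithin (0 : ℝ) {0}ᶜ, powSum p x ^ (2 / p) + m * s
      + c * s ^ 2 * powSum p d ^ (2 / p) < powSum p (x + s • d) ^ (2 / p) := by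
  have hp0 : 0 < p := by linarith
  set S₀ := powSum p x with hS₀
  have hS₀pos : 0 < S₀ := powSum_pos hx
  -- These weights dominate both |x i| and |x i + s d i| and tend to |x i| as s → 0. The summand 1
  -- keeps them positive where x i and d i both vanish, so that negative powers make sense.
  set A : ℝ → Fin n → ℝ := fun s i => |x i| + |s| * (|d i| + 1) with hA
  -- Hölder's inequality will cost exactly this ratio to the power 2/p - 1. It tends to 1, so every
  -- c < p - 1 is reached for small s.
  have hratio : Filter.Tendsto (fun s => (p - 1) * (S₀ / ∑ i, A s i ^ p) ^ (2 / p - 1))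
      (nhdsWithin 0 {0}ᶜ) (nhds (p - 1)) := by
    have h1 : Continuous fun s => ∑ i, A s i ^ p := by
      refine continuous_finsetSum _ fun i _ => ?_
      refine Continuous.rpow_const (by fun_prop) fun s => Or.inr hp0.le
    have h2 : ∑ i, A 0 i ^ p = S₀ := by simp [hA, hS₀, powSum]
    have h3 : ContinuousAt (fun s => (p - 1) * (S₀ / ∑ i, A s i ^ p) ^ (2 / p - 1)) 0 := by
      refine continuousAt_const.mul (ContinuousAt.rpow_const
        (continuousAt_const.div h1.continuousAt (by rw [h2]; exact hS₀pos.ne')) (Or.inl ?_))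
      rw [h2, div_self hS₀pos.ne']; exact one_ne_zero
    have h4 := h3.tendsto
    simp only [h2, div_self hS₀pos.ne', Real.one_rpow, mul_one] at h4
    exact h4.mono_left nhdsWithin_le_nhds
  refine ⟨2 / p * S₀ ^ (2 / p - 1) * ∑ i, p * |x i| ^ (p - 2) * x i * d i, ?_⟩
  filter_upwards [hratio.eventually (lt_mem_nhds hc), self_mem_nhdsWithin] with s hs hs0
  have hs0 : s ≠ 0 := hs0
  have hApos : ∀ i, 0 < A s i := fun i => by
    have : 0 < |s| := abs_pos.2 hs0
    positivity
  have hsum : S₀ + s * ∑ i, p * |x i| ^ (p - 2) * x i * d i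
      + p * (p - 1) / 2 * s ^ 2 * ∑ i, A s i ^ (p - 2) * d i ^ 2 ≤ powSum p (x + s • d) := by
    rw [hS₀, powSum, powSum, Finset.mul_sum, Finset.mul_sum, ← Finset.sum_add_distrib,
      ← Finset.sum_add_distrib]
    refine Finset.sum_le_sum fun i _ => ?_
    have h1 : |x i| ≤ A s i := le_add_of_nonneg_right (by positivity)
    have h2 : |(x + s • d) i| ≤ A s i := by
      simp only [PiLp.add_apply, PiLp.smul_apply, smul_eq_mul, hA]
      refine (abs_add_le _ _).trans ?_
      rw [abs_mul]
      gcongr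
      linarith
    have h3 := abs_rpow_ge_quadratic hp hp2.le h1 h2
    have h4 : (x + s • d) i - x i = s * d i := by simp
    rw [h4] at h3
    refine le_trans (le_of_eq ?_) h3
    ring
  have hq1 : 1 ≤ 2 / p := by rw [le_div_iff₀ hp0]; linarith
  -- Tangent-line inequality for the convex power 2/p ≥ 1, by Bernoulli.
  have hconv : S₀ ^ (2 / p) + 2 / p * S₀ ^ (2 / p - 1) * (powSum p (x + s • d) - S₀)
      ≤ powSum p (x + s • d) ^ (2 / p) := by
    have h1 := one_add_mul_self_le_rpow_one_add (s := powSum p (x + s • d) / S₀ - 1)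
      (by linarith [div_nonneg (powSum_nonneg p (x + s • d)) hS₀pos.le]) hq1
    rw [add_sub_cancel, Real.div_rpow (powSum_nonneg _ _) hS₀pos.le,
      le_div_iff₀ (Real.rpow_pos_of_pos hS₀pos _)] at h1
    have h3 : S₀ ^ (2 / p) = S₀ ^ (2 / p - 1) * S₀ := by
      rw [← Real.rpow_add_one hS₀pos.ne']; simp
    refine le_trans (le_of_eq ?_) h1
    rw [h3]; field_simp
  have hholder := sum_abs_rpow_le_weighted Finset.univ hp hp2 (A s) (fun i => d i)
    (fun i _ => hApos i)
  set T := ∑ i, A s i ^ p with hT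
  set Q := ∑ i, A s i ^ (p - 2) * d i ^ 2 with hQ
  have hTpos : 0 < T := by
    obtain ⟨i, -⟩ : ∃ i, x i ≠ 0 := by
      by_contra! h
      exact hx (by ext i; simp [h i])
    exact Finset.sum_pos (fun i _ => Real.rpow_pos_of_pos (hApos i) _) ⟨i, Finset.mem_univ i⟩
  have hdpos : 0 < powSum p d ^ (2 / p) := Real.rpow_pos_of_pos (powSum_pos hd) _
  have hmul : 2 / p * S₀ ^ (2 / p - 1) * (s * ∑ i, p * |x i| ^ (p - 2) * x i * d i
      + p * (p - 1) / 2 * s ^ 2 * Q)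
      ≤ 2 / p * S₀ ^ (2 / p - 1) * (powSum p (x + s • d) - S₀) := by
    have : 0 ≤ 2 / p * S₀ ^ (2 / p - 1) := by positivity
    exact mul_le_mul_of_nonneg_left (by linarith) this
  have hstrict : c * s ^ 2 * powSum p d ^ (2 / p) < (p - 1) * s ^ 2 * (S₀ ^ (2 / p - 1) * Q) := by
    have hs2 : 0 < s ^ 2 := by positivity
    calc c * s ^ 2 * powSum p d ^ (2 / p)
        = s ^ 2 * powSum p d ^ (2 / p) * c := by ring
      _ < s ^ 2 * powSum p d ^ (2 / p) * ((p - 1) * (S₀ / T) ^ (2 / p - 1)) := by gcongr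
      _ ≤ s ^ 2 * (Q * T ^ (2 / p - 1)) * ((p - 1) * (S₀ / T) ^ (2 / p - 1)) := by
          have : 0 ≤ (p - 1) * (S₀ / T) ^ (2 / p - 1) := by
            have : 0 < p - 1 := by linarith
            positivity
          refine mul_le_mul_of_nonneg_right ?_ this
          exact mul_le_mul_of_nonneg_left hholder hs2.le
      _ = (p - 1) * s ^ 2 * (S₀ ^ (2 / p - 1) * Q) := by
          rw [Real.div_rpow hS₀pos.le hTpos.le]
          have : T ^ (2 / p - 1) ≠ 0 := (Real.rpow_pos_of_pos hTpos _).ne'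
          field_simp
  have e : 2 / p * S₀ ^ (2 / p - 1) * (p * (p - 1) / 2 * s ^ 2 * Q)
      = (p - 1) * s ^ 2 * (S₀ ^ (2 / p - 1) * Q) := by field_simp
  rw [mul_add, e] at hmul
  linarith

theorem powSum_smul_rpow {p : ℝ} (hp : 0 < p) (s : ℝ) (d : E n) :
    powSum p (s • d) ^ (2 / p) = s ^ 2 * powSum p d ^ (2 / p) := by
  rw [powSum_smul, Real.mul_rpow (by positivity) (powSum_nonneg _ _), ← Real.rpow_mul (abs_nonneg _),
    show p * (2 / p) = 2 by field_simp, Real.rpow_two, sq_abs]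

/-- After subtraction of c t²‖d‖_p² with c < p - 1, the squared norm along the line still has a
strict linear local minorant at every point, hence lies below its chord. The sharp constant p - 1 is
obtained by letting c increase to it. -/
theorem powSum_rpow_chord {p : ℝ} (hp : 1 < p) (hp2 : p < 2) (x d : E n) {l : ℝ}
    (hl : l ∈ Set.Icc (0 : ℝ) 1) :
    powSum p (x + l • d) ^ (2 / p) ≤ (1 - l) * powSum p x ^ (2 / p)
      + l * powSum p (x + d) ^ (2 / p) - (p - 1) * (l * (1 - l)) * powSum p d ^ (2 / p) := by
  have hp0 : 0 < p := by linarith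
  rcases eq_or_ne d 0 with rfl | hd
  · simp only [smul_zero, add_zero, powSum_zero hp0.ne',
      Real.zero_rpow (div_pos two_pos hp0).ne']
    linarith
  have hdpos : 0 < powSum p d ^ (2 / p) := Real.rpow_pos_of_pos (powSum_pos hd) _
  have key : ∀ c : ℝ, c < p - 1 → powSum p (x + l • d) ^ (2 / p) ≤ (1 - l) * powSum p x ^ (2 / p)
      + l * powSum p (x + d) ^ (2 / p) - c * (l * (1 - l)) * powSum p d ^ (2 / p) := by
    intro c hc
    set k : ℝ → ℝ := fun t => powSum p (x + t • d) ^ (2 / p) - c * t ^ 2 * powSum p d ^ (2 / p)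
      with hk
    have hkc : Continuous k := by
      refine Continuous.sub ?_ (by fun_prop)
      exact (differentiable_powSum_rpow hp hp2.le).continuous.comp
        (by fun_prop : Continuous fun t : ℝ => x + t • d)
    have h := le_chord_of_local_minorant hkc.continuousOn ?_ hl
    · simp only [hk, zero_smul, add_zero, one_smul] at h
      linarith
    intro t _
    -- If the line passes through the origin at t, the squared norm there is exactly s²‖d‖_p², and c
    -- < p - 1 < 1 suffices.
    rcases eq_or_ne (x + t • d) 0 with h0 | h0
    · refine ⟨-(2 * c * t * powSum p d ^ (2 / p)), ?_⟩
      filter_upwards [self_mem_nhdsWithin] with s hs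
      have hs2 : 0 < s ^ 2 := by have : s ≠ 0 := hs; positivity
      have e : x + (t + s) • d = s • d := by rw [add_smul, ← add_assoc, h0, zero_add]
      simp only [hk, e, h0, powSum_zero hp0.ne', Real.zero_rpow (div_pos two_pos hp0).ne',
        powSum_smul_rpow hp0]
      have : 0 < s ^ 2 * powSum p d ^ (2 / p) * (1 - c) :=
        mul_pos (mul_pos hs2 hdpos) (by linarith)
      linarith
    · obtain ⟨m, hm⟩ := powSum_rpow_local hp hp2 h0 hc hd
      refine ⟨m - 2 * c * t * powSum p d ^ (2 / p), ?_⟩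
      filter_upwards [hm] with s hs
      have e : x + (t + s) • d = x + t • d + s • d := by rw [add_smul, ← add_assoc]
      simp only [hk, e]
      linarith
  have hcont : Filter.Tendsto (fun c : ℝ => (1 - l) * powSum p x ^ (2 / p)
      + l * powSum p (x + d) ^ (2 / p) - c * (l * (1 - l)) * powSum p d ^ (2 / p))
      (nhdsWithin (p - 1) (Set.Iio (p - 1))) (nhds ((1 - l) * powSum p x ^ (2 / p)
      + l * powSum p (x + d) ^ (2 / p) - (p - 1) * (l * (1 - l)) * powSum p d ^ (2 / p))) := by
    refine Filter.Tendsto.mono_left (Continuous.tendsto ?_ _) nhdsWithin_le_nhds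
    fun_prop
  refine ge_of_tendsto hcont ?_
  filter_upwards [self_mem_nhdsWithin] with c hc using key c hc

/-- Strong convexity in gradient form of a function which is strongly convex along chords. -/
theorem le_sub_of_chord {f : E n → ℝ} {x d g : E n} {K : ℝ} (hf : HasGradientAt f g x)
    (h : ∀ l ∈ Set.Icc (0 : ℝ) 1, f (x + l • d) ≤ (1 - l) * f x + l * f (x + d) - l * (1 - l) * K) :
    K ≤ f (x + d) - f x - inner ℝ g d := by
  have h1 : HasDerivAt (fun l : ℝ => f (x + l • d)) (inner ℝ g d) 0 := by
    have h2 : HasDerivAt (fun l : ℝ => x + l • d) d 0 := by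
      simpa using ((hasDerivAt_id (0 : ℝ)).smul_const d).const_add x
    have h3 := HasFDerivAt.comp_hasDerivAt (x := (0 : ℝ)) (l := f)
      (l' := (InnerProductSpace.toDual ℝ (E n)) g) (f := fun l : ℝ => x + l • d)
      (by simpa using hf.hasFDerivAt) h2
    simpa [Function.comp_def] using h3
  have h2 := (hasDerivAt_iff_tendsto_slope_zero.1 h1).mono_left
    (nhdsWithin_mono (0 : ℝ) (fun y hy => (ne_of_gt hy : y ≠ 0)) :
      nhdsWithin (0 : ℝ) (Set.Ioi 0) ≤ nhdsWithin 0 {0}ᶜ)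
  have h3 : Filter.Tendsto (fun l : ℝ => f (x + d) - f x - (1 - l) * K)
      (nhdsWithin 0 (Set.Ioi 0)) (nhds (f (x + d) - f x - (1 - 0) * K)) :=
    Filter.Tendsto.mono_left (Continuous.tendsto (by fun_prop) _) nhdsWithin_le_nhds
  have h4 := le_of_tendsto_of_tendsto h2 h3 ?_
  · linarith
  filter_upwards [Ioo_mem_nhdsGT (zero_lt_one : (0 : ℝ) < 1)] with l hl
  have h5 := h l ⟨hl.1.le, hl.2.le⟩
  simp only [zero_add, zero_smul, add_zero, smul_eq_mul]
  rw [inv_mul_le_iff₀ hl.1]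
  linarith

end LpNorm

/-! ### The distance-generating function -/

section Dgf

variable {n : ℕ}

theorem l1Norm_nonneg (x : E n) : 0 ≤ l1Norm x := Finset.sum_nonneg fun _ _ => abs_nonneg _

theorem l1Norm_neg (x : E n) : l1Norm (-x) = l1Norm x := by simp [l1Norm]

theorem l1Norm_sub_comm (x y : E n) : l1Norm (x - y) = l1Norm (y - x) := by
  rw [← neg_sub, l1Norm_neg]

theorem norm_le_l1Norm (x : E n) : ‖x‖ ≤ l1Norm x := by
  rw [← abs_of_nonneg (norm_nonneg x), ← abs_of_nonneg (l1Norm_nonneg x), ← sq_le_sq,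
    EuclideanSpace.norm_sq_eq]
  simp only [Real.norm_eq_abs, l1Norm]
  exact Finset.sum_sq_le_sq_sum_of_nonneg fun _ _ => abs_nonneg _

theorem one_lt_log (hn : 3 ≤ n) : 1 < Real.log n := by
  rw [Real.lt_log_iff_exp_lt (by positivity)]
  have h1 : (3 : ℝ) ≤ n := by exact_mod_cast hn
  linarith [Real.exp_one_lt_d9]

theorem one_lt_dgfExp (hn : 3 ≤ n) : 1 < dgfExp n := by
  have := one_lt_log hn
  unfold dgfExp
  have : 0 < 1 / Real.log n := by positivity
  linarith

theorem dgfExp_lt_two (hn : 3 ≤ n) : dgfExp n < 2 := by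
  have := one_lt_log hn
  unfold dgfExp
  have : 1 / Real.log n < 1 := by rw [div_lt_one (by linarith)]; exact this
  linarith

/-- The exponent is chosen for this identity: it makes the cost of passing between ℓ₁ and ℓ_p free
of the dimension. -/
theorem natCast_rpow_dgfExp_sub_one (hn : 3 ≤ n) : (n : ℝ) ^ (dgfExp n - 1) = Real.exp 1 := by
  have h := one_lt_log hn
  have hn0 : (0 : ℝ) < n := by positivity
  rw [Real.rpow_def_of_pos hn0, dgfExp]
  congr 1
  field_simp
  ring

/-- The normalizing factor of the distance-generating function. -/
def dgfConst (n : ℕ) : ℝ :=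
  1 / 2 * Real.exp 1 * Real.log n * (n : ℝ) ^ ((dgfExp n - 1) * (2 - dgfExp n) / dgfExp n)

theorem dgf_eq (x : E n) : dgf x = dgfConst n * powSum (dgfExp n) x ^ (2 / dgfExp n) := by
  rw [dgf, lpNorm_sq, dgfConst]

theorem dgfConst_pos (hn : 3 ≤ n) : 0 < dgfConst n := by
  have h := one_lt_log hn
  have hn0 : (0 : ℝ) < n := by positivity
  unfold dgfConst
  have : 0 < Real.log n := by linarith
  positivity

theorem dgf_nonneg (hn : 3 ≤ n) (x : E n) : 0 ≤ dgf x := by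
  rw [dgf_eq]
  exact mul_nonneg (dgfConst_pos hn).le (Real.rpow_nonneg (powSum_nonneg _ _) _)

theorem dgf_zero (hn : 3 ≤ n) : dgf (0 : E n) = 0 := by
  have hp := one_lt_dgfExp hn
  have : 0 < dgfExp n := by linarith
  rw [dgf_eq, powSum_zero (by linarith), Real.zero_rpow (by positivity), mul_zero]

theorem differentiable_dgf (hn : 3 ≤ n) : Differentiable ℝ (dgf : E n → ℝ) := by
  have : (dgf : E n → ℝ) = fun x => dgfConst n * powSum (dgfExp n) x ^ (2 / dgfExp n) :=
    funext dgf_eq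
  rw [this]
  exact (differentiable_powSum_rpow (one_lt_dgfExp hn) (dgfExp_lt_two hn).le).const_mul _

theorem continuous_dgf (hn : 3 ≤ n) : Continuous (dgf : E n → ℝ) := (differentiable_dgf hn).continuous

theorem gradient_dgf_zero (hn : 3 ≤ n) : gradient (dgf : E n → ℝ) 0 = 0 := by
  have h : IsLocalMin (dgf : E n → ℝ) 0 := by
    refine Filter.Eventually.of_forall fun x => ?_
    rw [dgf_zero hn]
    exact dgf_nonneg hn x
  rw [gradient, h.fderiv_eq_zero, map_zero]

theorem measurable_gradient_dgf : Measurable (gradient (dgf : E n → ℝ)) := by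
  unfold gradient
  exact (LinearIsometryEquiv.continuous _).measurable.comp (measurable_fderiv ℝ _)

theorem powSum_rpow_le_l1Norm_sq {p : ℝ} (hp : 1 < p) (x : E n) :
    powSum p x ^ (2 / p) ≤ l1Norm x ^ 2 := by
  have hp0 : 0 < p := by linarith
  have h1 : powSum p x ≤ l1Norm x ^ p := by
    have e : ∀ t : ℝ, 0 ≤ t → t ^ p = t * t ^ (p - 1) := fun t ht => by
      rcases ht.eq_or_lt with rfl | h
      · simp [Real.zero_rpow hp0.ne']
      · rw [mul_comm, ← Real.rpow_add_one h.ne']; simp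
    rw [powSum, e _ (l1Norm_nonneg x), l1Norm, Finset.sum_mul]
    refine Finset.sum_le_sum fun i hi => ?_
    rw [e _ (abs_nonneg _)]
    gcongr
    exact Finset.single_le_sum (f := fun i => |x i|) (fun _ _ => abs_nonneg _) hi
  calc powSum p x ^ (2 / p) ≤ (l1Norm x ^ p) ^ (2 / p) :=
        Real.rpow_le_rpow (powSum_nonneg _ _) h1 (by positivity)
    _ = l1Norm x ^ 2 := by
        rw [← Real.rpow_mul (l1Norm_nonneg x), show p * (2 / p) = 2 by field_simp, Real.rpow_two]

theorem l1Norm_sq_le_powSum {p : ℝ} (hp : 1 < p) (x : E n) :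
    l1Norm x ^ 2 ≤ (n : ℝ) ^ (2 * (p - 1) / p) * powSum p x ^ (2 / p) := by
  have hp0 : 0 < p := by linarith
  have h := Real.rpow_sum_le_const_mul_sum_rpow Finset.univ (fun i => x i) hp.le
  rw [Finset.card_univ, Fintype.card_fin, ← l1Norm, ← powSum] at h
  have h2 := Real.rpow_le_rpow (Real.rpow_nonneg (l1Norm_nonneg x) p) h
    (by positivity : 0 ≤ 2 / p)
  rw [← Real.rpow_mul (l1Norm_nonneg x), show p * (2 / p) = 2 by field_simp, Real.rpow_two,
    Real.mul_rpow (by positivity) (powSum_nonneg p x), ← Real.rpow_mul (by positivity)] at h2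
  refine h2.trans_eq ?_
  congr 2
  ring

theorem dgf_le_Theta (hn : 3 ≤ n) (x : E n) : dgf x ≤ Theta n * l1Norm x ^ 2 := by
  have hp := one_lt_dgfExp hn
  have hp2 := dgfExp_lt_two hn
  have hl := one_lt_log hn
  have h1 := powSum_rpow_le_l1Norm_sq hp x
  have hn1 : (1 : ℝ) ≤ n := by have : 1 ≤ n := by omega
                               exact_mod_cast this
  have h2 : (n : ℝ) ^ ((dgfExp n - 1) * (2 - dgfExp n) / dgfExp n) ≤ Real.exp 1 := by
    rw [← natCast_rpow_dgfExp_sub_one hn]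
    refine Real.rpow_le_rpow_of_exponent_le hn1 ?_
    rw [mul_div_assoc]
    refine mul_le_of_le_one_right (by linarith) ?_
    rw [div_le_one (by linarith)]; linarith
  have h3 : dgfConst n ≤ Theta n := by
    unfold dgfConst Theta
    calc _ ≤ 1 / 2 * Real.exp 1 * Real.log n * Real.exp 1 := by gcongr
      _ = _ := by ring
  rw [dgf_eq]
  have := (dgfConst_pos hn).le
  exact mul_le_mul h3 h1 (Real.rpow_nonneg (powSum_nonneg _ _) _) (this.trans h3)

/-- The normalization of ϑ is tuned here. From (p-1) ln n = 1 and n^(p-1) = e the modulus `dgfConst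
n * (p - 1)` equals ½ n^(2(p-1)/p), the factor by which ‖·‖₁² may exceed ‖·‖_p², up to the ½. -/
theorem half_l1Norm_sq_le (hn : 3 ≤ n) (d : E n) :
    1 / 2 * l1Norm d ^ 2 ≤ dgfConst n * (dgfExp n - 1) * powSum (dgfExp n) d ^ (2 / dgfExp n) := by
  have hp := one_lt_dgfExp hn
  have hl := one_lt_log hn
  have hp0 : dgfExp n ≠ 0 := by linarith
  have hn0 : (0 : ℝ) < n := by positivity
  have h1 := l1Norm_sq_le_powSum hp d
  have h2 : dgfConst n * (dgfExp n - 1) = 1 / 2 * (n : ℝ) ^ (2 * (dgfExp n - 1) / dgfExp n) := by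
    have e1 : Real.log n * (dgfExp n - 1) = 1 := by unfold dgfExp; field_simp; ring
    have e2 : 2 * (dgfExp n - 1) / dgfExp n
        = (dgfExp n - 1) + (dgfExp n - 1) * (2 - dgfExp n) / dgfExp n := by
      field_simp; ring
    rw [e2, Real.rpow_add hn0, natCast_rpow_dgfExp_sub_one hn, dgfConst]
    linear_combination (1 / 2 * Real.exp 1
      * (n : ℝ) ^ ((dgfExp n - 1) * (2 - dgfExp n) / dgfExp n)) * e1
  rw [h2, mul_assoc]
  linarith

/-- The distance-generating function is strongly convex with modulus `1` in the `ℓ₁`-norm. -/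
theorem dgf_strongly_convex (hn : 3 ≤ n) (x z : E n) :
    1 / 2 * l1Norm (z - x) ^ 2 ≤ dgf z - dgf x - inner ℝ (gradient (dgf : E n → ℝ) x) (z - x) := by
  have hp := one_lt_dgfExp hn
  have h := le_sub_of_chord (x := x) (d := z - x) (differentiable_dgf hn x).hasGradientAt
    (K := dgfConst n * (dgfExp n - 1) * powSum (dgfExp n) (z - x) ^ (2 / dgfExp n)) ?_
  · rw [add_sub_cancel] at h
    exact (half_l1Norm_sq_le hn _).trans h
  intro l hl
  have h1 := powSum_rpow_chord hp (dgfExp_lt_two hn) x (z - x) hl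
  have h2 := mul_le_mul_of_nonneg_left h1 (dgfConst_pos hn).le
  simp only [dgf_eq]
  linarith

theorem bregman_ge (hn : 3 ≤ n) (x₀ x z : E n) : 1 / 2 * l1Norm (z - x) ^ 2 ≤ bregman x₀ x z := by
  have := dgf_strongly_convex hn (x - x₀) (z - x₀)
  rwa [sub_sub_sub_cancel_right] at this

theorem bregman_nonneg (hn : 3 ≤ n) (x₀ x z : E n) : 0 ≤ bregman x₀ x z :=
  le_trans (by positivity) (bregman_ge hn x₀ x z)

theorem bregman_self_le (hn : 3 ≤ n) (y z : E n) : bregman y y z ≤ Theta n * l1Norm (z - y) ^ 2 := by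
  unfold bregman
  rw [sub_self, gradient_dgf_zero hn, dgf_zero hn, inner_zero_left, sub_zero, sub_zero]
  exact dgf_le_Theta hn _

theorem three_lt_Theta (hn : 3 ≤ n) : 3 < Theta n := by
  have h := one_lt_log hn
  have h1 := Real.exp_one_gt_d9
  unfold Theta
  nlinarith [mul_pos (by linarith : 0 < Real.exp 1 - 2.7) (by linarith : 0 < Real.log n - 1)]

theorem Theta_pos (hn : 3 ≤ n) : 0 < Theta n := by linarith [three_lt_Theta hn]

end Dgf

/-! ### The proximal mapping -/

section Prox

variable {n : ℕ} {X : Set (E n)} {β : ℝ}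

/-- The minimizer over `X` of `⟨ζ, z⟩ + β ϑ(z - x₀)`. -/
def proxCore (X : Set (E n)) (β : ℝ) (ζ x₀ : E n) : E n :=
  Classical.epsilon fun z => z ∈ X ∧ IsMinOn (fun y : E n => inner ℝ ζ y + β * dgf (y - x₀)) X z

/-- Terms not involving z drop out of the minimization, so the minimizer depends on three vectors
only through two. In these the objective is jointly continuous, whereas the gradient of ϑ is used
merely as a measurable map. -/
theorem prox_eq_proxCore (v x x₀ : E n) :
    prox X β v x x₀ = proxCore X β (v - β • gradient (dgf : E n → ℝ) (x - x₀)) x₀ := by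
  unfold prox proxCore
  congr 1
  funext z
  refine congrArg (z ∈ X ∧ ·) ?_
  simp only [isMinOn_iff, bregman, inner_sub_left, inner_sub_right, inner_smul_left, eq_iff_iff]
  refine forall₂_congr fun y _ => ?_
  simp only [conj_trivial]
  constructor <;> intro h <;> linarith

theorem exists_proxCore (hn : 3 ≤ n) (hX : IsClosed X) (hne : X.Nonempty) (hβ : 0 < β)
    (ζ x₀ : E n) :
    ∃ z, z ∈ X ∧ IsMinOn (fun y : E n => inner ℝ ζ y + β * dgf (y - x₀)) X z := by
  obtain ⟨w, hw⟩ := hne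
  have hc : Continuous (fun y : E n => inner ℝ ζ y + β * dgf (y - x₀)) := by
    have := continuous_dgf hn
    fun_prop
  refine hc.continuousOn.exists_isMinOn' hX hw ?_
  set C := inner ℝ ζ w + β * dgf (w - x₀) with hC
  -- Outside this radius ½β‖z - x₀‖² outweighs the linear term together with the value C at the
  -- reference point.
  set r := 2 * (‖ζ‖ + 1) / β + ‖ζ‖ * ‖x₀‖ + |C| with hr
  have hmem : (Metric.closedBall x₀ r)ᶜ ∈ Filter.cocompact (E n) ⊓ Filter.principal X :=
    Filter.mem_inf_of_left (isCompact_closedBall x₀ r).compl_mem_cocompact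
  filter_upwards [hmem] with z hz
  have hz : r < ‖z - x₀‖ := by simpa [dist_eq_norm] using hz
  have h1 := dgf_strongly_convex hn 0 (z - x₀)
  rw [gradient_dgf_zero hn, dgf_zero hn, inner_zero_left, sub_zero, sub_zero, sub_zero] at h1
  have h2 := norm_le_l1Norm (z - x₀)
  have h3 : inner ℝ ζ z = inner ℝ ζ (z - x₀) + inner ℝ ζ x₀ := by rw [inner_sub_right]; ring
  have h4 := (abs_le.1 (abs_real_inner_le_norm ζ (z - x₀))).1
  have h5 := (abs_le.1 (abs_real_inner_le_norm ζ x₀)).1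
  set t := ‖z - x₀‖
  have ht0 : 0 ≤ ‖ζ‖ * ‖x₀‖ := by positivity
  have ht1 : 0 ≤ 2 * (‖ζ‖ + 1) / β := by positivity
  have ht2 : ‖ζ‖ * ‖x₀‖ + |C| ≤ t := by linarith
  have ht3 : 2 * (‖ζ‖ + 1) / β ≤ t := by linarith [abs_nonneg C]
  rw [div_le_iff₀ hβ] at ht3
  have ht : 0 ≤ t := norm_nonneg _
  have h6 : t ^ 2 ≤ l1Norm (z - x₀) ^ 2 := by gcongr
  have h7 : β * (1 / 2 * t ^ 2) ≤ β * dgf (z - x₀) := by gcongr; linarith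
  have h8 : (‖ζ‖ + 1) * t ≤ β * (1 / 2 * t ^ 2) := by nlinarith
  have h9 := le_abs_self C
  linarith

theorem proxCore_spec (hn : 3 ≤ n) (hX : IsClosed X) (hne : X.Nonempty) (hβ : 0 < β)
    (ζ x₀ : E n) : proxCore X β ζ x₀ ∈ X ∧
      IsMinOn (fun y : E n => inner ℝ ζ y + β * dgf (y - x₀)) X (proxCore X β ζ x₀) :=
  Classical.epsilon_spec (exists_proxCore hn hX hne hβ ζ x₀)

theorem first_order_of_isMinOn (hn : 3 ≤ n) (hXc : Convex ℝ X) {ζ x₀ z u : E n} (hz : z ∈ X)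
    (hmin : IsMinOn (fun y : E n => inner ℝ ζ y + β * dgf (y - x₀)) X z) (hu : u ∈ X) :
    0 ≤ inner ℝ ζ (u - z) + β * inner ℝ (gradient (dgf : E n → ℝ) (z - x₀)) (u - z) := by
  have h1 : HasFDerivAt (fun y : E n => inner ℝ ζ y) (innerSL ℝ ζ) z :=
    (innerSL ℝ ζ).hasFDerivAt
  have h2 : HasFDerivAt (fun y : E n => dgf (y - x₀))
      ((InnerProductSpace.toDual ℝ (E n)) (gradient (dgf : E n → ℝ) (z - x₀))) z :=
    (hasFDerivAt_comp_sub x₀).2 (differentiable_dgf hn (z - x₀)).hasGradientAt.hasFDerivAt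
  have h3 := (h1.add (h2.const_mul β)).hasFDerivWithinAt (s := X)
  have h4 := IsLocalMinOn.hasFDerivWithinAt_nonneg (IsMinOn.localize hmin) h3
    (mem_posTangentConeAt_of_segment_subset (y := u - z) (by
      rw [add_sub_cancel]; exact hXc.segment_subset hz hu))
  simpa using h4

theorem unique_proxCore (hn : 3 ≤ n) (hXc : Convex ℝ X) (hβ : 0 < β) {ζ x₀ z u : E n}
    (hz : z ∈ X) (hmin : IsMinOn (fun y : E n => inner ℝ ζ y + β * dgf (y - x₀)) X z)
    (hu : u ∈ X) (humin : IsMinOn (fun y : E n => inner ℝ ζ y + β * dgf (y - x₀)) X u) : z = u := by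
  have h1 := first_order_of_isMinOn hn hXc hz hmin hu
  have h2 := dgf_strongly_convex hn (z - x₀) (u - x₀)
  rw [sub_sub_sub_cancel_right] at h2
  have h3 : inner ℝ ζ u + β * dgf (u - x₀) ≤ inner ℝ ζ z + β * dgf (z - x₀) := humin hz
  rw [inner_sub_right] at h1
  have h4 := mul_le_mul_of_nonneg_left h2 hβ.le
  have h5 := norm_le_l1Norm (u - z)
  have h6 : β * (1 / 2 * l1Norm (u - z) ^ 2) ≤ 0 := by linarith
  have h7 : l1Norm (u - z) ^ 2 ≤ 0 := by
    by_contra! h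
    have : 0 < β * (1 / 2 * l1Norm (u - z) ^ 2) := by positivity
    linarith
  have h8 : l1Norm (u - z) = 0 := by
    have := sq_nonneg (l1Norm (u - z))
    exact pow_eq_zero_iff two_ne_zero |>.1 (le_antisymm h7 this)
  have h9 : u - z = 0 := norm_le_zero_iff.1 (h8 ▸ h5)
  exact (sub_eq_zero.1 h9).symm

/-- The graph of the minimizer is closed and, by uniqueness, projects injectively on the parameters.
The preimage of a Borel set is thus an injective continuous image of a Borel set, which is Borel by
the Lusin-Souslin theorem. -/
theorem measurable_proxCore (hn : 3 ≤ n) (hX : IsClosed X) (hXc : Convex ℝ X) (hne : X.Nonempty)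
    (hβ : 0 < β) : Measurable fun q : E n × E n => proxCore X β q.1 q.2 := by
  set Γ : Set ((E n × E n) × E n) := {r | r.2 ∈ X ∧
    IsMinOn (fun y : E n => inner ℝ r.1.1 y + β * dgf (y - r.1.2)) X r.2} with hΓ
  have hΓc : IsClosed Γ := by
    have hd := continuous_dgf hn
    have : Γ = (Prod.snd ⁻¹' X) ∩ ⋂ u ∈ X, {r | inner ℝ r.1.1 r.2 + β * dgf (r.2 - r.1.2)
        ≤ inner ℝ r.1.1 u + β * dgf (u - r.1.2)} := by
      ext r; simp [hΓ, isMinOn_iff]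
    rw [this]
    refine (hX.preimage continuous_snd).inter (isClosed_biInter fun u _ => ?_)
    exact isClosed_le (by fun_prop) (by fun_prop)
  intro B hB
  have hpre : (fun q : E n × E n => proxCore X β q.1 q.2) ⁻¹' B
      = Prod.fst '' (Γ ∩ Prod.snd ⁻¹' B) := by
    ext q
    constructor
    · intro hq
      exact ⟨(q, proxCore X β q.1 q.2), ⟨proxCore_spec hn hX hne hβ q.1 q.2, hq⟩, rfl⟩
    · rintro ⟨r, ⟨hr, hrB⟩, rfl⟩
      have hs := proxCore_spec hn hX hne hβ r.1.1 r.1.2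
      have : proxCore X β r.1.1 r.1.2 = r.2 := unique_proxCore hn hXc hβ hs.1 hs.2 hr.1 hr.2
      simp only [Set.mem_preimage, this]
      exact hrB
  rw [hpre]
  refine (hΓc.measurableSet.inter (measurable_snd hB)).image_of_continuousOn_injOn
    continuous_fst.continuousOn ?_
  rintro r ⟨hr, -⟩ r' ⟨hr', -⟩ heq
  refine Prod.ext heq ?_
  refine unique_proxCore hn hXc hβ hr.1 hr.2 hr'.1 ?_
  rw [show r.1 = r'.1 from heq]
  exact hr'.2

theorem measurable_prox (hn : 3 ≤ n) (hX : IsClosed X) (hXc : Convex ℝ X) (hne : X.Nonempty)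
    (hβ : 0 < β) {Ω : Type*} [MeasurableSpace Ω] {v x x₀ : Ω → E n} (hv : Measurable v)
    (hx : Measurable x) (hx₀ : Measurable x₀) :
    Measurable fun ω => prox X β (v ω) (x ω) (x₀ ω) := by
  have h0 : Measurable fun ω => gradient (dgf : E n → ℝ) (x ω - x₀ ω) :=
    measurable_gradient_dgf.comp (hx.sub hx₀)
  have h1 : Measurable fun ω => (v ω - β • gradient (dgf : E n → ℝ) (x ω - x₀ ω), x₀ ω) :=
    (hv.sub (h0.const_smul β)).prodMk hx₀
  have h2 := (measurable_proxCore hn hX hXc hne hβ).comp h1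
  have h3 : (fun ω => prox X β (v ω) (x ω) (x₀ ω)) = (fun q : E n × E n => proxCore X β q.1 q.2) ∘
      fun ω => (v ω - β • gradient (dgf : E n → ℝ) (x ω - x₀ ω), x₀ ω) :=
    funext fun ω => prox_eq_proxCore _ _ _
  rw [h3]
  exact h2

theorem prox_mem (hn : 3 ≤ n) (hX : IsClosed X) (hne : X.Nonempty) (hβ : 0 < β)
    (v x x₀ : E n) : prox X β v x x₀ ∈ X := by
  rw [prox_eq_proxCore]
  exact (proxCore_spec hn hX hne hβ _ _).1

/-- The three-point inequality of mirror descent. -/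
theorem prox_three_point (hn : 3 ≤ n) (hX : IsClosed X) (hXc : Convex ℝ X) (hβ : 0 < β)
    (v x x₀ : E n) {u : E n} (hu : u ∈ X) :
    inner ℝ v (prox X β v x x₀ - u) ≤ β * (bregman x₀ x u - bregman x₀ (prox X β v x x₀) u
      - bregman x₀ x (prox X β v x x₀)) := by
  rw [prox_eq_proxCore]
  set ζ := v - β • gradient (dgf : E n → ℝ) (x - x₀) with hζ
  obtain ⟨h1, h2⟩ := proxCore_spec hn hX ⟨u, hu⟩ hβ ζ x₀
  set z := proxCore X β ζ x₀
  have h3 := first_order_of_isMinOn hn hXc h1 h2 hu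
  rw [hζ] at h3
  simp only [bregman, inner_sub_left, inner_sub_right, inner_smul_left, conj_trivial] at h3 ⊢
  linarith

end Prox

/-! ### Cauchy-Schwarz and Minkowski inequalities for Bochner integrals -/

section CauchySchwarz

variable {α : Type*} [MeasurableSpace α] {μ : Measure α}

theorem integral_abs_mul_le_sqrt {F G : α → ℝ} (hF : MemLp F 2 μ) (hG : MemLp G 2 μ) :
    ∫ a, |F a| * |G a| ∂μ ≤ Real.sqrt (∫ a, F a ^ 2 ∂μ) * Real.sqrt (∫ a, G a ^ 2 ∂μ) := by
  have h := integral_mul_norm_le_Lp_mul_Lq (μ := μ) (f := F) (g := G) (p := 2) (q := 2)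
    Real.HolderConjugate.two_two (by simpa using hF) (by simpa using hG)
  simpa [Real.norm_eq_abs, Real.sqrt_eq_rpow] using h

theorem abs_integral_mul_le_sqrt {F G : α → ℝ} (hF : MemLp F 2 μ) (hG : MemLp G 2 μ) :
    |∫ a, F a * G a ∂μ| ≤ Real.sqrt (∫ a, F a ^ 2 ∂μ) * Real.sqrt (∫ a, G a ^ 2 ∂μ) := by
  refine (abs_integral_le_integral_abs).trans ?_
  simp only [abs_mul]
  exact integral_abs_mul_le_sqrt hF hG

theorem sqrt_integral_add_sq_le {F G : α → ℝ} (hF : MemLp F 2 μ) (hG : MemLp G 2 μ) :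
    Real.sqrt (∫ a, (F a + G a) ^ 2 ∂μ)
      ≤ Real.sqrt (∫ a, F a ^ 2 ∂μ) + Real.sqrt (∫ a, G a ^ 2 ∂μ) := by
  rw [Real.sqrt_le_left (by positivity)]
  have h1 : ∫ a, (F a + G a) ^ 2 ∂μ
      = ∫ a, F a ^ 2 ∂μ + 2 * ∫ a, F a * G a ∂μ + ∫ a, G a ^ 2 ∂μ := by
    have i1 := hF.integrable_sq
    have i2 : Integrable (fun a => F a * G a) μ := hF.integrable_mul hG
    have i3 := hG.integrable_sq
    rw [← integral_const_mul, ← integral_add i1 (i2.const_mul 2),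
      ← integral_add (by exact i1.add (i2.const_mul 2)) i3]
    refine integral_congr_ae (Filter.Eventually.of_forall fun a => ?_)
    simp only; ring
  have h2 := (abs_le.1 (abs_integral_mul_le_sqrt hF hG)).2
  have h3 := Real.sq_sqrt (integral_nonneg (μ := μ) fun a => sq_nonneg (F a))
  have h4 := Real.sq_sqrt (integral_nonneg (μ := μ) fun a => sq_nonneg (G a))
  rw [h1, add_sq]
  linarith

end CauchySchwarz

/-! ### Norm duality -/

section Duality

variable {n : ℕ}

theorem linfNorm_nonneg (x : E n) : 0 ≤ linfNorm x := norm_nonneg _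

theorem abs_coord_le_linfNorm (x : E n) (i : Fin n) : |x i| ≤ linfNorm x :=
  norm_le_pi_norm (WithLp.ofLp x) i

theorem linfNorm_le {x : E n} {r : ℝ} (hr : 0 ≤ r) (h : ∀ i, |x i| ≤ r) : linfNorm x ≤ r :=
  (pi_norm_le_iff_of_nonneg hr).2 h

theorem linfNorm_le_norm (x : E n) : linfNorm x ≤ ‖x‖ :=
  linfNorm_le (norm_nonneg _) fun i => PiLp.norm_apply_le x i

theorem linfNorm_add_le (x y : E n) : linfNorm (x + y) ≤ linfNorm x + linfNorm y :=
  norm_add_le (WithLp.ofLp x) (WithLp.ofLp y)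

theorem linfNorm_neg (x : E n) : linfNorm (-x) = linfNorm x := norm_neg (WithLp.ofLp x)

theorem linfNorm_smul (c : ℝ) (x : E n) : linfNorm (c • x) = |c| * linfNorm x :=
  norm_smul c (WithLp.ofLp x)

theorem continuous_linfNorm : Continuous (linfNorm : E n → ℝ) :=
  continuous_norm.comp (PiLp.continuous_ofLp 2 _)

theorem continuous_l1Norm : Continuous (l1Norm : E n → ℝ) := by
  unfold l1Norm
  fun_prop

theorem abs_inner_le (x y : E n) : |inner ℝ x y| ≤ linfNorm x * l1Norm y := by
  rw [PiLp.inner_apply, l1Norm, Finset.mul_sum]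
  refine (Finset.abs_sum_le_sum_abs _ _).trans (Finset.sum_le_sum fun i _ => ?_)
  simp only [RCLike.inner_apply, conj_trivial, abs_mul, mul_comm]
  gcongr
  exact abs_coord_le_linfNorm x i

theorem l1Norm_smul (c : ℝ) (x : E n) : l1Norm (c • x) = |c| * l1Norm x := by
  simp [l1Norm, abs_mul, Finset.mul_sum]

end Duality

/-! ### Smoothness of the objective -/

section Smoothness

variable {n : ℕ} {S : Setup n} {μφ : Measure (E n)} {μξ : Measure ℝ} {xs : E n}

theorem gradField_strongly_monotone (hS : S.Valid) (hL : LawAssumptions S μφ μξ) (x y : E n) :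
    S.kLow * ‖y - x‖ ^ 2 ≤ inner ℝ (gradField S μφ xs y - gradField S μφ xs x) (y - x) := by
  have h1 := (objective_bounds hS hL xs x y).1
  have h2 := (objective_bounds hS hL xs y x).1
  have h3 := kap_mul_norm_sq_le hL (y - x)
  have h4 := kap_mul_norm_sq_le hL (x - y)
  rw [norm_sub_rev x y] at h4
  have e : inner ℝ (gradField S μφ xs y) (x - y) = -inner ℝ (gradField S μφ xs y) (y - x) := by
    rw [← neg_sub, inner_neg_right]
  rw [e] at h2
  rw [inner_sub_left]
  have h5 := mul_le_mul_of_nonneg_left h3 (by linarith [hS.uLo_pos] : 0 ≤ S.uLo / 2)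
  have h6 := mul_le_mul_of_nonneg_left h4 (by linarith [hS.uLo_pos] : 0 ≤ S.uLo / 2)
  unfold Setup.kLow
  linarith

theorem SmoothCond.abs_inner_le (hS : S.Valid) (hL : LawAssumptions S μφ μξ)
    (h : SmoothCond S μφ μξ xs) {x y : E n} (hx : x ∈ S.X) (hy : y ∈ S.X) (d : E n) :
    |inner ℝ (gradField S μφ xs x - gradField S μφ xs y) d|
      ≤ S.nu * l1Norm (x - y) * l1Norm d := by
  have h1 := h x hx y hy
  rw [gradient_objective hS hL, gradient_objective hS hL] at h1
  exact (SparseGLM.abs_inner_le _ _).trans (mul_le_mul_of_nonneg_right h1 (l1Norm_nonneg d))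

/-- Along a coordinate vector the ℓ₁- and ℓ₂-norms agree, so strong monotonicity and smoothness can
be compared on a short such segment in X, which exists because X has interior. In particular ν > 0,
which is not among the assumptions. -/
theorem SmoothCond.kLow_le_nu (hn : 0 < n) (hS : S.Valid) (hL : LawAssumptions S μφ μξ)
    (h : SmoothCond S μφ μξ xs) : S.kLow ≤ S.nu := by
  obtain ⟨y, hy⟩ := hS.X_solid
  obtain ⟨r, hr, hball⟩ := Metric.isOpen_iff.1 isOpen_interior y hy
  set e : E n := EuclideanSpace.single ⟨0, hn⟩ (r / 2)
  have he : ‖e‖ = r / 2 := by simp [e, abs_of_pos hr]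
  have he1 : l1Norm e = r / 2 := by
    rw [l1Norm, Finset.sum_eq_single ⟨0, hn⟩]
    · simp only [e, PiLp.single_apply, if_true]
      exact abs_of_pos (by linarith)
    · intro b _ hb; simp [e, hb]
    · simp
  have hy' : y + e ∈ S.X := interior_subset (hball (by simp [he]; linarith))
  have h1 := gradField_strongly_monotone (xs := xs) hS hL y (y + e)
  have h2 := (abs_le.1 (h.abs_inner_le hS hL hy' (interior_subset hy) e)).2
  rw [add_sub_cancel_left] at h1 h2
  rw [he1] at h2
  rw [he] at h1
  have h3 : 0 < (r / 2) ^ 2 := by positivity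
  have h4 : S.kLow * (r / 2) ^ 2 ≤ S.nu * (r / 2) ^ 2 := by linarith
  exact le_of_mul_le_mul_right h4 h3

theorem SmoothCond.upper_bound (hS : S.Valid) (hL : LawAssumptions S μφ μξ)
    (h : SmoothCond S μφ μξ xs) {x y : E n} (hx : x ∈ S.X) (hy : y ∈ S.X) :
    objective S μφ μξ xs y ≤ objective S μφ μξ xs x + inner ℝ (gradField S μφ xs x) (y - x)
      + S.nu / 2 * l1Norm (y - x) ^ 2 := by
  set d := y - x with hd
  set K := S.nu * l1Norm d ^ 2 with hK
  have hder : ∀ t : ℝ, HasDerivAt (fun t : ℝ => objective S μφ μξ xs (x + t • d)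
      - t * inner ℝ (gradField S μφ xs x) d - K / 2 * t ^ 2)
      (inner ℝ (gradField S μφ xs (x + t • d)) d - inner ℝ (gradField S μφ xs x) d - K * t) t := by
    intro t
    have h2 : HasDerivAt (fun l : ℝ => x + l • d) d t := by
      simpa using ((hasDerivAt_id t).smul_const d).const_add x
    have h3 := HasFDerivAt.comp_hasDerivAt (x := t) (l := objective S μφ μξ xs)
      (f := fun l : ℝ => x + l • d) (hasGradientAt_objective hS hL xs (x + t • d)).hasFDerivAt h2
    have h4 := (h3.sub ((hasDerivAt_id t).mul_const (inner ℝ (gradField S μφ xs x) d))).sub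
      (((hasDerivAt_id t).pow 2).const_mul (K / 2))
    convert! h4 using 1
    simp; ring
  have hanti : AntitoneOn (fun t : ℝ => objective S μφ μξ xs (x + t • d)
      - t * inner ℝ (gradField S μφ xs x) d - K / 2 * t ^ 2) (Set.Icc 0 1) := by
    refine antitoneOn_of_deriv_nonpos (convex_Icc 0 1)
      (fun t _ => (hder t).continuousAt.continuousWithinAt)
      (fun t _ => (hder t).differentiableAt.differentiableWithinAt) fun t ht => ?_
    rw [interior_Icc] at ht
    rw [(hder t).deriv]
    have hmem : x + t • d ∈ S.X := by
      rw [hd]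
      exact hS.X_convex.add_smul_sub_mem hx hy ⟨ht.1.le, ht.2.le⟩
    have h5 := (abs_le.1 (h.abs_inner_le hS hL hmem hx d)).2
    rw [add_sub_cancel_left, l1Norm_smul, abs_of_pos ht.1, inner_sub_left] at h5
    rw [hK]
    linarith
  have h6 := hanti (Set.left_mem_Icc.2 zero_le_one) (Set.right_mem_Icc.2 zero_le_one) zero_le_one
  simp only [one_smul, zero_smul, add_zero, hd, add_sub_cancel] at h6
  rw [← hd] at h6
  rw [hK] at h6
  linarith

end Smoothness

/-! ### The law of an observation and the noise of the stochastic gradient -/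

section Noise

variable {n : ℕ} {S : Setup n} {μφ : Measure (E n)} {μξ : Measure ℝ} {xs : E n}

/-- The law of an observation `(φ, η)`. -/
def obsLaw (S : Setup n) (μφ : Measure (E n)) (μξ : Measure ℝ) (xs : E n) : Measure (E n × ℝ) :=
  (μφ.prod μξ).map fun w => (w.1, response S xs w.1 w.2)

theorem measurable_response (hS : S.Valid) (xs : E n) :
    Measurable fun w : E n × ℝ => (w.1, response S xs w.1 w.2) := by
  have hc := hS.continuous_u
  unfold response
  exact Continuous.measurable (by fun_prop)

theorem continuous_stochGrad (hS : S.Valid) :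
    Continuous fun q : E n × (E n × ℝ) => stochGrad S.u q.1 q.2 := by
  have hc := hS.continuous_u
  unfold stochGrad
  fun_prop

theorem isProbabilityMeasure_obsLaw (hS : S.Valid) (hL : LawAssumptions S μφ μξ) (xs : E n) :
    IsProbabilityMeasure (obsLaw S μφ μξ xs) := by
  have := hL.probφ
  have := hL.probξ
  exact Measure.isProbabilityMeasure_map (measurable_response hS xs).aemeasurable

theorem stochGrad_response (x f : E n) (e : ℝ) :
    stochGrad S.u x (f, response S xs f e)
      = (S.u (inner ℝ f x) - S.u (inner ℝ f xs) - S.sig * e) • f := by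
  simp only [stochGrad, response]
  congr 1; ring

theorem integral_obsLaw (hS : S.Valid) {F : E n × ℝ → ℝ} (hF : Measurable F) :
    ∫ w, F w ∂(obsLaw S μφ μξ xs)
      = ∫ w : E n × ℝ, F (w.1, response S xs w.1 w.2) ∂(μφ.prod μξ) :=
  integral_map (measurable_response hS xs).aemeasurable hF.aestronglyMeasurable

theorem integrable_obsLaw_iff (hS : S.Valid) {F : E n × ℝ → ℝ} (hF : Measurable F) :
    Integrable F (obsLaw S μφ μξ xs)
      ↔ Integrable (fun w : E n × ℝ => F (w.1, response S xs w.1 w.2)) (μφ.prod μξ) :=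
  integrable_map_measure hF.aestronglyMeasurable (measurable_response hS xs).aemeasurable

theorem measurable_inner_stochGrad (hS : S.Valid) (x z : E n) :
    Measurable fun w : E n × ℝ => inner ℝ (stochGrad S.u x w) z := by
  have h := (continuous_stochGrad hS).comp
    (by fun_prop : Continuous fun w : E n × ℝ => (x, w))
  exact (h.inner continuous_const).measurable

theorem integrable_inner_stochGrad (hS : S.Valid) (hL : LawAssumptions S μφ μξ) (x z : E n) :
    Integrable (fun w => inner ℝ (stochGrad S.u x w) z) (obsLaw S μφ μξ xs) := by
  have := hL.probφ
  have := hL.probξ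
  rw [integrable_obsLaw_iff hS (measurable_inner_stochGrad hS x z)]
  have i1 : Integrable (fun f : E n =>
      (S.u (inner ℝ f x) - S.u (inner ℝ f xs)) * inner ℝ f z) μφ :=
    (hL.memLp_u_sub hS x xs).integrable_mul (hL.memLp_inner z)
  have i2 : Integrable (fun w : E n × ℝ => inner ℝ w.1 z * (S.sig * w.2)) (μφ.prod μξ) :=
    ((hL.memLp_inner z).integrable one_le_two).mul_prod
      ((hL.memLpξ.integrable one_le_two).const_mul S.sig)
  refine ((i1.comp_fst μξ).sub i2).congr (Filter.Eventually.of_forall fun w => ?_)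
  simp only [stochGrad_response, inner_smul_left, conj_trivial, Pi.sub_apply]
  ring

theorem integral_inner_stochGrad (hS : S.Valid) (hL : LawAssumptions S μφ μξ) (x z : E n) :
    ∫ w, inner ℝ (stochGrad S.u x w) z ∂(obsLaw S μφ μξ xs) = inner ℝ (gradField S μφ xs x) z := by
  have := hL.probφ
  have := hL.probξ
  rw [integral_obsLaw hS (measurable_inner_stochGrad hS x z), inner_gradField hS hL]
  have i1 : Integrable (fun f : E n =>
      (S.u (inner ℝ f x) - S.u (inner ℝ f xs)) * inner ℝ f z) μφ :=
    (hL.memLp_u_sub hS x xs).integrable_mul (hL.memLp_inner z)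
  have i2 : Integrable (fun w : E n × ℝ => inner ℝ w.1 z * (S.sig * w.2)) (μφ.prod μξ) :=
    ((hL.memLp_inner z).integrable one_le_two).mul_prod
      ((hL.memLpξ.integrable one_le_two).const_mul S.sig)
  have h : ∀ w : E n × ℝ, inner ℝ (stochGrad S.u x (w.1, response S xs w.1 w.2)) z
      = (S.u (inner ℝ w.1 x) - S.u (inner ℝ w.1 xs)) * inner ℝ w.1 z
        - inner ℝ w.1 z * (S.sig * w.2) := fun w => by
    simp only [stochGrad_response, inner_smul_left, conj_trivial]
    ring
  simp_rw [h]
  rw [integral_sub (i1.comp_fst μξ) i2,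
    integral_prod_mul (fun f : E n => inner ℝ f z) (fun e : ℝ => S.sig * e),
    integral_const_mul, hL.meanξ, mul_zero, mul_zero, sub_zero,
    integral_fun_fst (μ := μφ) (ν := μξ)
      (fun f : E n => (S.u (inner ℝ f x) - S.u (inner ℝ f xs)) * inner ℝ f z)]
  simp

/-- Cauchy-Schwarz in each coordinate, with E φ_i² = Σ_ii ≤ υ; this accounts for the middle summand
of `VarianceCond`. -/
theorem linfNorm_gradField_le (hS : S.Valid) (hL : LawAssumptions S μφ μξ) (x : E n) :
    linfNorm (gradField S μφ xs x)
      ≤ S.uHi * Real.sqrt S.ups * matNorm (secondMoment μφ) (x - xs) := by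
  have hm := matNorm_nonneg (secondMoment μφ) (x - xs)
  have hu := hS.uHi_pos
  refine linfNorm_le (by positivity) fun i => ?_
  have h1 : (gradField S μφ xs x) i
      = ∫ f, (S.u (inner ℝ f x) - S.u (inner ℝ f xs)) * f i ∂μφ := by
    have := inner_gradField hS hL xs x (EuclideanSpace.single i 1)
    simpa [EuclideanSpace.inner_single_right] using this
  have h2 : Real.sqrt (∫ f, (f i) ^ 2 ∂μφ) ≤ Real.sqrt S.ups := by
    refine Real.sqrt_le_sqrt ?_
    have := (le_abs_self _).trans (hL.upper i i)
    simpa [secondMoment, sq] using this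
  have h3 : Real.sqrt (∫ f, (S.u (inner ℝ f x) - S.u (inner ℝ f xs)) ^ 2 ∂μφ)
      ≤ S.uHi * matNorm (secondMoment μφ) (x - xs) := by
    rw [Real.sqrt_le_left (by positivity), mul_pow, matNorm_sq_eq_integral hL,
      ← integral_const_mul]
    refine integral_mono (hL.memLp_u_sub hS x xs).integrable_sq
      ((hL.memLp_inner (x - xs)).integrable_sq.const_mul _) fun f => ?_
    have := hS.abs_u_sub_le (inner ℝ f x) (inner ℝ f xs)
    simp only [inner_sub_right, ← mul_pow]
    rw [← abs_of_pos hu, ← abs_mul] at this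
    exact sq_le_sq.2 this
  rw [h1]
  refine (abs_integral_mul_le_sqrt (hL.memLp_u_sub hS x xs) (hL.memLp_coord i)).trans ?_
  calc _ ≤ S.uHi * matNorm (secondMoment μφ) (x - xs) * Real.sqrt S.ups := by gcongr
    _ = _ := by ring

theorem integrable_linfNorm_sq (hL : LawAssumptions S μφ μξ) :
    Integrable (fun f : E n => linfNorm f ^ 2) μφ := by
  refine hL.memLpφ.integrable_norm_pow two_ne_zero |>.mono'
    (continuous_linfNorm.pow 2).aestronglyMeasurable (Filter.Eventually.of_forall fun f => ?_)
  rw [Real.norm_eq_abs, abs_of_nonneg (sq_nonneg _)]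
  have := linfNorm_nonneg f
  gcongr
  exact linfNorm_le_norm f

/-- The squared `ℓ_∞`-norm of the noise of the stochastic gradient is integrable, and its mean is
controlled by the excess. -/
theorem noise_sq_bound (hS : S.Valid) (hL : LawAssumptions S μφ μξ) (hxs : xs ∈ S.X)
    (hV : VarianceCond S μφ μξ xs) {x : E n} (hx : x ∈ S.X) :
    Integrable (fun w => linfNorm (stochGrad S.u x w - gradField S μφ xs x) ^ 2)
      (obsLaw S μφ μξ xs) ∧
    ∫ w, linfNorm (stochGrad S.u x w - gradField S μφ xs x) ^ 2 ∂(obsLaw S μφ μξ xs)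
      ≤ S.vk * S.nu * excess S μφ μξ xs x + S.vk' * S.varStar := by
  have := hL.probφ
  have := hL.probξ
  obtain ⟨hint, hbound⟩ := hV x hx
  have hcont : Continuous fun w : E n × ℝ =>
      linfNorm (stochGrad S.u x w - gradField S μφ xs x) ^ 2 := by
    have h := (continuous_stochGrad hS).comp
      (by fun_prop : Continuous fun w : E n × ℝ => (x, w))
    exact (continuous_linfNorm.comp (h.sub continuous_const)).pow 2
  have hu := hS.uHi_pos
  have hsig := hS.sig_nonneg
  set B := S.uHi * Real.sqrt S.ups * matNorm (secondMoment μφ) (x - xs) with hB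
  have hB0 : 0 ≤ B := by
    have hm := matNorm_nonneg (secondMoment μφ) (x - xs)
    positivity
  -- A, B and C dominate the model error, the mean gradient and the observation noise. Minkowski's
  -- inequality for A + B + C produces the three summands squared in `VarianceCond`.
  set A : E n × ℝ → ℝ := fun w => S.uHi * (linfNorm w.1 * |inner ℝ w.1 (x - xs)|) with hA
  set C : E n × ℝ → ℝ := fun w => linfNorm w.1 * (S.sig * |w.2|) with hC
  have hlc : Continuous fun w : E n × ℝ => linfNorm w.1 := continuous_linfNorm.comp continuous_fst
  have hAc : Continuous A := by fun_prop
  have hCc : Continuous C := by fun_prop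
  have hAsq : ∀ w, A w ^ 2 = S.uHi ^ 2 * (linfNorm w.1 ^ 2 * inner ℝ w.1 (x - xs) ^ 2) := fun w => by
    simp only [hA, mul_pow, sq_abs]
  have hCsq : ∀ w, C w ^ 2 = linfNorm w.1 ^ 2 * (S.sig ^ 2 * w.2 ^ 2) := fun w => by
    simp only [hC, mul_pow, sq_abs]
  have hAi : Integrable (fun w => A w ^ 2) (μφ.prod μξ) := by
    simp only [hAsq]
    exact (hint.comp_fst μξ).const_mul _
  have hCi : Integrable (fun w => C w ^ 2) (μφ.prod μξ) := by
    simp only [hCsq]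
    exact (integrable_linfNorm_sq hL).mul_prod (hL.memLpξ.integrable_sq.const_mul _)
  have hA2 : MemLp A 2 (μφ.prod μξ) :=
    (memLp_two_iff_integrable_sq hAc.aestronglyMeasurable).2 hAi
  have hC2 : MemLp C 2 (μφ.prod μξ) :=
    (memLp_two_iff_integrable_sq hCc.aestronglyMeasurable).2 hCi
  have hB2 : MemLp (fun _ : E n × ℝ => B) 2 (μφ.prod μξ) := memLp_const B
  have hAval : Real.sqrt (∫ w, A w ^ 2 ∂(μφ.prod μξ))
      = S.uHi * Real.sqrt (∫ f : E n, linfNorm f ^ 2 * (inner ℝ f (x - xs)) ^ 2 ∂μφ) := by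
    simp only [hAsq]
    rw [integral_const_mul, integral_fun_fst (μ := μφ) (ν := μξ)
      (fun f : E n => linfNorm f ^ 2 * inner ℝ f (x - xs) ^ 2), Real.sqrt_mul (sq_nonneg _),
      Real.sqrt_sq hu.le]
    simp
  have hCval : Real.sqrt (∫ w, C w ^ 2 ∂(μφ.prod μξ))
      ≤ Real.sqrt (∫ f, linfNorm f ^ 2 ∂μφ) * S.sig := by
    simp only [hCsq]
    rw [integral_prod_mul (fun f : E n => linfNorm f ^ 2) (fun e : ℝ => S.sig ^ 2 * e ^ 2),
      integral_const_mul, Real.sqrt_mul (integral_nonneg fun f => sq_nonneg _)]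
    refine mul_le_mul_of_nonneg_left ?_ (Real.sqrt_nonneg _)
    rw [Real.sqrt_le_left hsig]
    exact mul_le_of_le_one_right (sq_nonneg _) hL.varξ
  have hBval : Real.sqrt (∫ _w : E n × ℝ, B ^ 2 ∂(μφ.prod μξ)) = B := by
    simp [Real.sqrt_sq hB0]
  have hptw : ∀ w : E n × ℝ,
      linfNorm (stochGrad S.u x (w.1, response S xs w.1 w.2) - gradField S μφ xs x)
        ≤ A w + B + C w := by
    intro w
    rw [stochGrad_response, sub_eq_add_neg]
    refine (linfNorm_add_le _ _).trans ?_
    rw [linfNorm_neg, linfNorm_smul]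
    have h1 := linfNorm_gradField_le (xs := xs) hS hL x
    have h2 : |S.u (inner ℝ w.1 x) - S.u (inner ℝ w.1 xs) - S.sig * w.2|
        ≤ S.uHi * |inner ℝ w.1 (x - xs)| + S.sig * |w.2| := by
      refine (abs_sub _ _).trans ?_
      rw [abs_mul, abs_of_nonneg hsig, inner_sub_right]
      exact add_le_add_left (hS.abs_u_sub_le _ _) _
    have h3 := mul_le_mul_of_nonneg_right h2 (linfNorm_nonneg w.1)
    simp only [hA, hC]
    linarith
  have hsum2 : MemLp (fun w => A w + B + C w) 2 (μφ.prod μξ) := (hA2.add hB2).add hC2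
  have hle : ∀ w : E n × ℝ,
      linfNorm (stochGrad S.u x (w.1, response S xs w.1 w.2) - gradField S μφ xs x) ^ 2
        ≤ (A w + B + C w) ^ 2 := fun w => by
    have := linfNorm_nonneg (stochGrad S.u x (w.1, response S xs w.1 w.2) - gradField S μφ xs x)
    exact pow_le_pow_left₀ this (hptw w) 2
  have hI : Integrable (fun w : E n × ℝ =>
      linfNorm (stochGrad S.u x (w.1, response S xs w.1 w.2) - gradField S μφ xs x) ^ 2)
      (μφ.prod μξ) := by
    refine hsum2.integrable_sq.mono'
      (hcont.measurable.comp (measurable_response hS xs)).aestronglyMeasurable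
      (Filter.Eventually.of_forall fun w => ?_)
    rw [Real.norm_eq_abs, abs_of_nonneg (sq_nonneg _)]
    exact hle w
  refine ⟨(integrable_obsLaw_iff hS hcont.measurable).2 hI, ?_⟩
  rw [integral_obsLaw hS hcont.measurable]
  refine (integral_mono hI hsum2.integrable_sq hle).trans ?_
  have h1 := sqrt_integral_add_sq_le (hA2.add hB2) hC2
  have h2 := sqrt_integral_add_sq_le hA2 hB2
  rw [hBval, hAval] at h2
  rw [optValue_eq hS hL hxs, ← excess] at hbound
  refine le_trans ?_ hbound
  rw [← Real.sqrt_le_left (by positivity)]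
  simp only [Pi.add_apply] at h1
  linarith

/-- The second moment of the noisy directional derivative. -/
theorem directional_sq_bound (hS : S.Valid) (hL : LawAssumptions S μφ μξ)
    (hF : FourthMomentCond S μφ xs) {x : E n} (hx : x ∈ S.X) (z : E n) :
    MemLp (fun w => inner ℝ (stochGrad S.u x w) z) 2 (obsLaw S μφ μξ xs) ∧
    ∫ w, inner ℝ (stochGrad S.u x w) z ^ 2 ∂(obsLaw S μφ μξ xs)
      ≤ S.chi * (S.uHi * sigma1 (secondMoment μφ)) * ‖z‖ ^ 2 * excess S μφ μξ xs x
        + S.sig ^ 2 * matNorm (secondMoment μφ) z ^ 2 := by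
  have := hL.probφ
  have := hL.probξ
  obtain ⟨hint, hbound⟩ := hF x hx z
  have hu := hS.uHi_pos
  have hul := hS.uLo_pos
  have hmeas := measurable_inner_stochGrad hS x z
  set A : E n → ℝ := fun f => (S.u (inner ℝ f x) - S.u (inner ℝ f xs)) * inner ℝ f z with hA
  have hAc : Continuous A := by have := hS.continuous_u; fun_prop
  have hAle : ∀ f, A f ^ 2 ≤ S.uHi ^ 2 * (inner ℝ z f ^ 2 * inner ℝ f (x - xs) ^ 2) := fun f => by
    have h1 := hS.abs_u_sub_le (inner ℝ f x) (inner ℝ f xs)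
    have h2 : (S.u (inner ℝ f x) - S.u (inner ℝ f xs)) ^ 2
        ≤ (S.uHi * (inner ℝ f x - inner ℝ f xs)) ^ 2 :=
      sq_le_sq.2 (by rwa [abs_mul, abs_of_pos hu])
    simp only [hA, mul_pow, inner_sub_right, real_inner_comm z f] at h2 ⊢
    nlinarith [mul_le_mul_of_nonneg_right h2 (sq_nonneg (inner ℝ z f : ℝ))]
  have hAi : Integrable (fun f => A f ^ 2) μφ := by
    refine (hint.const_mul (S.uHi ^ 2)).mono' (hAc.pow 2).aestronglyMeasurable
      (Filter.Eventually.of_forall fun f => ?_)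
    rw [Real.norm_eq_abs, abs_of_nonneg (sq_nonneg _)]
    exact hAle f
  have hA2 : MemLp A 2 μφ := (memLp_two_iff_integrable_sq hAc.aestronglyMeasurable).2 hAi
  have hz2 := hL.memLp_inner z
  have i1 := hAi.comp_fst μξ
  have i2 : Integrable (fun w : E n × ℝ => (A w.1 * inner ℝ w.1 z) * (2 * S.sig * w.2))
      (μφ.prod μξ) :=
    (hA2.integrable_mul hz2).mul_prod ((hL.memLpξ.integrable one_le_two).const_mul _)
  have i3 : Integrable (fun w : E n × ℝ => inner ℝ w.1 z ^ 2 * (S.sig ^ 2 * w.2 ^ 2))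
      (μφ.prod μξ) :=
    hz2.integrable_sq.mul_prod (hL.memLpξ.integrable_sq.const_mul _)
  have hexp : ∀ w : E n × ℝ, inner ℝ (stochGrad S.u x (w.1, response S xs w.1 w.2)) z ^ 2
      = A w.1 ^ 2 - (A w.1 * inner ℝ w.1 z) * (2 * S.sig * w.2)
        + inner ℝ w.1 z ^ 2 * (S.sig ^ 2 * w.2 ^ 2) := fun w => by
    simp only [stochGrad_response, inner_smul_left, conj_trivial, hA]
    ring
  have hI : Integrable (fun w : E n × ℝ =>
      inner ℝ (stochGrad S.u x (w.1, response S xs w.1 w.2)) z ^ 2) (μφ.prod μξ) := by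
    simp only [hexp]
    exact (i1.sub i2).add i3
  constructor
  · rw [memLp_two_iff_integrable_sq hmeas.aestronglyMeasurable]
    exact (integrable_obsLaw_iff hS (hmeas.pow_const 2)).2 hI
  rw [integral_obsLaw hS (hmeas.pow_const 2)]
  simp_rw [hexp]
  -- The cross term is linear in ξ and independent of it otherwise, so it integrates to zero.
  rw [integral_add (by exact i1.sub i2) i3, integral_sub i1 i2,
    integral_prod_mul (fun f : E n => A f * inner ℝ f z) (fun e : ℝ => 2 * S.sig * e),
    integral_const_mul, hL.meanξ, mul_zero, mul_zero, sub_zero,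
    integral_prod_mul (fun f : E n => inner ℝ f z ^ 2) (fun e : ℝ => S.sig ^ 2 * e ^ 2),
    integral_const_mul, integral_fun_fst (μ := μφ) (ν := μξ) (fun f : E n => A f ^ 2),
    ← matNorm_sq_eq_integral hL]
  simp only [probReal_univ, one_smul]
  refine add_le_add ?_ ?_
  · have h1 : ∫ f, A f ^ 2 ∂μφ
        ≤ S.uHi ^ 2 * ∫ f, inner ℝ z f ^ 2 * inner ℝ f (x - xs) ^ 2 ∂μφ := by
      rw [← integral_const_mul]
      exact integral_mono hAi (hint.const_mul _) hAle
    have h2 := (excess_bounds hS hL xs x).1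
    have h3 := sigma1_nonneg (secondMoment μφ)
    have hchi : 0 < S.chi := by linarith [hS.one_le_chi]
    calc ∫ f, A f ^ 2 ∂μφ
        ≤ S.uHi * S.uLo * (S.uLo⁻¹ * S.uHi
          * ∫ f, inner ℝ z f ^ 2 * inner ℝ f (x - xs) ^ 2 ∂μφ) := by
          refine h1.trans_eq ?_; field_simp
      _ ≤ S.uHi * S.uLo * (1 / 2 * S.chi * ‖z‖ ^ 2 * sigma1 (secondMoment μφ)
          * matNorm (secondMoment μφ) (x - xs) ^ 2) := by gcongr
      _ = S.chi * (S.uHi * sigma1 (secondMoment μφ)) * ‖z‖ ^ 2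
          * (S.uLo / 2 * matNorm (secondMoment μφ) (x - xs) ^ 2) := by ring
      _ ≤ _ := by gcongr
  · have h1 := mul_le_of_le_one_right (sq_nonneg S.sig) hL.varξ
    have := mul_le_mul_of_nonneg_left h1 (sq_nonneg (matNorm (secondMoment μφ) z))
    linarith

end Noise

/-! ### Integrals of functions of independent arguments -/

section Independence

variable {Ω A B : Type*} [MeasurableSpace Ω] [MeasurableSpace A] [MeasurableSpace B]
  {P : Measure Ω} [IsProbabilityMeasure P] {H : Ω → A} {W : Ω → B} {π : Measure B}

theorem map_prodMk_of_indepFun (hH : Measurable H) (hW : Measurable W) (hind : IndepFun H W P)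
    (hlaw : P.map W = π) : P.map (fun ω => (H ω, W ω)) = (P.map H).prod π := by
  rw [(indepFun_iff_map_prod_eq_prod_map_map hH.aemeasurable hW.aemeasurable).1 hind, hlaw]

/-- By Fubini, H may be frozen while W is averaged out. The bound by k is required only on X because
the gradient noise is controlled only at points of the domain, where the iterates live. -/
theorem integrable_of_indepFun [IsProbabilityMeasure π] (hH : Measurable H) (hW : Measurable W)
    (hind : IndepFun H W P) (hlaw : P.map W = π) {X : Set A} (hX : MeasurableSet X) (hHX : ∀ ω, H ω ∈ X) {f : A × B → ℝ}
    (hf : Measurable f) (hf0 : ∀ q, 0 ≤ f q) {k : A → ℝ} (hk : Integrable (fun ω => k (H ω)) P)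
    (hkm : Measurable k)
    (hint : ∀ a ∈ X, Integrable (fun b => f (a, b)) π ∧ ∫ b, f (a, b) ∂π ≤ k a) :
    Integrable (fun ω => f (H ω, W ω)) P ∧ ∫ ω, f (H ω, W ω) ∂P ≤ ∫ ω, k (H ω) ∂P := by
  have : IsProbabilityMeasure (P.map H) := Measure.isProbabilityMeasure_map hH.aemeasurable
  have hlaw' := map_prodMk_of_indepFun hH hW hind hlaw
  have hXae : ∀ᵐ a ∂(P.map H), a ∈ X :=
    (ae_map_iff hH.aemeasurable hX).2 (Filter.Eventually.of_forall hHX)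
  have hkI : Integrable k (P.map H) :=
    (integrable_map_measure hkm.aestronglyMeasurable hH.aemeasurable).2 hk
  have hI : Integrable f ((P.map H).prod π) := by
    rw [integrable_prod_iff hf.aestronglyMeasurable]
    refine ⟨hXae.mono fun a ha => (hint a ha).1, ?_⟩
    refine hkI.mono' ?_ (hXae.mono fun a ha => ?_)
    · exact (hf.norm.stronglyMeasurable.integral_prod_right').aestronglyMeasurable
    · simp only [Real.norm_eq_abs, abs_of_nonneg (hf0 _)]
      rw [abs_of_nonneg (integral_nonneg fun b => hf0 _)]
      exact (hint a ha).2
  have hpair : Measurable fun ω => (H ω, W ω) := hH.prodMk hW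
  constructor
  · rw [← hlaw'] at hI
    exact (integrable_map_measure hf.aestronglyMeasurable hpair.aemeasurable).1 hI
  · have e1 : ∫ ω, f (H ω, W ω) ∂P = ∫ q, f q ∂((P.map H).prod π) := by
      rw [← hlaw', integral_map hpair.aemeasurable hf.aestronglyMeasurable]
    have e2 : ∫ ω, k (H ω) ∂P = ∫ a, k a ∂(P.map H) := by
      rw [integral_map hH.aemeasurable hkm.aestronglyMeasurable]
    rw [e1, e2, integral_prod _ hI]
    exact integral_mono_ae hI.integral_prod_left hkI (hXae.mono fun a ha => (hint a ha).2)

theorem integral_eq_zero_of_indepFun [IsProbabilityMeasure π] (hH : Measurable H) (hW : Measurable W)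
    (hind : IndepFun H W P) (hlaw : P.map W = π) {f : A × B → ℝ} (hf : Measurable f)
    (hI : Integrable (fun ω => f (H ω, W ω)) P) (hint : ∀ a, ∫ b, f (a, b) ∂π = 0) :
    ∫ ω, f (H ω, W ω) ∂P = 0 := by
  have : IsProbabilityMeasure (P.map H) := Measure.isProbabilityMeasure_map hH.aemeasurable
  have hlaw' := map_prodMk_of_indepFun hH hW hind hlaw
  have hpair : Measurable fun ω => (H ω, W ω) := hH.prodMk hW
  have hI' : Integrable f ((P.map H).prod π) := by
    rw [← hlaw']
    exact (integrable_map_measure hf.aestronglyMeasurable hpair.aemeasurable).2 hI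
  have e1 : ∫ ω, f (H ω, W ω) ∂P = ∫ q, f q ∂((P.map H).prod π) := by
    rw [← hlaw', integral_map hpair.aemeasurable hf.aestronglyMeasurable]
  rw [e1, integral_prod _ hI']
  simp [hint]

end Independence

/-! ### A stage of stochastic mirror descent -/

section Stage

variable {n : ℕ} {S : Setup n} {μφ : Measure (E n)} {μξ : Measure ℝ} {xs : E n}

theorem Setup.Valid.X_nonempty (hS : S.Valid) : S.X.Nonempty := ⟨_, hS.x₀_mem⟩

theorem excess_le_l1Norm_sq (hS : S.Valid) (hL : LawAssumptions S μφ μξ) (hxs : xs ∈ S.X)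
    (hsm : SmoothCond S μφ μξ xs) {x : E n} (hx : x ∈ S.X) :
    excess S μφ μξ xs x ≤ S.nu / 2 * l1Norm (x - xs) ^ 2 := by
  have := hsm.upper_bound hS hL hxs hx
  rw [gradField_self, inner_zero_left] at this
  unfold excess
  linarith

/-- Each coordinate is Lipschitz by Cauchy-Schwarz and the Lipschitz bound on u. Continuity serves
to make the gradient noise measurable jointly in the point and the observation. -/
theorem continuous_gradField (hS : S.Valid) (hL : LawAssumptions S μφ μξ) :
    Continuous fun x : E n => gradField S μφ xs x := by
  have h1 : ∀ i, Continuous fun x : E n => gradField S μφ xs x i := by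
    intro i
    rw [Metric.continuous_iff]
    intro x ε hε
    refine ⟨ε / (S.uHi * sigma1 (secondMoment μφ) + 1), ?_, fun x' hx' => ?_⟩
    · have := hS.uHi_pos; have := sigma1_nonneg (secondMoment μφ); positivity
    have hσ := sigma1_nonneg (secondMoment μφ)
    have hu := hS.uHi_pos
    have hco : ∀ x : E n, (gradField S μφ xs x) i
        = ∫ f, (S.u (inner ℝ f x) - S.u (inner ℝ f xs)) * f i ∂μφ := fun x => by
      have := inner_gradField hS hL xs x (EuclideanSpace.single i 1)
      simpa [EuclideanSpace.inner_single_right] using this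
    have h2 : (gradField S μφ xs x') i - (gradField S μφ xs x) i
        = ∫ f, (S.u (inner ℝ f x') - S.u (inner ℝ f x)) * f i ∂μφ := by
      rw [hco, hco, ← integral_sub
        (by exact (hL.memLp_u_sub hS x' xs).integrable_mul (hL.memLp_coord i))
        (by exact (hL.memLp_u_sub hS x xs).integrable_mul (hL.memLp_coord i))]
      refine integral_congr_ae (Filter.Eventually.of_forall fun f => ?_)
      simp only; ring
    have h3 : Real.sqrt (∫ f, (S.u (inner ℝ f x') - S.u (inner ℝ f x)) ^ 2 ∂μφ)
        ≤ S.uHi * (Real.sqrt (sigma1 (secondMoment μφ)) * ‖x' - x‖) := by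
      have h4 := matNorm_sq_le_sigma1 hL (x' - x)
      rw [Real.sqrt_le_left (by positivity), mul_pow, mul_pow, Real.sq_sqrt hσ]
      refine le_trans ?_ (mul_le_mul_of_nonneg_left h4 (sq_nonneg S.uHi))
      rw [matNorm_sq_eq_integral hL, ← integral_const_mul]
      refine integral_mono (hL.memLp_u_sub hS x' x).integrable_sq
        ((hL.memLp_inner (x' - x)).integrable_sq.const_mul _) fun f => ?_
      have := hS.abs_u_sub_le (inner ℝ f x') (inner ℝ f x)
      simp only [inner_sub_right, ← mul_pow]
      rw [← abs_of_pos hu, ← abs_mul] at this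
      exact sq_le_sq.2 this
    have h5 : Real.sqrt (∫ f, (f i) ^ 2 ∂μφ) ≤ Real.sqrt (sigma1 (secondMoment μφ)) := by
      refine Real.sqrt_le_sqrt ?_
      have := matNorm_sq_le_sigma1 hL (EuclideanSpace.single i (1 : ℝ))
      rw [matNorm_sq_eq_integral hL] at this
      simpa [EuclideanSpace.inner_single_right] using this
    have h6 := abs_integral_mul_le_sqrt (hL.memLp_u_sub hS x' x) (hL.memLp_coord i)
    rw [Real.dist_eq, h2]
    rw [dist_eq_norm, lt_div_iff₀ (by positivity)] at hx'
    have h7 : Real.sqrt (∫ f, (S.u (inner ℝ f x') - S.u (inner ℝ f x)) ^ 2 ∂μφ)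
        * Real.sqrt (∫ f, (f i) ^ 2 ∂μφ)
        ≤ S.uHi * (Real.sqrt (sigma1 (secondMoment μφ)) * ‖x' - x‖)
          * Real.sqrt (sigma1 (secondMoment μφ)) := by gcongr
    have h8 := Real.mul_self_sqrt hσ
    have h9 : S.uHi * (Real.sqrt (sigma1 (secondMoment μφ)) * ‖x' - x‖)
          * Real.sqrt (sigma1 (secondMoment μφ)) = ‖x' - x‖ * (S.uHi * sigma1 (secondMoment μφ)) := by
      linear_combination S.uHi * ‖x' - x‖ * h8
    have h10 := norm_nonneg (x' - x)
    linarith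
  have h2 : (fun x : E n => gradField S μφ xs x)
      = fun x => WithLp.toLp 2 (fun i => gradField S μφ xs x i) := rfl
  rw [h2]
  exact (PiLp.continuous_toLp 2 _).comp (continuous_pi h1)

/-- One step of stochastic mirror descent. -/
theorem smd_step (hn : 3 ≤ n) (hS : S.Valid) (hL : LawAssumptions S μφ μξ) (hxs : xs ∈ S.X)
    (hsm : SmoothCond S μφ μξ xs) {β : ℝ} (hβ : 2 * S.nu ≤ β) (x₀ : E n) {x : E n} (hx : x ∈ S.X)
    (w : E n × ℝ) :
    excess S μφ μξ xs (prox S.X β (stochGrad S.u x w) x x₀)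
        + β * bregman x₀ (prox S.X β (stochGrad S.u x w) x x₀) xs
      ≤ β * bregman x₀ x xs
        - inner ℝ (stochGrad S.u x w - gradField S μφ xs x) (x - xs)
        + linfNorm (stochGrad S.u x w - gradField S μφ xs x) ^ 2 / β := by
  have hnu : 0 < S.nu := hS.kLow_pos.trans_le (hsm.kLow_le_nu (by omega) hS hL)
  have hβ0 : 0 < β := by linarith
  set v := stochGrad S.u x w with hv
  set z := prox S.X β v x x₀ with hz
  have hzX : z ∈ S.X := prox_mem hn hS.X_closed hS.X_nonempty hβ0 v x x₀
  have h1 := prox_three_point hn hS.X_closed hS.X_convex hβ0 v x x₀ hxs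
  rw [← hz] at h1
  have h2 := bregman_ge hn x₀ x z
  have h3 := hsm.upper_bound hS hL hx hzX
  have h4 := objective_gradient_le hS hL xs x xs
  set δ := v - gradField S μφ xs x with hδ
  have h5 := (abs_le.1 (abs_inner_le δ (z - x))).1
  set q := l1Norm (z - x)
  set a := linfNorm δ
  -- Strong convexity supplies βV ≥ (β/2)q². One half of it pays for the noise term here; the other
  -- pays for the smoothness term (ν/2)q², as ν ≤ β/2.
  have h6 : a * q ≤ a ^ 2 / β + β / 4 * q ^ 2 := by
    have e : a ^ 2 / β + β / 4 * q ^ 2 - a * q = (a - β / 2 * q) ^ 2 / β := by field_simp; ring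
    have : 0 ≤ (a - β / 2 * q) ^ 2 / β := by positivity
    linarith
  have e1 : inner ℝ v (z - xs) = inner ℝ δ (z - x) + inner ℝ δ (x - xs)
      + inner ℝ (gradField S μφ xs x) (z - x) - inner ℝ (gradField S μφ xs x) (xs - x) := by
    simp only [hδ, inner_sub_left, inner_sub_right]; ring
  have h7 := mul_le_mul_of_nonneg_left h2 hβ0.le
  have h8 : S.nu / 2 * q ^ 2 ≤ β / 4 * q ^ 2 := by
    have : 0 ≤ q ^ 2 := sq_nonneg _
    nlinarith
  unfold excess
  rw [e1] at h1
  linarith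

variable {Ω : Type*} [MeasurableSpace Ω] {P : Measure Ω} [IsProbabilityMeasure P]

theorem smdIter_mem (hn : 3 ≤ n) (hS : S.Valid) {β : ℝ} (hβ : 0 < β) {y : E n} (hy : y ∈ S.X)
    (w : ℕ → E n × ℝ) (i : ℕ) : smdIter S β y w i ∈ S.X := by
  cases i with
  | zero => exact hy
  | succ i => exact prox_mem hn hS.X_closed hS.X_nonempty hβ _ _ _

theorem measurable_stochGrad (hS : S.Valid) {x : Ω → E n} {w : Ω → E n × ℝ} (hx : Measurable x)
    (hw : Measurable w) : Measurable fun ω => stochGrad S.u (x ω) (w ω) := by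
  have hc := hS.continuous_u.measurable
  unfold stochGrad
  have h1 : Measurable fun ω => inner ℝ (w ω).1 (x ω) := hw.fst.inner hx
  exact ((hc.comp h1).sub hw.snd).smul hw.fst

theorem measurable_smdIter (hn : 3 ≤ n) (hS : S.Valid) {β : ℝ} (hβ : 0 < β) {y : Ω → E n}
    (hy : Measurable y) {w : ℕ → Ω → E n × ℝ} (hw : ∀ i, Measurable (w i)) (i : ℕ) :
    Measurable fun ω => smdIter S β (y ω) (fun j => w j ω) i := by
  induction i with
  | zero => exact hy
  | succ i ih =>
    simp only [smdIter]
    have h2 := measurable_stochGrad hS ih (hw i)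
    exact measurable_prox hn hS.X_closed hS.X_convex hS.X_nonempty hβ h2 ih hy

theorem smdAvg_mem (hn : 3 ≤ n) (hS : S.Valid) {β : ℝ} (hβ : 0 < β) {y : E n} (hy : y ∈ S.X)
    (w : ℕ → E n × ℝ) {m : ℕ} (hm : 0 < m) : smdAvg S β m y w ∈ S.X := by
  have hm' : (0 : ℝ) < m := by exact_mod_cast hm
  unfold smdAvg
  rw [Finset.smul_sum]
  refine hS.X_convex.sum_mem (fun _ _ => by positivity) ?_
    fun i _ => smdIter_mem hn hS hβ hy w (i + 1)
  simp [hm'.ne']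

theorem measurable_smdAvg (hn : 3 ≤ n) (hS : S.Valid) {β : ℝ} (hβ : 0 < β) {y : Ω → E n}
    (hy : Measurable y) {w : ℕ → Ω → E n × ℝ} (hw : ∀ i, Measurable (w i)) (m : ℕ) :
    Measurable fun ω => smdAvg S β m (y ω) (fun j => w j ω) := by
  unfold smdAvg
  exact (Finset.measurable_fun_sum _ fun i _ =>
    measurable_smdIter hn hS hβ hy hw (i + 1)).const_smul (m : ℝ)⁻¹

theorem excess_smdAvg_le (hS : S.Valid) (hL : LawAssumptions S μφ μξ) (β : ℝ) (y : E n)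
    (w : ℕ → E n × ℝ) {m : ℕ} (hm : 0 < m) :
    excess S μφ μξ xs (smdAvg S β m y w)
      ≤ (m : ℝ)⁻¹ * ∑ i ∈ Finset.range m, excess S μφ μξ xs (smdIter S β y w (i + 1)) := by
  have hm' : (0 : ℝ) < m := by exact_mod_cast hm
  have h := (convexOn_excess hS hL xs).map_sum_le (t := Finset.range m) (w := fun _ => (m : ℝ)⁻¹)
    (p := fun i => smdIter S β y w (i + 1)) (fun _ _ => by positivity) (by simp [hm'.ne'])
    (fun _ _ => Set.mem_univ _)
  rw [smdAvg, Finset.smul_sum, Finset.mul_sum]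
  simpa using h

/-- The mean excess of the output of a stage of stochastic mirror descent. -/
theorem smd_stage_bound (hn : 3 ≤ n) (hS : S.Valid) (hL : LawAssumptions S μφ μξ) (hxs : xs ∈ S.X)
    (hsm : SmoothCond S μφ μξ xs) (hV : VarianceCond S μφ μξ xs) {β : ℝ}
    (hβ : 2 * S.vk * S.nu ≤ β) {y : Ω → E n} (hy : Measurable y) (hyX : ∀ ω, y ω ∈ S.X)
    (hy2 : Integrable (fun ω => l1Norm (y ω - xs) ^ 2) P) {w : ℕ → Ω → E n × ℝ}
    (hw : ∀ i, Measurable (w i)) (hlaw : ∀ i, P.map (w i) = obsLaw S μφ μξ xs) {m : ℕ}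
    (hind : ∀ i < m, IndepFun (fun ω => smdIter S β (y ω) (fun j => w j ω) i) (w i) P)
    (hm : 0 < m) :
    Integrable (fun ω => excess S μφ μξ xs (smdAvg S β m (y ω) fun j => w j ω)) P ∧
    ∫ ω, excess S μφ μξ xs (smdAvg S β m (y ω) fun j => w j ω) ∂P
      ≤ 2 / m * (β * Theta n + S.vk * S.nu ^ 2 / (2 * β)) * ∫ ω, l1Norm (y ω - xs) ^ 2 ∂P
        + 2 * (S.vk' * S.varStar) / β := by
  have hnu : 0 < S.nu := hS.kLow_pos.trans_le (hsm.kLow_le_nu (by omega) hS hL)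
  have hvk : 1 ≤ S.vk := hS.one_le_vk
  have hvknu : S.nu ≤ S.vk * S.nu := le_mul_of_one_le_left hnu.le hvk
  have hβ0 : 0 < β := by nlinarith
  have hβ2 : 2 * S.nu ≤ β := by nlinarith
  have hm' : (0 : ℝ) < m := by exact_mod_cast hm
  have hπ := isProbabilityMeasure_obsLaw hS hL xs
  set Y : ℕ → Ω → E n := fun i ω => smdIter S β (y ω) (fun j => w j ω) i with hYdef
  have hYm : ∀ i, Measurable (Y i) := fun i => measurable_smdIter hn hS hβ0 hy hw i
  have hYX : ∀ i ω, Y i ω ∈ S.X := fun i ω => smdIter_mem hn hS hβ0 (hyX ω) _ i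
  set V : ℕ → Ω → ℝ := fun i ω => bregman (y ω) (Y i ω) xs with hVdef
  have hVm : ∀ i, Measurable (V i) := fun i => by
    have hd := (continuous_dgf (n := n) hn).measurable
    have h1 : Measurable fun ω => dgf (xs - y ω) := hd.comp (measurable_const.sub hy)
    have h2 : Measurable fun ω => dgf (Y i ω - y ω) := hd.comp ((hYm i).sub hy)
    have h3 : Measurable fun ω => gradient (dgf : E n → ℝ) (Y i ω - y ω) :=
      measurable_gradient_dgf.comp ((hYm i).sub hy)
    have h4 : Measurable fun ω => xs - Y i ω := measurable_const.sub (hYm i)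
    exact (h1.sub h2).sub (h3.inner h4)
  have hexc := (continuous_excess hS hL xs).measurable
  set e : ℕ → Ω → ℝ := fun i ω => excess S μφ μξ xs (Y i ω) with hedef
  have hem : ∀ i, Measurable (e i) := fun i => hexc.comp (hYm i)
  have he0 : ∀ i ω, 0 ≤ e i ω := fun i ω => excess_nonneg hS hL xs _
  have hV0 : ∀ i ω, 0 ≤ V i ω := fun i ω => bregman_nonneg hn _ _ _
  have hl1V : ∀ i ω, l1Norm (Y i ω - xs) ^ 2 ≤ 2 * V i ω := fun i ω => by
    have := bregman_ge hn (y ω) (Y i ω) xs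
    rw [l1Norm_sub_comm]
    linarith
  have heV : ∀ i ω, e i ω ≤ S.nu * V i ω := fun i ω => by
    have h1 := excess_le_l1Norm_sq hS hL hxs hsm (hYX i ω)
    have h2 := mul_le_mul_of_nonneg_left (hl1V i ω) (by positivity : 0 ≤ S.nu / 2)
    simp only [hedef]
    linarith
  have heI : ∀ i, Integrable (V i) P → Integrable (e i) P := fun i hi =>
    (hi.const_mul S.nu).mono' (hem i).aestronglyMeasurable (Filter.Eventually.of_forall fun ω => by
      rw [Real.norm_eq_abs, abs_of_nonneg (he0 i ω)]; exact heV i ω)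
  have hgc := continuous_gradField (xs := xs) hS hL
  set δ : E n × (E n × ℝ) → E n := fun q => stochGrad S.u q.1 q.2 - gradField S μφ xs q.1 with hδ
  have hδc : Continuous δ := (continuous_stochGrad hS).sub (hgc.comp continuous_fst)
  have hstep : ∀ i ω, e (i + 1) ω + β * V (i + 1) ω ≤ β * V i ω
      - inner ℝ (δ (Y i ω, w i ω)) (Y i ω - xs) + linfNorm (δ (Y i ω, w i ω)) ^ 2 / β := by
    intro i ω
    exact smd_step hn hS hL hxs hsm hβ2 (y ω) (hYX i ω) (w i ω)
  have hnoise : ∀ i < m, Integrable (V i) P →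
      Integrable (fun ω => linfNorm (δ (Y i ω, w i ω)) ^ 2) P ∧
      ∫ ω, linfNorm (δ (Y i ω, w i ω)) ^ 2 ∂P
        ≤ ∫ ω, (S.vk * S.nu * e i ω + S.vk' * S.varStar) ∂P := by
    intro i hi hVi
    refine integrable_of_indepFun (π := obsLaw S μφ μξ xs) (hYm i) (hw i) (hind i hi) (hlaw i)
      hS.X_closed.measurableSet (hYX i) (f := fun q => linfNorm (δ q) ^ 2)
      ((continuous_linfNorm.comp hδc).pow 2).measurable (fun q => sq_nonneg _)
      (k := fun x => S.vk * S.nu * excess S μφ μξ xs x + S.vk' * S.varStar)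
      (((heI i hVi).const_mul _).add (integrable_const _)) (by fun_prop) fun x hx => ?_
    exact noise_sq_bound hS hL hxs hV hx
  have hcross : ∀ i < m, Integrable (V i) P →
      Integrable (fun ω => inner ℝ (δ (Y i ω, w i ω)) (Y i ω - xs)) P ∧
      ∫ ω, inner ℝ (δ (Y i ω, w i ω)) (Y i ω - xs) ∂P = 0 := by
    intro i hi hVi
    have hmeas : Measurable fun q : E n × (E n × ℝ) => (inner ℝ (δ q) (q.1 - xs) : ℝ) :=
      (hδc.inner (continuous_fst.sub continuous_const)).measurable
    have hI : Integrable (fun ω => inner ℝ (δ (Y i ω, w i ω)) (Y i ω - xs)) P := by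
      refine ((hnoise i hi hVi).1.add (hVi.const_mul 2)).mono'
        (hmeas.comp ((hYm i).prodMk (hw i))).aestronglyMeasurable
        (Filter.Eventually.of_forall fun ω => ?_)
      have h1 := abs_inner_le (δ (Y i ω, w i ω)) (Y i ω - xs)
      have h2 := hl1V i ω
      rw [Real.norm_eq_abs]
      simp only [Pi.add_apply]
      nlinarith [sq_nonneg (linfNorm (δ (Y i ω, w i ω)) - l1Norm (Y i ω - xs)),
        sq_nonneg (linfNorm (δ (Y i ω, w i ω))), sq_nonneg (l1Norm (Y i ω - xs))]
    refine ⟨hI, ?_⟩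
    refine integral_eq_zero_of_indepFun (π := obsLaw S μφ μξ xs) (hYm i) (hw i) (hind i hi)
      (hlaw i) (f := fun q => inner ℝ (δ q) (q.1 - xs)) hmeas hI fun x => ?_
    simp only [hδ, inner_sub_left]
    rw [integral_sub (integrable_inner_stochGrad hS hL x _) (integrable_const _),
      integral_inner_stochGrad hS hL]
    simp
  -- Integrability has to be propagated step by step: the noise of step i is known to be integrable
  -- only once V i is, and then dominates V (i + 1).
  have hVI : ∀ i ≤ m, Integrable (V i) P := by
    intro i
    induction i with
    | zero =>
      intro _
      refine (hy2.const_mul (Theta n)).mono' (hVm 0).aestronglyMeasurable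
        (Filter.Eventually.of_forall fun ω => ?_)
      rw [Real.norm_eq_abs, abs_of_nonneg (hV0 0 ω), l1Norm_sub_comm]
      exact bregman_self_le hn (y ω) xs
    | succ i ih =>
      intro hi
      have hVi := ih (by omega)
      have hdom := (((hVi.const_mul β).sub (hcross i (by omega) hVi).1).add
        ((hnoise i (by omega) hVi).1.div_const β)).const_mul β⁻¹
      refine hdom.mono' (hVm _).aestronglyMeasurable (Filter.Eventually.of_forall fun ω => ?_)
      rw [Real.norm_eq_abs, abs_of_nonneg (hV0 _ ω)]
      simp only [Pi.add_apply, Pi.sub_apply]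
      rw [← div_eq_inv_mul, le_div_iff₀ hβ0]
      have := hstep i ω
      have := he0 (i + 1) ω
      linarith
  have hEstep : ∀ i < m, ∫ ω, e (i + 1) ω ∂P + β * ∫ ω, V (i + 1) ω ∂P ≤ β * ∫ ω, V i ω ∂P
      + (S.vk * S.nu * ∫ ω, e i ω ∂P + S.vk' * S.varStar) / β := by
    intro i hi
    have hVi := hVI i hi.le
    have hVi' := hVI (i + 1) hi
    have hc := hcross i hi hVi
    have hno := hnoise i hi hVi
    have h1 : ∫ ω, (e (i + 1) ω + β * V (i + 1) ω) ∂P ≤ ∫ ω, (β * V i ω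
        - inner ℝ (δ (Y i ω, w i ω)) (Y i ω - xs) + linfNorm (δ (Y i ω, w i ω)) ^ 2 / β) ∂P :=
      integral_mono ((heI _ hVi').add (hVi'.const_mul β))
        (((hVi.const_mul β).sub hc.1).add (hno.1.div_const β)) (hstep i)
    rw [integral_add (heI _ hVi') (hVi'.const_mul β),
      integral_add (by exact (hVi.const_mul β).sub hc.1) (hno.1.div_const β),
      integral_sub (hVi.const_mul β) hc.1, hc.2, integral_const_mul, integral_const_mul,
      integral_div, sub_zero] at h1
    have h2 := hno.2
    rw [integral_add ((heI i hVi).const_mul _) (integrable_const _), integral_const_mul] at h2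
    simp only [integral_const, probReal_univ, one_smul] at h2
    have h3 := div_le_div_of_nonneg_right h2 hβ0.le
    linarith
  set a : ℕ → ℝ := fun i => ∫ ω, e i ω ∂P with ha
  have ha0 : ∀ i, 0 ≤ a i := fun i => integral_nonneg (he0 i)
  have htel : ∀ j ≤ m, ∑ i ∈ Finset.range j, a (i + 1) + β * ∫ ω, V j ω ∂P
      ≤ β * ∫ ω, V 0 ω ∂P + S.vk * S.nu / β * ∑ i ∈ Finset.range j, a i
        + j * (S.vk' * S.varStar / β) := by
    intro j
    induction j with
    | zero => intro _; simp
    | succ j ih =>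
      intro hj
      have h1 := ih (by omega)
      have h2 := hEstep j (by omega)
      rw [Finset.sum_range_succ, Finset.sum_range_succ]
      push_cast
      have e1 : (S.vk * S.nu * a j + S.vk' * S.varStar) / β
          = S.vk * S.nu / β * a j + S.vk' * S.varStar / β := by ring
      rw [e1] at h2
      linarith
  -- The variance proportional to the excess returns with this factor; being at most 1/2 it is
  -- absorbed by the left side, at the price of the factor 2 in `hmain`.
  have hθ : S.vk * S.nu / β ≤ 1 / 2 := by
    rw [div_le_iff₀ hβ0]; linarith
  have hθ0 : 0 ≤ S.vk * S.nu / β := by positivity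
  set θ := S.vk * S.nu / β with hθdef
  set D := ∫ ω, l1Norm (y ω - xs) ^ 2 ∂P with hD
  have hV0D : ∫ ω, V 0 ω ∂P ≤ Theta n * D := by
    rw [hD, ← integral_const_mul]
    refine integral_mono (hVI 0 (by omega)) (hy2.const_mul _) fun ω => ?_
    simp only
    rw [l1Norm_sub_comm]
    exact bregman_self_le hn (y ω) xs
  have ha0D : a 0 ≤ S.nu / 2 * D := by
    rw [hD, ← integral_const_mul]
    exact integral_mono (heI 0 (hVI 0 (by omega))) (hy2.const_mul _)
      fun ω => excess_le_l1Norm_sq hS hL hxs hsm (hyX ω)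
  -- The noise sees iterates 0, …, m - 1 while the average uses 1, …, m. The extra initial excess is
  -- the source of the term ϰν²/(2β).
  have hsum : ∑ i ∈ Finset.range m, a i ≤ a 0 + ∑ i ∈ Finset.range m, a (i + 1) := by
    have h1 := Finset.sum_range_succ' a m
    have h2 := Finset.sum_range_succ a m
    have := ha0 m
    linarith
  have hmain : ∑ i ∈ Finset.range m, a (i + 1)
      ≤ 2 * (β * (Theta n * D) + θ * (S.nu / 2 * D) + m * (S.vk' * S.varStar / β)) := by
    have h1 := htel m le_rfl
    have h2 : 0 ≤ β * ∫ ω, V m ω ∂P := mul_nonneg hβ0.le (integral_nonneg (hV0 m))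
    have h3 := mul_le_mul_of_nonneg_left hsum hθ0
    have h4 := mul_le_mul_of_nonneg_left hV0D hβ0.le
    have h5 := mul_le_mul_of_nonneg_left ha0D hθ0
    have h6 : 0 ≤ ∑ i ∈ Finset.range m, a (i + 1) := Finset.sum_nonneg fun i _ => ha0 _
    have h7 := mul_le_mul_of_nonneg_right hθ h6
    linarith
  have heIm : ∀ i ∈ Finset.range m, Integrable (e (i + 1)) P := fun i hi =>
    heI _ (hVI _ (Finset.mem_range.1 hi))
  have hsI : Integrable (fun ω => (m : ℝ)⁻¹ * ∑ i ∈ Finset.range m, e (i + 1) ω) P :=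
    (integrable_finsetSum _ heIm).const_mul _
  have hle : ∀ ω, excess S μφ μξ xs (smdAvg S β m (y ω) fun j => w j ω)
      ≤ (m : ℝ)⁻¹ * ∑ i ∈ Finset.range m, e (i + 1) ω := fun ω =>
    excess_smdAvg_le hS hL β (y ω) _ hm
  have hfI : Integrable (fun ω => excess S μφ μξ xs (smdAvg S β m (y ω) fun j => w j ω)) P := by
    refine hsI.mono' (hexc.comp (measurable_smdAvg hn hS hβ0 hy hw m)).aestronglyMeasurable
      (Filter.Eventually.of_forall fun ω => ?_)
    rw [Real.norm_eq_abs, abs_of_nonneg (excess_nonneg hS hL xs _)]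
    exact hle ω
  refine ⟨hfI, (integral_mono hfI hsI hle).trans ?_⟩
  rw [integral_const_mul, integral_finsetSum _ heIm]
  have h1 := mul_le_mul_of_nonneg_left hmain (by positivity : 0 ≤ (m : ℝ)⁻¹)
  refine h1.trans_eq ?_
  rw [hθdef]
  field_simp

end Stage

/-! ### Independent identically distributed sequences -/

section IID

variable {Ω A B B' : Type*} [MeasurableSpace Ω] [MeasurableSpace A] [MeasurableSpace B]
  [MeasurableSpace B']

/-- A sequence of independent random elements with the common law `π`. -/
structure IsIIDSeq (P : Measure Ω) (w : ℕ → Ω → A) (π : Measure A) : Prop where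
  meas : ∀ i, Measurable (w i)
  indep : iIndepFun w P
  law : ∀ i, P.map (w i) = π

variable {P : Measure Ω} {w : ℕ → Ω → A} {π : Measure A}

theorem IsIIDSeq.reindex (h : IsIIDSeq P w π) {g : ℕ → ℕ} (hg : Function.Injective g) :
    IsIIDSeq P (fun i => w (g i)) π :=
  ⟨fun _ => h.meas _, h.indep.precomp hg, fun _ => h.law _⟩

/-- A function of finitely many coordinates factors measurably through these coordinates. -/
theorem exists_measurable_factor [Inhabited A] {F : (ℕ → A) → B} (hF : Measurable F) (s : Finset ℕ)
    (hdep : DependsOn F (s : Set ℕ)) :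
    ∃ F' : (s → A) → B, Measurable F' ∧ ∀ v, F v = F' fun i => v i := by
  classical
  refine ⟨fun v => F fun j => if hj : j ∈ s then v ⟨j, hj⟩ else default, ?_, fun v => ?_⟩
  · refine hF.comp (measurable_pi_lambda _ fun j => ?_)
    by_cases hj : j ∈ s
    · simp only [hj, dif_pos]
      exact measurable_pi_apply _
    · simp only [hj, dif_neg, not_false_eq_true]
      exact measurable_const
  · refine hdep fun j hj => ?_
    have hj' : j ∈ s := hj
    simp [hj']

theorem IsIIDSeq.indepFun [Inhabited A] (h : IsIIDSeq P w π) {F : (ℕ → A) → B} (hF : Measurable F)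
    {F' : (ℕ → A) → B'} (hF' : Measurable F') {s t : Finset ℕ} (hst : Disjoint s t)
    (hs : DependsOn F (s : Set ℕ)) (ht : DependsOn F' (t : Set ℕ)) :
    IndepFun (fun ω => F fun j => w j ω) (fun ω => F' fun j => w j ω) P := by
  obtain ⟨f, hf, hfF⟩ := exists_measurable_factor hF s hs
  obtain ⟨f', hf', hfF'⟩ := exists_measurable_factor hF' t ht
  simp only [hfF, hfF']
  exact (h.indep.indepFun_finset s t hst h.meas).comp hf hf'

theorem IsIIDSeq.indepFun_past [Inhabited A] (h : IsIIDSeq P w π) {F : (ℕ → A) → B}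
    (hF : Measurable F) {k : ℕ} (hs : ∀ v v', (∀ j < k, v j = v' j) → F v = F v') :
    IndepFun (fun ω => F fun j => w j ω) (w k) P := by
  refine h.indepFun hF (measurable_pi_apply k) (s := Finset.range k) (t := {k}) (by simp) ?_ ?_
  · intro v v' hv
    exact hs v v' fun j hj => hv j (by simpa using hj)
  · intro v v' hv
    exact hv k (by simp)

theorem measure_lt_le_of_integral_le [IsProbabilityMeasure P] {f : Ω → ℝ} (hf0 : ∀ ω, 0 ≤ f ω)
    (hf : Integrable f P) {p t : ℝ} (hp : 0 ≤ p) (ht : 0 ≤ t) (h : ∫ ω, f ω ∂P ≤ p * t) :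
    P.real {ω | t < f ω} ≤ p := by
  -- The level can be zero, namely when R = 0 and σ = 0. Then f vanishes almost surely, and the
  -- event with strict inequality is null.
  rcases ht.eq_or_lt with rfl | ht
  · have h0 : ∫ ω, f ω ∂P = 0 := le_antisymm (by simpa using h) (integral_nonneg hf0)
    rw [integral_eq_zero_iff_of_nonneg hf0 hf] at h0
    have h1 : P {ω | 0 < f ω} = 0 := by
      have : ∀ᵐ ω ∂P, ¬ (0 < f ω) := by
        filter_upwards [h0] with ω hω
        simp [hω]
      simpa [ae_iff] using this
    rw [Measure.real, h1]
    simpa using hp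
  · have h1 := mul_meas_ge_le_integral_of_nonneg (Filter.Eventually.of_forall hf0) hf t
    have h2 : P.real {ω | t < f ω} ≤ P.real {ω | t ≤ f ω} :=
      measureReal_mono fun ω (hω : t < f ω) => hω.le
    have h3 : t * P.real {ω | t ≤ f ω} ≤ t * p := by linarith
    exact h2.trans (le_of_mul_le_mul_left h3 ht)

end IID

/-! ### Sparse approximation -/

section Sparse

variable {n : ℕ}

/-- The difference is supported on at most 2s coordinates; Cauchy-Schwarz on the support. -/
theorem l1Norm_sq_le_of_isSparse {x y : E n} {s : ℕ} (hx : IsSparse s x) (hy : IsSparse s y) :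
    l1Norm (x - y) ^ 2 ≤ 2 * s * ‖x - y‖ ^ 2 := by
  classical
  set T := Finset.univ.filter (fun i => (x - y) i ≠ 0) with hT
  have hcard : T.card ≤ 2 * s := by
    have : T ⊆ Finset.univ.filter (fun i => x i ≠ 0) ∪ Finset.univ.filter (fun i => y i ≠ 0) := by
      intro i hi
      have hi' := (Finset.mem_filter.1 hi).2
      simp only [Finset.mem_filter, Finset.mem_union, Finset.mem_univ, true_and]
      by_contra! h
      exact hi' (by rw [PiLp.sub_apply, h.1, h.2, sub_zero])
    have h1 := (Finset.card_le_card this).trans (Finset.card_union_le _ _)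
    unfold IsSparse at hx hy
    omega
  have h1 : l1Norm (x - y) = ∑ i ∈ T, |(x - y) i| := by
    rw [l1Norm]
    refine (Finset.sum_subset (Finset.subset_univ T) fun i _ hi => ?_).symm
    have : (x - y) i = 0 := by
      by_contra h
      exact hi (Finset.mem_filter.2 ⟨Finset.mem_univ i, h⟩)
    rw [this, abs_zero]
  have h2 : ∑ i ∈ T, |(x - y) i| ^ 2 ≤ ‖x - y‖ ^ 2 := by
    rw [EuclideanSpace.norm_sq_eq]
    simp only [Real.norm_eq_abs]
    exact Finset.sum_le_sum_of_subset_of_nonneg (Finset.subset_univ T) fun i _ _ => by positivity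
  rw [h1]
  refine (sq_sum_le_card_mul_sum_sq).trans ?_
  have h3 : (T.card : ℝ) ≤ 2 * s := by exact_mod_cast hcard
  have h4 : 0 ≤ ∑ i ∈ T, |(x - y) i| ^ 2 := Finset.sum_nonneg fun i _ => by positivity
  exact mul_le_mul h3 h2 h4 (by positivity)

variable {S : Setup n} {μφ : Measure (E n)} {μξ : Measure ℝ} {xs : E n}

/-- The signal itself competes in the sparse approximation problem, so ‖y - x_*‖ ≤ 2‖x - x_*‖. The
constant 16 is 2 from the size of the joint support, 4 from the squared triangle inequality and 2
from quadratic growth. -/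
theorem l1Norm_sparsified_le (hS : S.Valid) (hL : LawAssumptions S μφ μξ) (hxs : xs ∈ S.X)
    (hxsp : IsSparse S.s xs) {x y : E n} (hy : IsSparseApprox S.X S.s x y) :
    l1Norm (y - xs) ^ 2 ≤ 16 * S.sBar / S.kLow * excess S μφ μξ xs x := by
  have hk := hS.kLow_pos
  have h1 := l1Norm_sq_le_of_isSparse hy.1.2 hxsp
  have h2 := hy.2 xs hxs hxsp
  have h3 : ‖y - xs‖ ≤ 2 * ‖x - xs‖ := by
    have := norm_add_le (y - x) (x - xs)
    rw [sub_add_sub_cancel, norm_sub_rev y x] at this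
    linarith
  have h4 : ‖y - xs‖ ^ 2 ≤ 4 * ‖x - xs‖ ^ 2 := by
    have := pow_le_pow_left₀ (norm_nonneg _) h3 2
    linarith
  have h5 := norm_sq_le_excess hS hL xs x
  have h6 : (S.s : ℝ) ≤ S.sBar := by exact_mod_cast hS.s_le
  have h7 : 2 * (S.s : ℝ) * ‖y - xs‖ ^ 2 ≤ 2 * S.sBar * (4 * ‖x - xs‖ ^ 2) := by gcongr
  have h8 : 2 * S.sBar * (4 * ‖x - xs‖ ^ 2) = 16 * S.sBar / S.kLow * (S.kLow / 2 * ‖x - xs‖ ^ 2) := by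
    field_simp; ring
  rw [h8] at h7
  refine (h1.trans h7).trans ?_
  gcongr

end Sparse

/-! ### Multistage stochastic mirror descent -/

section Multistage

variable {n : ℕ} {S : Setup n} {μφ : Measure (E n)} {μξ : Measure ℝ} {xs : E n}

theorem smdIter_congr (β : ℝ) (y : E n) {w w' : ℕ → E n × ℝ} {i : ℕ}
    (h : ∀ j < i, w j = w' j) : smdIter S β y w i = smdIter S β y w' i := by
  induction i with
  | zero => rfl
  | succ i ih =>
    have h1 := ih fun j hj => h j (by omega)
    simp only [smdIter, h1, h i (by omega)]

theorem smdAvg_congr (β : ℝ) (y : E n) {w w' : ℕ → E n × ℝ} {m : ℕ}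
    (h : ∀ j < m, w j = w' j) : smdAvg S β m y w = smdAvg S β m y w' := by
  unfold smdAvg
  congr 1
  refine Finset.sum_congr rfl fun i hi => smdIter_congr β y fun j hj => h j ?_
  have := Finset.mem_range.1 hi
  omega

theorem stageState_congr (sp : E n → E n) (N : ℕ) {w w' : ℕ → E n × ℝ} {k : ℕ}
    (h : ∀ j < ∑ i ∈ Finset.range k, stageLen S N i, w j = w' j) :
    stageState S sp N w k = stageState S sp N w' k := by
  induction k with
  | zero => rfl
  | succ k ih =>
    rw [Finset.sum_range_succ] at h
    have h1 := ih fun j hj => h j (by omega)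
    simp only [stageState, h1]
    rw [smdAvg_congr (w' := fun i => w' ((∑ j ∈ Finset.range k, stageLen S N j) + i))]
    intro j hj
    exact h _ (by omega)

theorem stageBeta_ge (hS : S.Valid) (hnu : 0 < S.nu) (N k : ℕ) :
    2 * S.vk * S.nu ≤ stageBeta S N k := by
  have hvk := hS.one_le_vk
  unfold stageBeta
  split_ifs
  · exact le_rfl
  · rw [pow_succ]
    have h1 : (1 : ℝ) ≤ 2 ^ (k - numPrelim S N) := one_le_pow₀ (by norm_num)
    have h2 : 0 < S.vk * S.nu := by positivity
    nlinarith

theorem stageBeta_pos (hS : S.Valid) (hnu : 0 < S.nu) (N k : ℕ) : 0 < stageBeta S N k := by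
  have hvk := hS.one_le_vk
  have : 0 < S.vk * S.nu := by positivity
  linarith [stageBeta_ge hS hnu N k]

theorem m0_real_pos (hn : 3 ≤ n) (hS : S.Valid) (hnu : 0 < S.nu) :
    0 < 16 * S.kLow⁻¹ * S.sBar * (8 * Theta n * S.vk + 1) * S.nu := by
  have h1 := hS.kLow_pos
  have h2 := Theta_pos hn
  have h3 := hS.one_le_vk
  have h4 : (0 : ℝ) < S.sBar := by exact_mod_cast hS.one_le_sBar
  have h5 : 0 < S.vk := by linarith
  positivity

theorem mAsym_real_pos (hn : 3 ≤ n) (hS : S.Valid) (hnu : 0 < S.nu) (k : ℕ) :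
    0 < 512 * (S.sBar * Theta n * S.nu * S.vk / S.kLow) * 2 ^ k := by
  have h1 := hS.kLow_pos
  have h2 := Theta_pos hn
  have h3 := hS.one_le_vk
  have h4 : (0 : ℝ) < S.sBar := by exact_mod_cast hS.one_le_sBar
  have h5 : 0 < S.vk := by linarith
  positivity

theorem stageLen_pos (hn : 3 ≤ n) (hS : S.Valid) (hnu : 0 < S.nu) (N k : ℕ) :
    0 < stageLen S N k := by
  unfold stageLen
  split_ifs
  · exact Nat.ceil_pos.2 (m0_real_pos hn hS hnu)
  · exact Nat.ceil_pos.2 (mAsym_real_pos hn hS hnu _)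

theorem stageState_mem (hn : 3 ≤ n) (hS : S.Valid) (hnu : 0 < S.nu) {sp : E n → E n}
    (hsp : ∀ x ∈ S.X, IsSparseApprox S.X S.s x (sp x)) (N : ℕ) (w : ℕ → E n × ℝ) (k : ℕ) :
    (stageState S sp N w k).1 ∈ S.X ∧ (stageState S sp N w k).2 ∈ S.X := by
  induction k with
  | zero => exact ⟨hS.x₀_mem, hS.x₀_mem⟩
  | succ k ih =>
    have h1 : (stageState S sp N w (k + 1)).1 ∈ S.X :=
      smdAvg_mem hn hS (stageBeta_pos hS hnu N k) ih.2 _ (stageLen_pos hn hS hnu N k)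
    exact ⟨h1, (hsp _ h1).1.1⟩

theorem measurable_stageState (hn : 3 ≤ n) (hS : S.Valid) (hnu : 0 < S.nu) {sp : E n → E n}
    (hspm : Measurable sp) (N k : ℕ) :
    Measurable fun w : ℕ → E n × ℝ => stageState S sp N w k := by
  induction k with
  | zero => exact measurable_const
  | succ k ih =>
    have h1 : Measurable fun w : ℕ → E n × ℝ =>
        smdAvg S (stageBeta S N k) (stageLen S N k) (stageState S sp N w k).2
          (fun i => w ((∑ j ∈ Finset.range k, stageLen S N j) + i)) :=
      measurable_smdAvg hn hS (stageBeta_pos hS hnu N k) ih.snd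
        (w := fun i w => w ((∑ j ∈ Finset.range k, stageLen S N j) + i))
        (fun i => measurable_pi_apply _) _
    simp only [stageState]
    exact h1.prodMk (hspm.comp h1)

theorem measurable_algOne (hn : 3 ≤ n) (hS : S.Valid) (hnu : 0 < S.nu) {sp : E n → E n}
    (hspm : Measurable sp) (N : ℕ) : Measurable fun w : ℕ → E n × ℝ => algOne S sp N w :=
  (measurable_stageState hn hS hnu hspm N _).fst

theorem algOne_mem (hn : 3 ≤ n) (hS : S.Valid) (hnu : 0 < S.nu) {sp : E n → E n}
    (hsp : ∀ x ∈ S.X, IsSparseApprox S.X S.s x (sp x)) (N : ℕ) (w : ℕ → E n × ℝ) :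
    algOne S sp N w ∈ S.X := (stageState_mem hn hS hnu hsp N w _).1

variable {Ω : Type*} [MeasurableSpace Ω] {P : Measure Ω} [IsProbabilityMeasure P]

/-- Transition from one stage to the next one. -/
theorem stage_transition (hn : 3 ≤ n) (hS : S.Valid) (hL : LawAssumptions S μφ μξ)
    (hsig : xs ∈ signals S μφ μξ) {sp : E n → E n} (hspm : Measurable sp)
    (hsp : ∀ x ∈ S.X, IsSparseApprox S.X S.s x (sp x)) {w : ℕ → Ω → E n × ℝ}
    (hw : IsIIDSeq P w (obsLaw S μφ μξ xs)) (N k : ℕ)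
    (hint : Integrable (fun ω => l1Norm ((stageState S sp N (fun i => w i ω) k).2 - xs) ^ 2) P) :
    Integrable (fun ω => excess S μφ μξ xs (stageState S sp N (fun i => w i ω) (k + 1)).1) P ∧
    ∫ ω, excess S μφ μξ xs (stageState S sp N (fun i => w i ω) (k + 1)).1 ∂P
      ≤ 2 / (stageLen S N k : ℝ) * (stageBeta S N k * Theta n + S.vk * S.nu ^ 2 / (2 * stageBeta S N k))
        * ∫ ω, l1Norm ((stageState S sp N (fun i => w i ω) k).2 - xs) ^ 2 ∂P
        + 2 * (S.vk' * S.varStar) / stageBeta S N k ∧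
    Integrable (fun ω => l1Norm ((stageState S sp N (fun i => w i ω) (k + 1)).2 - xs) ^ 2) P ∧
    ∫ ω, l1Norm ((stageState S sp N (fun i => w i ω) (k + 1)).2 - xs) ^ 2 ∂P
      ≤ 16 * S.sBar / S.kLow
        * ∫ ω, excess S μφ μξ xs (stageState S sp N (fun i => w i ω) (k + 1)).1 ∂P := by
  obtain ⟨hxs, hsparse, -, hsm, hV, -⟩ := hsig
  have hnu : 0 < S.nu := hS.kLow_pos.trans_le (hsm.kLow_le_nu (by omega) hS hL)
  set off := ∑ j ∈ Finset.range k, stageLen S N j with hoff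
  have hst : Measurable fun w : ℕ → E n × ℝ => (stageState S sp N w k).2 :=
    (measurable_stageState hn hS hnu hspm N k).snd
  have hwm : Measurable fun ω => fun i => w i ω := measurable_pi_lambda _ hw.meas
  have key := smd_stage_bound (P := P) hn hS hL hxs hsm hV (stageBeta_ge hS hnu N k)
    (y := fun ω => (stageState S sp N (fun i => w i ω) k).2) (hst.comp hwm)
    (fun ω => (stageState_mem hn hS hnu hsp N _ k).2) hint (w := fun i => w (off + i))
    (fun i => hw.meas _) (fun i => hw.law _) (m := stageLen S N k) ?_ (stageLen_pos hn hS hnu N k)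
  · refine ⟨key.1, key.2, ?_⟩
    have hle : ∀ ω, l1Norm ((stageState S sp N (fun i => w i ω) (k + 1)).2 - xs) ^ 2
        ≤ 16 * S.sBar / S.kLow
          * excess S μφ μξ xs (stageState S sp N (fun i => w i ω) (k + 1)).1 := fun ω =>
      l1Norm_sparsified_le hS hL hxs hsparse
        (hsp _ (stageState_mem hn hS hnu hsp N (fun i => w i ω) (k + 1)).1)
    have hI : Integrable (fun ω =>
        l1Norm ((stageState S sp N (fun i => w i ω) (k + 1)).2 - xs) ^ 2) P := by
      refine (key.1.const_mul (16 * S.sBar / S.kLow)).mono' ?_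
        (Filter.Eventually.of_forall fun ω => ?_)
      · have h1 : Measurable fun ω => (stageState S sp N (fun i => w i ω) (k + 1)).2 :=
          (measurable_stageState hn hS hnu hspm N (k + 1)).snd.comp hwm
        exact ((continuous_l1Norm.measurable.comp (h1.sub_const xs)).pow_const 2).aestronglyMeasurable
      · rw [Real.norm_eq_abs, abs_of_nonneg (sq_nonneg _)]
        exact hle ω
    refine ⟨hI, ?_⟩
    rw [← integral_const_mul]
    exact integral_mono hI (key.1.const_mul _) hle
  · intro i _
    -- Iterate i of stage k is a function of the observations before number off + i, hence
    -- independent of that observation.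
    refine hw.indepFun_past (k := off + i) (F := fun v : ℕ → E n × ℝ =>
      smdIter S (stageBeta S N k) (stageState S sp N v k).2 (fun j => v (off + j)) i) ?_ ?_
    · exact measurable_smdIter hn hS (stageBeta_pos hS hnu N k) hst
        (w := fun j v => v (off + j)) (fun j => measurable_pi_apply _) i
    · intro v v' hv
      rw [stageState_congr sp N (w' := v') fun j hj => hv j (by omega)]
      exact smdIter_congr _ _ fun j hj => hv _ (by omega)

end Multistage

/-! ### Recursions for the mean errors of the stages -/

section Recursions

/-- The two hypotheses combine to d (k + 1) ≤ (d k + D)/2, so the excess of d over D is halved. Here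
κ stands for κ̲/s̄, d for the mean squared ℓ₁-error of the starting points and D for the noise
floor. -/
theorem prelim_recursion {a d : ℕ → ℝ} {κ D Q : ℝ} {K : ℕ} (hκ : 0 < κ) (hD : 0 ≤ D)
    (h0 : d 0 ≤ Q)
    (ha : ∀ k < K, a (k + 1) ≤ κ / 32 * (d k + D)) (hd : ∀ k < K, d (k + 1) ≤ 16 / κ * a (k + 1)) :
    (∀ k ≤ K, d k ≤ Q / 2 ^ k + D) ∧ ∀ k < K, a (k + 1) ≤ κ / 32 * (Q / 2 ^ k + 2 * D) := by
  have hmain : ∀ k ≤ K, d k ≤ Q / 2 ^ k + D := by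
    intro k
    induction k with
    | zero => intro _; simpa using h0.trans (le_add_of_nonneg_right hD)
    | succ k ih =>
      intro hk
      have h1 := ih (by omega)
      have h2 := ha k (by omega)
      have h3 := hd k (by omega)
      have h4 : 16 / κ * a (k + 1) ≤ 16 / κ * (κ / 32 * (d k + D)) := by gcongr
      have e : 16 / κ * (κ / 32 * (d k + D)) = (d k + D) / 2 := by field_simp; ring
      have e2 : ∀ t : ℝ, t / 2 ^ (k + 1) = t / 2 ^ k / 2 := fun t => by rw [pow_succ]; field_simp
      rw [e2]
      linarith
  refine ⟨hmain, fun k hk => (ha k hk).trans ?_⟩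
  have := hmain k hk.le
  have h3 : d k + D ≤ Q / 2 ^ k + 2 * D := by linarith
  gcongr

/-- The hypotheses give d (K+j+1) ≤ d (K+j)/8 + D/2^(j+1), which preserves the invariant d (K+j) ≤
2D/2^j. -/
theorem asym_recursion {a d : ℕ → ℝ} {κ D : ℝ} {K : ℕ} (hκ : 0 < κ) (hD : 0 ≤ D)
    (h0 : d K ≤ 2 * D)
    (ha : ∀ j, a (K + j + 1) ≤ κ / 128 * d (K + j) + κ / 16 * (D / 2 ^ (j + 1)))
    (hd : ∀ k, d (k + 1) ≤ 16 / κ * a (k + 1)) (j : ℕ) :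
    a (K + j + 1) ≤ κ / 8 * (D / 2 ^ (j + 1)) := by
  have e2 : ∀ (k : ℕ) (t : ℝ), t / 2 ^ (k + 1) = t / 2 ^ k / 2 := fun k t => by
    rw [pow_succ]; field_simp
  have hmain : ∀ j, d (K + j) ≤ 2 * (D / 2 ^ j) := by
    intro j
    induction j with
    | zero => simpa using h0
    | succ j ih =>
      have h1 := hd (K + j)
      have h2 : 16 / κ * a (K + j + 1)
          ≤ 16 / κ * (κ / 128 * d (K + j) + κ / 16 * (D / 2 ^ (j + 1))) := by
        gcongr
        exact ha j
      have e : 16 / κ * (κ / 128 * d (K + j) + κ / 16 * (D / 2 ^ (j + 1)))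
          = d (K + j) / 8 + D / 2 ^ (j + 1) := by field_simp; ring
      have h3 : 0 ≤ D / 2 ^ j := by positivity
      rw [← add_assoc]
      rw [e2] at e ⊢
      rw [e2] at h2
      linarith
  have h1 := hmain j
  have h2 := ha j
  have h3 : κ / 128 * d (K + j) ≤ κ / 128 * (2 * (D / 2 ^ j)) := by gcongr
  have h4 : 0 ≤ κ * (D / 2 ^ j) := by positivity
  rw [e2] at h2 ⊢
  linarith

end Recursions

/-! ### The accuracy of multistage stochastic mirror descent -/

section AlgOne

variable {n : ℕ} {S : Setup n} {μφ : Measure (E n)} {μξ : Measure ℝ} {xs : E n}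

/-- The squared `ℓ₁`-error at which the preliminary phase is stopped. -/
def noiseFloor (S : Setup n) : ℝ := 32 * S.varStar * S.sBar * S.vk' / (S.kLow * S.nu * S.vk)

theorem noiseFloor_nonneg (hS : S.Valid) (hnu : 0 < S.nu) : 0 ≤ noiseFloor S := by
  have h1 := hS.kLow_pos
  have h2 := hS.one_le_vk
  have h3 := hS.one_le_vk'
  unfold noiseFloor Setup.varStar
  have : 0 < S.vk := by linarith
  have : 0 < S.vk' := by linarith
  positivity

theorem noiseFloor_pos (hS : S.Valid) (hnu : 0 < S.nu) (hsig : S.sig ≠ 0) : 0 < noiseFloor S := by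
  have h1 := hS.kLow_pos
  have h2 := hS.one_le_vk
  have h3 := hS.one_le_vk'
  have h4 : (0 : ℝ) < S.sBar := by exact_mod_cast hS.one_le_sBar
  unfold noiseFloor Setup.varStar
  have : 0 < S.vk := by linarith
  have : 0 < S.vk' := by linarith
  positivity

theorem kBar_arg_eq (hS : S.Valid) (hnu : 0 < S.nu) :
    S.R ^ 2 * S.kLow * S.nu * S.vk / (32 * S.varStar * S.sBar * S.vk') = S.R ^ 2 / noiseFloor S := by
  have h1 := hS.kLow_pos.ne'
  have h2 : S.vk ≠ 0 := by linarith [hS.one_le_vk]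
  have h3 := hnu.ne'
  unfold noiseFloor
  rw [div_div_eq_mul_div]
  congr 1
  ring

/-- `kBar` counts the halvings needed to bring R² down to the floor. -/
theorem sq_R_div_le_noiseFloor (hS : S.Valid) (hnu : 0 < S.nu) (hsig : S.sig ≠ 0) :
    S.R ^ 2 / 2 ^ kBar S ≤ noiseFloor S := by
  have hD := noiseFloor_pos hS hnu hsig
  rcases eq_or_ne (S.R ^ 2) 0 with hR | hR
  · rw [hR, zero_div]; exact hD.le
  have hR0 : 0 < S.R ^ 2 := lt_of_le_of_ne (sq_nonneg _) hR.symm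
  have h1 : Real.logb 2 (S.R ^ 2 / noiseFloor S) ≤ kBar S := by
    unfold kBar
    rw [kBar_arg_eq hS hnu]
    exact (Nat.le_ceil _).trans (by exact_mod_cast le_max_right _ _)
  rw [Real.logb_le_iff_le_rpow (by norm_num) (by positivity), Real.rpow_natCast,
    div_le_iff₀ hD] at h1
  rw [div_le_iff₀ (by positivity)]
  linarith

/-- Before the last allowed preliminary stage the geometric term still dominates the floor. The
condition 1 ≤ k rules out that `kBar` equals 1 merely because of the maximum in its definition. -/
theorem noiseFloor_le_sq_R_div (hS : S.Valid) (hnu : 0 < S.nu) (hsig : S.sig ≠ 0) {k : ℕ}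
    (hk1 : 1 ≤ k) (hk : k + 1 ≤ kBar S) : noiseFloor S ≤ S.R ^ 2 / 2 ^ k := by
  have hD := noiseFloor_pos hS hnu hsig
  have h1 : k < ⌈Real.logb 2 (S.R ^ 2 / noiseFloor S)⌉₊ := by
    unfold kBar at hk
    rw [kBar_arg_eq hS hnu] at hk
    rcases le_max_iff.1 hk with h | h <;> omega
  rw [Nat.lt_ceil] at h1
  have hR0 : 0 < S.R ^ 2 / noiseFloor S := by
    rcases eq_or_ne (S.R ^ 2) 0 with hR | hR
    · rw [hR, zero_div, Real.logb_zero] at h1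
      have : (0 : ℝ) ≤ k := by positivity
      linarith
    · have : 0 < S.R ^ 2 := lt_of_le_of_ne (sq_nonneg _) hR.symm
      positivity
  rw [Real.lt_logb_iff_rpow_lt (by norm_num) hR0, Real.rpow_natCast, lt_div_iff₀ hD] at h1
  rw [le_div_iff₀ (by positivity)]
  linarith

/-- The number of observations per unit of progress of the preliminary phase, up to an absolute
constant. -/
def stageUnit (S : Setup n) : ℝ := Theta n * S.vk * S.sBar * S.nu / S.kLow

/-- A lower bound on the unit makes rounding up of the stage lengths cost only a constant factor; it
rests on κ̲ ≤ ν. -/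
theorem three_lt_stageUnit (hn : 3 ≤ n) (hS : S.Valid) (hnu : S.kLow ≤ S.nu) : 3 < stageUnit S := by
  have h1 := hS.kLow_pos
  have h2 := three_lt_Theta hn
  have h3 := hS.one_le_vk
  have h4 : (1 : ℝ) ≤ S.sBar := by exact_mod_cast hS.one_le_sBar
  unfold stageUnit
  rw [lt_div_iff₀ h1]
  have h5 : (1 : ℝ) ≤ S.vk * S.sBar := one_le_mul_of_one_le_of_one_le h3 h4
  calc 3 * S.kLow < Theta n * S.kLow := by gcongr
    _ ≤ Theta n * (S.vk * S.sBar) * S.nu := by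
        have : 0 < Theta n := by linarith
        have : Theta n * 1 ≤ Theta n * (S.vk * S.sBar) := by gcongr
        have : 0 < S.nu := by linarith
        nlinarith
    _ = _ := by ring

theorem m0_le (hn : 3 ≤ n) (hS : S.Valid) (hnu : S.kLow ≤ S.nu) :
    (m0 S : ℝ) ≤ 176 * stageUnit S := by
  have h0 := three_lt_stageUnit hn hS hnu
  have hk := hS.kLow_pos
  have hnu0 : 0 < S.nu := by linarith
  have h1 := Nat.ceil_lt_add_one (m0_real_pos hn hS hnu0).le
  have h2 := three_lt_Theta hn
  have h3 := hS.one_le_vk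
  have h4 : 8 * Theta n * S.vk + 1 ≤ 9 * (Theta n * S.vk) := by nlinarith
  have h5 : 16 * S.kLow⁻¹ * S.sBar * (8 * Theta n * S.vk + 1) * S.nu
      ≤ 16 * S.kLow⁻¹ * S.sBar * (9 * (Theta n * S.vk)) * S.nu := by gcongr
  have e : 16 * S.kLow⁻¹ * S.sBar * (9 * (Theta n * S.vk)) * S.nu = 144 * stageUnit S := by
    unfold stageUnit; field_simp; ring
  unfold m0
  linarith

theorem mAsym_le (hn : 3 ≤ n) (hS : S.Valid) (hnu : S.kLow ≤ S.nu) (k : ℕ) :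
    (mAsym S k : ℝ) ≤ 1024 * stageUnit S * 2 ^ k := by
  have h0 := three_lt_stageUnit hn hS hnu
  have hnu0 : 0 < S.nu := by linarith [hS.kLow_pos]
  have h1 := Nat.ceil_lt_add_one (mAsym_real_pos hn hS hnu0 k).le
  have e : 512 * (S.sBar * Theta n * S.nu * S.vk / S.kLow) * 2 ^ k = 512 * stageUnit S * 2 ^ k := by
    unfold stageUnit; ring
  have h2 : (1 : ℝ) ≤ 2 ^ k := one_le_pow₀ (by norm_num)
  rw [e] at h1
  unfold mAsym
  rw [e]
  nlinarith

theorem m0_pos (hn : 3 ≤ n) (hS : S.Valid) (hnu : 0 < S.nu) : 0 < m0 S :=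
  Nat.ceil_pos.2 (m0_real_pos hn hS hnu)

theorem mAsym_pos (hn : 3 ≤ n) (hS : S.Valid) (hnu : 0 < S.nu) (k : ℕ) : 0 < mAsym S k :=
  Nat.ceil_pos.2 (mAsym_real_pos hn hS hnu k)

/-- With β = 2ϰν the left side is (8Θϰ + 1)ν/(2m₀), and m₀ is defined by requiring this to be at
most κ̲/(32 s̄). -/
theorem prelim_coef_le (hn : 3 ≤ n) (hS : S.Valid) (hnu : 0 < S.nu) :
    2 / (m0 S : ℝ) * (2 * S.vk * S.nu * Theta n + S.vk * S.nu ^ 2 / (2 * (2 * S.vk * S.nu)))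
      ≤ S.kLow / S.sBar / 32 := by
  have hk0 := hS.kLow_pos
  have hvk0 : 0 < S.vk := by linarith [hS.one_le_vk]
  have hsB : (0 : ℝ) < S.sBar := by exact_mod_cast hS.one_le_sBar
  have hm0 : (0 : ℝ) < m0 S := by exact_mod_cast m0_pos hn hS hnu
  have h3 := Nat.le_ceil (16 * S.kLow⁻¹ * S.sBar * (8 * Theta n * S.vk + 1) * S.nu)
  rw [← m0] at h3
  have e3 : 2 / (m0 S : ℝ) * (2 * S.vk * S.nu * Theta n
      + S.vk * S.nu ^ 2 / (2 * (2 * S.vk * S.nu)))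
      = (8 * Theta n * S.vk + 1) * S.nu / (2 * m0 S) := by field_simp; ring
  rw [e3, div_le_iff₀ (by positivity)]
  have e4 : S.kLow / S.sBar / 32
      * (2 * (16 * S.kLow⁻¹ * S.sBar * (8 * Theta n * S.vk + 1) * S.nu))
      = (8 * Theta n * S.vk + 1) * S.nu := by field_simp; ring
  rw [← e4]
  gcongr

/-- Here the second summand is dominated by the first, so the coefficient is at most 4βΘ/m_k with β
and m_k both proportional to 2^k; 4 · 128 is the constant 512 in the stage length. -/
theorem asym_coef_le (hn : 3 ≤ n) (hS : S.Valid) (hnu : 0 < S.nu) (j : ℕ) :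
    2 / (mAsym S (j + 1) : ℝ) * (2 ^ (j + 1) * S.nu * S.vk * Theta n
      + S.vk * S.nu ^ 2 / (2 * (2 ^ (j + 1) * S.nu * S.vk))) ≤ S.kLow / S.sBar / 128 := by
  have hk0 := hS.kLow_pos
  have hvk := hS.one_le_vk
  have hvk0 : 0 < S.vk := by linarith
  have hsB : (0 : ℝ) < S.sBar := by exact_mod_cast hS.one_le_sBar
  have hΘ := three_lt_Theta hn
  have hΘ0 : 0 < Theta n := by linarith
  have hma : (0 : ℝ) < mAsym S (j + 1) := by exact_mod_cast mAsym_pos hn hS hnu (j + 1)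
  have h3 := Nat.le_ceil (512 * (S.sBar * Theta n * S.nu * S.vk / S.kLow) * 2 ^ (j + 1))
  rw [← mAsym] at h3
  have hT2 : (2 : ℝ) ≤ 2 ^ (j + 1) := by
    rw [pow_succ]; have : (1 : ℝ) ≤ 2 ^ j := one_le_pow₀ (by norm_num)
    linarith
  set T : ℝ := 2 ^ (j + 1) with hT
  have hT0 : 0 < T := by linarith
  have h4 : S.vk * S.nu ^ 2 / (2 * (T * S.nu * S.vk)) ≤ T * S.nu * S.vk * Theta n := by
    rw [div_le_iff₀ (by positivity)]
    have h5 : 1 ≤ T * S.vk * Theta n * (2 * T) := by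
      have h6 : 2 ≤ T * S.vk := by nlinarith
      have h7 : 6 ≤ T * S.vk * Theta n := by nlinarith
      nlinarith
    have h8 : 0 < S.vk * S.nu ^ 2 := by positivity
    have h9 := mul_le_mul_of_nonneg_left h5 h8.le
    linarith
  calc 2 / (mAsym S (j + 1) : ℝ) * (T * S.nu * S.vk * Theta n
        + S.vk * S.nu ^ 2 / (2 * (T * S.nu * S.vk)))
      ≤ 2 / (mAsym S (j + 1) : ℝ) * (T * S.nu * S.vk * Theta n + T * S.nu * S.vk * Theta n) := by
        gcongr
    _ = 4 * (T * S.nu * S.vk * Theta n) / mAsym S (j + 1) := by ring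
    _ ≤ S.kLow / S.sBar / 128 := by
        rw [div_le_iff₀ hma]
        have e4 : S.kLow / S.sBar / 128 * (512 * (S.sBar * Theta n * S.nu * S.vk / S.kLow) * T)
            = 4 * (T * S.nu * S.vk * Theta n) := by field_simp; ring
        rw [← e4]
        gcongr

theorem numAsym_spec (hn : 3 ≤ n) (hS : S.Valid) (hnu : 0 < S.nu) (hsig : S.sig ≠ 0) (N : ℕ) :
    N - m0 S * kBar S < ∑ i ∈ Finset.range (numAsym S N + 1), mAsym S (i + 1) := by
  have hpos := mAsym_pos hn hS hnu
  unfold numAsym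
  rw [if_neg hsig]
  set Q : ℕ → Prop := fun k => (∑ i ∈ Finset.range k, mAsym S (i + 1)) ≤ N - m0 S * kBar S with hQ
  set k := Nat.findGreatest Q N with hk
  -- The search for the number of stages is cut off at N. This is harmless: stages have length at
  -- least 1, so N + 1 of them never fit.
  rcases Nat.lt_or_ge N (k + 1) with h | h
  · have h1 : k + 1 ≤ ∑ i ∈ Finset.range (k + 1), mAsym S (i + 1) := by
      have := Finset.card_nsmul_le_sum (Finset.range (k + 1)) (fun i => mAsym S (i + 1)) 1
        fun i _ => hpos _
      simpa using this
    omega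
  · have h1 := Nat.findGreatest_is_greatest (P := Q) (n := N) (k := k + 1) (by omega) h
    simp only [hQ] at h1
    omega

variable {Ω : Type*} [MeasurableSpace Ω] {P : Measure Ω} [IsProbabilityMeasure P]

set_option maxHeartbeats 1000000 in
/-- The mean excess of the output of the multistage algorithm. -/
theorem algOne_mean_bound (hn : 3 ≤ n) (hS : S.Valid) (hL : LawAssumptions S μφ μξ)
    (hsig : xs ∈ signals S μφ μξ) {sp : E n → E n} (hspm : Measurable sp)
    (hsp : ∀ x ∈ S.X, IsSparseApprox S.X S.s x (sp x)) {w : ℕ → Ω → E n × ℝ}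
    (hw : IsIIDSeq P w (obsLaw S μφ μξ xs)) {N : ℕ} (hN : 2 * m0 S ≤ N) :
    Integrable (fun ω => excess S μφ μξ xs (algOne S sp N fun i => w i ω)) P ∧
    ∫ ω, excess S μφ μξ xs (algOne S sp N fun i => w i ω) ∂P
      ≤ S.kLow * S.R ^ 2 / (4 * S.sBar) * (1 / 2 : ℝ) ^ ((N : ℝ) / (2 * m0 S))
        + 32768 * (S.varStar * S.sBar * S.vk' * Theta n / (S.kLow * N)) := by
  have hsm := hsig.2.2.2.1
  have hR := hsig.2.2.1
  have hnuk : S.kLow ≤ S.nu := hsm.kLow_le_nu (by omega) hS hL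
  have hk0 := hS.kLow_pos
  have hnu : 0 < S.nu := hk0.trans_le hnuk
  have hvk := hS.one_le_vk
  have hvk0 : 0 < S.vk := by linarith
  have hvk' : 0 < S.vk' := by linarith [hS.one_le_vk']
  have hsB1 : (1 : ℝ) ≤ S.sBar := by exact_mod_cast hS.one_le_sBar
  have hsB : (0 : ℝ) < S.sBar := by linarith
  have hΘ := three_lt_Theta hn
  have hΘ0 : 0 < Theta n := by linarith
  have hm0 : 0 < m0 S := m0_pos hn hS hnu
  have hm0' : (0 : ℝ) < m0 S := by exact_mod_cast hm0
  set K := numPrelim S N with hK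
  set D := noiseFloor S with hDdef
  have hD0 : 0 ≤ D := noiseFloor_nonneg hS hnu
  set a : ℕ → ℝ := fun k => ∫ ω, excess S μφ μξ xs (stageState S sp N (fun i => w i ω) k).1 ∂P
    with ha
  set d : ℕ → ℝ := fun k => ∫ ω, l1Norm ((stageState S sp N (fun i => w i ω) k).2 - xs) ^ 2 ∂P
    with hd
  have hdI : ∀ k, Integrable (fun ω =>
      l1Norm ((stageState S sp N (fun i => w i ω) k).2 - xs) ^ 2) P := by
    intro k
    induction k with
    | zero => exact integrable_const (μ := P) (l1Norm (S.x₀ - xs) ^ 2)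
    | succ k ih => exact (stage_transition hn hS hL hsig hspm hsp hw N k ih).2.2.1
  have htr := fun k => stage_transition hn hS hL hsig hspm hsp hw N k (hdI k)
  -- The starting point x₀ need not be sparse; for the first stage R takes the place of the
  -- sparsification bound.
  have hd0 : d 0 ≤ S.R ^ 2 := by
    have e : d 0 = l1Norm (S.x₀ - xs) ^ 2 := by simp [hd, stageState]
    rw [e, l1Norm_sub_comm]
    exact pow_le_pow_left₀ (l1Norm_nonneg _) hR 2
  have hdnn : ∀ k, 0 ≤ d k := fun k => integral_nonneg fun ω => sq_nonneg _
  set κ := S.kLow / S.sBar with hκ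
  have hκ0 : 0 < κ := by positivity
  have hdrec : ∀ k, d (k + 1) ≤ 16 / κ * a (k + 1) := fun k => by
    have := (htr k).2.2.2
    have e : 16 / κ = 16 * S.sBar / S.kLow := by rw [hκ]; field_simp
    rw [e]
    exact this
  have harec1 : ∀ k < K, a (k + 1) ≤ κ / 32 * (d k + D) := by
    intro k hk
    have h1 := (htr k).2.1
    have e1 : stageLen S N k = m0 S := by unfold stageLen; rw [if_pos hk]
    have e2 : stageBeta S N k = 2 * S.vk * S.nu := by unfold stageBeta; rw [if_pos hk]
    rw [e1, e2] at h1
    have h2 := prelim_coef_le hn hS hnu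
    rw [← hκ] at h2
    have e5 : 2 * (S.vk' * S.varStar) / (2 * S.vk * S.nu) = κ / 32 * D := by
      rw [hDdef, noiseFloor, hκ]; field_simp
    rw [e5] at h1
    have h6 := mul_le_mul_of_nonneg_right h2 (hdnn k)
    simp only [ha, hd] at h6 ⊢
    linarith
  have harec2 : ∀ j, a (K + j + 1) ≤ κ / 128 * d (K + j) + κ / 16 * (D / 2 ^ (j + 1)) := by
    intro j
    have h1 := (htr (K + j)).2.1
    have e1 : stageLen S N (K + j) = mAsym S (j + 1) := by
      unfold stageLen; rw [if_neg (by omega)]; congr 2; omega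
    have e2 : stageBeta S N (K + j) = 2 ^ (j + 1) * S.nu * S.vk := by
      unfold stageBeta; rw [if_neg (by omega), ← hK, Nat.add_sub_cancel_left]
    rw [e1, e2] at h1
    set T : ℝ := 2 ^ (j + 1) with hT
    have hT0 : 0 < T := by positivity
    have h2 := asym_coef_le hn hS hnu j
    rw [← hκ, ← hT] at h2
    have e5 : 2 * (S.vk' * S.varStar) / (T * S.nu * S.vk) = κ / 16 * (D / T) := by
      rw [hDdef, noiseFloor, hκ]; field_simp; ring
    rw [e5] at h1
    have h6 := mul_le_mul_of_nonneg_right h2 (hdnn (K + j))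
    simp only [ha, hd] at h6 ⊢
    linarith
  obtain ⟨hpd, hpa⟩ := prelim_recursion hκ0 hD0 hd0 harec1 fun k _ => hdrec k
  have hNm : 2 ≤ N / m0 S := (Nat.le_div_iff_mul_le hm0).2 hN
  have hfin : algOne S sp N = fun w => (stageState S sp N w (K + numAsym S N)).1 := rfl
  have hK1 : 1 ≤ K := by
    rw [hK, numPrelim]
    split_ifs
    · omega
    · exact le_min (by omega) (le_max_left _ _)
  have hI : Integrable (fun ω => excess S μφ μξ xs (algOne S sp N fun i => w i ω)) P := by
    rw [hfin]
    obtain ⟨k, hk⟩ : ∃ k, K + numAsym S N = k + 1 := ⟨K + numAsym S N - 1, by omega⟩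
    simp only [hk]
    exact (htr k).1
  refine ⟨hI, ?_⟩
  have hgoal : ∫ ω, excess S μφ μξ xs (algOne S sp N fun i => w i ω) ∂P = a (K + numAsym S N) := by
    rw [hfin]
  rw [hgoal]
  have hN0 : 0 < N := by omega
  have hN0' : (0 : ℝ) < N := by exact_mod_cast hN0
  have hvs : 0 ≤ S.varStar := by unfold Setup.varStar; positivity
  have hterm2 : 0 ≤ 32768 * (S.varStar * S.sBar * S.vk' * Theta n / (S.kLow * N)) := by positivity
  have hhalf : ∀ k : ℕ, (N : ℝ) / (2 * m0 S) ≤ k →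
      (1 : ℝ) / 2 ^ k ≤ (1 / 2 : ℝ) ^ ((N : ℝ) / (2 * m0 S)) := by
    intro k hk
    rw [← one_div_pow, ← Real.rpow_natCast]
    exact Real.rpow_le_rpow_of_exponent_ge (by norm_num) (by norm_num) hk
  have hterm1 : 0 ≤ S.kLow * S.R ^ 2 / (4 * S.sBar) * (1 / 2 : ℝ) ^ ((N : ℝ) / (2 * m0 S)) := by
    positivity
  have e2 : ∀ (k : ℕ) (t : ℝ), t / 2 ^ (k + 1) = t / 2 ^ k / 2 := fun k t => by
    rw [pow_succ]; field_simp
  have hdivfloor : (N : ℝ) / (2 * m0 S) ≤ (N / m0 S : ℕ) := by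
    have h1 : N < m0 S * (N / m0 S + 1) := Nat.lt_mul_div_succ N hm0
    have h2 : (N : ℝ) < m0 S * ((N / m0 S : ℕ) + 1) := by exact_mod_cast h1
    have h3 : (2 : ℝ) ≤ (N / m0 S : ℕ) := by exact_mod_cast hNm
    rw [div_le_iff₀ (by positivity)]
    nlinarith
  -- Without noise the floor is zero and there are only preliminary stages.
  by_cases hσ : S.sig = 0
  · have hKe : K = N / m0 S := by rw [hK, numPrelim, if_pos hσ]
    have hAs : numAsym S N = 0 := by rw [numAsym, if_pos hσ]
    have hDz : D = 0 := by rw [hDdef, noiseFloor, Setup.varStar, hσ]; simp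
    obtain ⟨k, hk⟩ : ∃ k, K = k + 1 := ⟨K - 1, by omega⟩
    have h1 := hpa k (by omega)
    rw [hDz] at h1
    rw [hAs, add_zero, hk]
    have h2 := hhalf (k + 1) (by rw [← hk, hKe]; exact hdivfloor)
    rw [e2] at h2
    have h3 : S.kLow * S.R ^ 2 / (4 * S.sBar) * (1 / 2 ^ k / 2)
        ≤ S.kLow * S.R ^ 2 / (4 * S.sBar) * (1 / 2 : ℝ) ^ ((N : ℝ) / (2 * m0 S)) := by gcongr
    have e3 : κ / 32 * (S.R ^ 2 / 2 ^ k + 2 * 0)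
        = S.kLow * S.R ^ 2 / (4 * S.sBar) * (1 / 2 ^ k / 2) / 4 := by
      rw [hκ]; field_simp; ring
    have h4 : 0 ≤ S.kLow * S.R ^ 2 / (4 * S.sBar) * ((1 : ℝ) / 2 ^ k / 2) := by positivity
    linarith
  · have hKe : K = min (N / m0 S) (kBar S) := by rw [hK, numPrelim, if_neg hσ]
    obtain ⟨k, hk⟩ : ∃ k, K = k + 1 := ⟨K - 1, by omega⟩
    rcases Nat.lt_or_ge (N / m0 S) (kBar S) with hlt | hge
    -- The preliminary phase is cut short by the budget. The floor is then still below the geometric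
    -- term, and the exponential term covers both.
    · have hKe' : K = N / m0 S := by omega
      have hAs : numAsym S N = 0 := by
        rw [numAsym, if_neg hσ, Nat.findGreatest_eq_zero_iff]
        intro j hj _ hsum
        have h1 : N < m0 S * kBar S := by
          have h1 : N < m0 S * (N / m0 S + 1) := Nat.lt_mul_div_succ N hm0
          have h2 : m0 S * (N / m0 S + 1) ≤ m0 S * kBar S := Nat.mul_le_mul_left _ hlt
          omega
        have h2 : 0 < ∑ i ∈ Finset.range j, mAsym S (i + 1) :=
          Finset.sum_pos (fun i _ => mAsym_pos hn hS hnu _)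
            ⟨0, Finset.mem_range.2 hj⟩
        omega
      have hDle := noiseFloor_le_sq_R_div hS hnu hσ (k := K) (by omega) (by omega)
      rw [← hDdef, hk, e2] at hDle
      have h1 := hpa k (by omega)
      rw [hAs, add_zero, hk]
      have h2 := hhalf (k + 1) (by rw [← hk, hKe']; exact hdivfloor)
      rw [e2] at h2
      have h3 : S.kLow * S.R ^ 2 / (4 * S.sBar) * (1 / 2 ^ k / 2)
          ≤ S.kLow * S.R ^ 2 / (4 * S.sBar) * (1 / 2 : ℝ) ^ ((N : ℝ) / (2 * m0 S)) := by gcongr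
      have h5 : κ / 32 * (S.R ^ 2 / 2 ^ k + 2 * D)
          ≤ κ / 32 * (4 * (S.R ^ 2 / 2 ^ k / 2)) := by
        gcongr
        linarith
      have e3 : κ / 32 * (4 * (S.R ^ 2 / 2 ^ k / 2))
          = S.kLow * S.R ^ 2 / (4 * S.sBar) * (1 / 2 ^ k / 2) / 2 := by
        rw [hκ]; field_simp; ring
      have h4 : 0 ≤ S.kLow * S.R ^ 2 / (4 * S.sBar) * ((1 : ℝ) / 2 ^ k / 2) := by positivity
      linarith
    · have hKe' : K = kBar S := by omega
      have hRD := sq_R_div_le_noiseFloor hS hnu hσ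
      rw [← hDdef, ← hKe'] at hRD
      have hdK : d K ≤ 2 * D := by
        have := hpd K le_rfl
        linarith
      have hbound : a (K + numAsym S N) ≤ κ / 8 * (D / 2 ^ numAsym S N) := by
        rcases Nat.eq_zero_or_pos (numAsym S N) with h0 | h0
        · rw [h0, add_zero, pow_zero, div_one, hk]
          refine (hpa k (by omega)).trans ?_
          rw [hk, e2] at hRD
          have h3 : S.R ^ 2 / 2 ^ k + 2 * D ≤ 4 * D := by
            linarith
          calc κ / 32 * (S.R ^ 2 / 2 ^ k + 2 * D) ≤ κ / 32 * (4 * D) := by gcongr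
            _ = _ := by ring
        · obtain ⟨j, hj⟩ : ∃ j, numAsym S N = j + 1 := ⟨numAsym S N - 1, by omega⟩
          rw [hj, ← add_assoc]
          exact asym_recursion hκ0 hD0 hdK harec2 hdrec j
      -- The preliminary phase is complete. If it took more than half of the budget, D ≤ R²/2^(kBar
      -- - 1) already gives the exponential term; otherwise at least N/2 observations were left for
      -- the asymptotic phase.
      rcases Nat.lt_or_ge N (2 * m0 S * kBar S) with hlt2 | hge2
      · have hkB2 : 2 ≤ kBar S := by
          by_contra h
          have h1 : kBar S ≤ 1 := by omega
          have : 2 * m0 S * kBar S ≤ 2 * m0 S * 1 := Nat.mul_le_mul_left _ h1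
          omega
        have hDle := noiseFloor_le_sq_R_div hS hnu hσ (k := k) (by omega) (by omega)
        rw [← hDdef] at hDle
        have h2 := hhalf (k + 1) (by
          rw [← hk, hKe', div_le_iff₀ (by positivity)]
          have : (N : ℝ) < 2 * m0 S * kBar S := by exact_mod_cast hlt2
          linarith)
        rw [e2] at h2
        have h3 : S.kLow * S.R ^ 2 / (4 * S.sBar) * (1 / 2 ^ k / 2)
            ≤ S.kLow * S.R ^ 2 / (4 * S.sBar) * (1 / 2 : ℝ) ^ ((N : ℝ) / (2 * m0 S)) := by gcongr
        have h5 : κ / 8 * (D / 2 ^ numAsym S N) ≤ κ / 8 * (S.R ^ 2 / 2 ^ k) := by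
          have h6 : D / 2 ^ numAsym S N ≤ D := div_le_self hD0 (one_le_pow₀ (by norm_num))
          exact mul_le_mul_of_nonneg_left (h6.trans hDle) (by positivity)
        have e3 : κ / 8 * (S.R ^ 2 / 2 ^ k)
            = S.kLow * S.R ^ 2 / (4 * S.sBar) * (1 / 2 ^ k / 2) := by
          rw [hκ]; field_simp; ring
        linarith
      · have h1 := numAsym_spec hn hS hnu hσ N
        set J := numAsym S N with hJ
        -- By maximality of J, one more asymptotic stage would exceed the remaining N/2
        -- observations. The lengths grow geometrically, so 2^J is at least N/(8192 `stageUnit`).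
        have h2 : (N : ℝ) / 2 ≤ ∑ i ∈ Finset.range (J + 1), (mAsym S (i + 1) : ℝ) := by
          have h3 : N < 2 * ∑ i ∈ Finset.range (J + 1), mAsym S (i + 1) := by
            have : 2 * m0 S * kBar S = 2 * (m0 S * kBar S) := by ring
            omega
          have h4 : (N : ℝ) < 2 * ∑ i ∈ Finset.range (J + 1), (mAsym S (i + 1) : ℝ) := by
            exact_mod_cast h3
          linarith
        have h3 : ∑ i ∈ Finset.range (J + 1), (mAsym S (i + 1) : ℝ)
            ≤ 4096 * stageUnit S * 2 ^ J := by
          have hU := three_lt_stageUnit hn hS hnuk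
          calc ∑ i ∈ Finset.range (J + 1), (mAsym S (i + 1) : ℝ)
              ≤ ∑ i ∈ Finset.range (J + 1), 1024 * stageUnit S * 2 ^ (i + 1) :=
                Finset.sum_le_sum fun i _ => mAsym_le hn hS hnuk (i + 1)
            _ = 2048 * stageUnit S * ∑ i ∈ Finset.range (J + 1), (2 : ℝ) ^ i := by
                rw [Finset.mul_sum]
                refine Finset.sum_congr rfl fun i _ => ?_
                rw [pow_succ]; ring
            _ ≤ 2048 * stageUnit S * (2 * 2 ^ J) := by
                rw [geom_sum_eq (by norm_num), pow_succ]
                gcongr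
                norm_num
                linarith
            _ = _ := by ring
        have hterm : κ / 8 * (D / 2 ^ J)
            ≤ 32768 * (S.varStar * S.sBar * S.vk' * Theta n / (S.kLow * N)) := by
          have h4 : 1 / (2 : ℝ) ^ J ≤ 8192 * stageUnit S / N := by
            rw [div_le_div_iff₀ (by positivity) hN0']
            linarith
          calc κ / 8 * (D / 2 ^ J) = κ / 8 * D * (1 / 2 ^ J) := by ring
            _ ≤ κ / 8 * D * (8192 * stageUnit S / N) := by gcongr
            _ = _ := by
              rw [hκ, hDdef, noiseFloor, stageUnit]
              field_simp
              ring
        linarith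

/-- With enough observations, the excess of the output of the multistage algorithm exceeds
`τ²` with small probability. -/
theorem algOne_tail_bound (hn : 3 ≤ n) (hS : S.Valid) (hL : LawAssumptions S μφ μξ)
    (hsig : xs ∈ signals S μφ μξ) {sp : E n → E n} (hspm : Measurable sp)
    (hsp : ∀ x ∈ S.X, IsSparseApprox S.X S.s x (sp x)) {w : ℕ → Ω → E n × ℝ}
    (hw : IsIIDSeq P w (obsLaw S μφ μξ xs)) {N : ℕ} (hN : 8192 * stageUnit S ≤ N) :
    P.real {ω | tauSq S (1 / 2048) 2654208 N < excess S μφ μξ xs (algOne S sp N fun i => w i ω)}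
      ≤ 1 / 81 := by
  have hsm := hsig.2.2.2.1
  have hnuk : S.kLow ≤ S.nu := hsm.kLow_le_nu (by omega) hS hL
  have hk0 := hS.kLow_pos
  have hnu : 0 < S.nu := hk0.trans_le hnuk
  have hvk0 : 0 < S.vk := by linarith [hS.one_le_vk]
  have hvk' : 0 < S.vk' := by linarith [hS.one_le_vk']
  have hsB : (0 : ℝ) < S.sBar := by exact_mod_cast hS.one_le_sBar
  have hΘ0 := Theta_pos hn
  have hvs : 0 ≤ S.varStar := by unfold Setup.varStar; positivity
  have hU := three_lt_stageUnit hn hS hnuk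
  have hm0 := m0_le hn hS hnuk
  have hm0pos : (0 : ℝ) < m0 S := by exact_mod_cast m0_pos hn hS hnu
  have hN0 : (0 : ℝ) < N := by linarith
  have hN2 : 2 * m0 S ≤ N := by
    have : (2 * m0 S : ℝ) ≤ N := by linarith
    exact_mod_cast this
  obtain ⟨hI, hle⟩ := algOne_mean_bound hn hS hL hsig hspm hsp hw hN2
  -- Markov's inequality at 81 times the mean. For the noise term 81 · 32768 = 2654208; for the
  -- exponential term the factor 81/4 is bought by lowering the rate from 1/1024 to 1/2048, as x ≥
  -- 8192.
  refine measure_lt_le_of_integral_le (fun ω => excess_nonneg hS hL xs _) hI (by norm_num) ?_ ?_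
  · unfold tauSq
    positivity
  refine hle.trans ?_
  set x := (N : ℝ) / stageUnit S with hx
  have hx8 : 8192 ≤ x := by rw [hx, le_div_iff₀ (by linarith)]; exact hN
  have e1 : 1 / 2048 * (N : ℝ) * S.kLow / (Theta n * S.vk * S.sBar * S.nu) = x / 2048 := by
    rw [hx, stageUnit]; field_simp
  have h1 : (1 / 2 : ℝ) ^ ((N : ℝ) / (2 * m0 S)) ≤ Real.exp (-(x / 1024)) := by
    have hl : (0.69 : ℝ) < Real.log 2 := by linarith [Real.log_two_gt_d9]
    rw [Real.rpow_def_of_pos (by norm_num), Real.exp_le_exp, one_div, Real.log_inv]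
    have h2 : x / 352 ≤ (N : ℝ) / (2 * m0 S) := by
      rw [hx, div_div]
      exact div_le_div_of_nonneg_left hN0.le (by positivity) (by linarith)
    have h3 : x / 1024 ≤ Real.log 2 * ((N : ℝ) / (2 * m0 S)) := by
      have h4 : 0.69 * (x / 352) ≤ Real.log 2 * ((N : ℝ) / (2 * m0 S)) := by gcongr
      linarith
    linarith
  have h2 : 81 / 4 * Real.exp (-(x / 1024)) ≤ Real.exp (-(x / 2048)) := by
    have h3 : (81 : ℝ) / 4 ≤ Real.exp (x / 2048) := by
      have h4 : (2.7 : ℝ) ≤ Real.exp 1 := by linarith [Real.exp_one_gt_d9]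
      calc (81 : ℝ) / 4 ≤ 2.7 ^ 4 := by norm_num
        _ ≤ Real.exp 1 ^ 4 := by gcongr
        _ = Real.exp 4 := by rw [← Real.exp_nat_mul]; norm_num
        _ ≤ _ := Real.exp_le_exp.2 (by linarith)
    calc 81 / 4 * Real.exp (-(x / 1024)) ≤ Real.exp (x / 2048) * Real.exp (-(x / 1024)) := by gcongr
      _ = _ := by rw [← Real.exp_add]; congr 1; ring
  unfold tauSq
  rw [e1]
  have h5 : S.kLow * S.R ^ 2 / (4 * S.sBar) * (1 / 2 : ℝ) ^ ((N : ℝ) / (2 * m0 S))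
      ≤ S.kLow * S.R ^ 2 / (4 * S.sBar) * Real.exp (-(x / 1024)) := by gcongr
  have h6 : S.kLow * S.R ^ 2 / S.sBar * (81 / 4 * Real.exp (-(x / 1024)))
      ≤ S.kLow * S.R ^ 2 / S.sBar * Real.exp (-(x / 2048)) := by gcongr
  have e2 : S.kLow * S.R ^ 2 / (4 * S.sBar) * Real.exp (-(x / 1024))
      = S.kLow * S.R ^ 2 / S.sBar * (81 / 4 * Real.exp (-(x / 1024))) / 81 := by field_simp
  linarith

end AlgOne

/-! ### Order statistics and medians -/

section OrderStat

variable {ι : Type*} {I : Finset ι} {v : ι → ℝ} {k : ℕ}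

theorem bddBelow_orderStat (hk : 1 ≤ k) :
    BddBelow {t : ℝ | k ≤ (I.filter (fun i => v i ≤ t)).card} := by
  refine ⟨-∑ i ∈ I, |v i|, fun t ht => ?_⟩
  have ht : k ≤ (I.filter (fun i => v i ≤ t)).card := ht
  obtain ⟨i, hi⟩ := Finset.card_pos.1 (lt_of_lt_of_le hk ht)
  rw [Finset.mem_filter] at hi
  have h1 := Finset.single_le_sum (f := fun i => |v i|) (fun _ _ => abs_nonneg _) hi.1
  have h2 := neg_abs_le (v i)
  linarith [hi.2]

theorem nonempty_orderStat (hk : k ≤ I.card) :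
    {t : ℝ | k ≤ (I.filter (fun i => v i ≤ t)).card}.Nonempty := by
  refine ⟨∑ i ∈ I, |v i|, ?_⟩
  have : I.filter (fun i => v i ≤ ∑ i ∈ I, |v i|) = I := by
    refine Finset.filter_true_of_mem fun i hi => (le_abs_self _).trans ?_
    exact Finset.single_le_sum (f := fun i => |v i|) (fun _ _ => abs_nonneg _) hi
  simpa [this] using hk

theorem orderStat_le (hk : 1 ≤ k) {t : ℝ} (h : k ≤ (I.filter (fun i => v i ≤ t)).card) :
    orderStat I v k ≤ t := csInf_le (bddBelow_orderStat hk) h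

theorem le_orderStat (hk : k ≤ I.card) {t : ℝ} (h : (I.filter (fun i => v i < t)).card < k) :
    t ≤ orderStat I v k := by
  refine le_csInf (nonempty_orderStat hk) fun u hu => ?_
  by_contra! hlt
  have hu : k ≤ (I.filter (fun i => v i ≤ u)).card := hu
  have : (I.filter (fun i => v i ≤ u)).card ≤ (I.filter (fun i => v i < t)).card :=
    Finset.card_le_card (Finset.monotone_filter_right I fun i _ (hi : v i ≤ u) =>
      lt_of_le_of_lt hi hlt)
  omega

/-- The infimum defining the order statistic is attained: if too few values were at most t, the
smallest value above t would separate t from the order statistic. -/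
theorem le_card_of_orderStat_le (hk : k ≤ I.card) {t : ℝ} (h : orderStat I v k ≤ t) :
    k ≤ (I.filter (fun i => v i ≤ t)).card := by
  by_contra! hlt
  set J := I.filter (fun i => t < v i) with hJ
  have hcard : (I.filter (fun i => v i ≤ t)).card + J.card = I.card := by
    rw [hJ, ← Finset.card_filter_add_card_filter_not (s := I) (fun i => v i ≤ t)]
    simp only [not_le]
  have hJne : J.Nonempty := Finset.card_pos.1 (by omega)
  have h1 : t < J.inf' hJne v := by
    rw [Finset.lt_inf'_iff]
    exact fun i hi => (Finset.mem_filter.1 hi).2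
  have h2 : J.inf' hJne v ≤ orderStat I v k := by
    refine le_orderStat hk (lt_of_le_of_lt (Finset.card_le_card fun i hi => ?_) hlt)
    rw [Finset.mem_filter] at hi ⊢
    refine ⟨hi.1, ?_⟩
    by_contra! hti
    have : i ∈ J := Finset.mem_filter.2 ⟨hi.1, hti⟩
    exact absurd (Finset.inf'_le v this) (not_le.2 hi.2)
  linarith

/-- If fewer than half of the values are at a distance more than `r` from `c`, so is the median. -/
theorem abs_median_sub_le {k : ℕ} {v : ℕ → ℝ} {c r : ℝ}
    (h : 2 * ((Finset.range k).filter (fun l => r < |v l - c|)).card < k) :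
    |median k v - c| ≤ r := by
  set bad := (Finset.range k).filter (fun l => r < |v l - c|) with hbad
  -- Both ranks averaged in `median` satisfy k ≤ 2j ≤ k + 2. A value of such a rank outside [c - r,
  -- c + r] would need at least j bad values below or k - j + 1 above, and there are fewer than k/2.
  have hgood : ∀ j, 2 * j ≤ k + 1 ∨ 2 * j ≤ k + 2 → 1 ≤ j → j ≤ k →
      k ≤ 2 * j → c - r ≤ orderStat (Finset.range k) v j ∧
        orderStat (Finset.range k) v j ≤ c + r := by
    intro j hj1 hj2 hj3 hj4
    constructor
    · refine le_orderStat (by simpa using hj3) ?_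
      have : ((Finset.range k).filter (fun i => v i < c - r)).card ≤ bad.card := by
        refine Finset.card_le_card (Finset.monotone_filter_right _ fun i _ (hi : v i < c - r) => ?_)
        rw [lt_abs]; right; linarith
      omega
    · refine orderStat_le hj2 ?_
      have h1 : ((Finset.range k).filter (fun i => v i ≤ c + r)).card + bad.card ≥ k := by
        have h2 := Finset.card_filter_add_card_filter_not (s := Finset.range k)
          (fun i => v i ≤ c + r)
        have h3 : ((Finset.range k).filter (fun i => ¬ v i ≤ c + r)).card ≤ bad.card := by
          refine Finset.card_le_card
            (Finset.monotone_filter_right _ fun i _ (hi : ¬ v i ≤ c + r) => ?_)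
          rw [lt_abs]; left; push Not at hi; linarith
        rw [Finset.card_range] at h2
        omega
      omega
  have hk : 1 ≤ k := by omega
  obtain ⟨h1, h2⟩ := hgood ((k + 1) / 2) (by omega) (by omega) (by omega) (by omega)
  obtain ⟨h3, h4⟩ := hgood (k / 2 + 1) (by omega) (by omega) (by omega) (by omega)
  unfold median
  rw [abs_le]
  constructor <;> linarith

end OrderStat

/-! ### The set of closest points -/

section Closest

variable {n L : ℕ} {x : ℕ → E n} {i₀ : ℕ} {I : Finset ℕ}

/-- Any good point has L/2 + 1 other good points within 2d, so the minimizing centre also has L/2 +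
1 neighbours within 2d. With itself that is more points than I has, so the closest ones all lie
within 2d of the centre. Since |I| + |G| > L, the sets I and G meet. -/
theorem closestSet_geometry {xs : E n} {d : ℝ} {G : Finset ℕ} (hG : G ⊆ Finset.range L)
    (hGd : ∀ l ∈ G, ‖x l - xs‖ ≤ d) (hcard : L / 2 + 2 ≤ G.card) (hc : IsCenter L x i₀)
    (hI : IsClosestSet L x i₀ I) :
    (∀ i ∈ I, ∀ j ∈ I, ‖x i - x j‖ ≤ 4 * d) ∧ ∃ j ∈ I, j ∈ G := by
  classical
  have hGL : G.card ≤ L := by simpa using Finset.card_le_card hG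
  obtain ⟨i, hi⟩ := Finset.card_pos.1 (by omega : 0 < G.card)
  have hstat : orderStat ((Finset.range L).erase i) (fun j => ‖x i - x j‖) (L / 2 + 1)
      ≤ 2 * d := by
    refine orderStat_le (by omega) ?_
    have h1 : G.erase i ⊆ ((Finset.range L).erase i).filter (fun j => ‖x i - x j‖ ≤ 2 * d) := by
      intro j hj
      rw [Finset.mem_erase] at hj
      refine Finset.mem_filter.2 ⟨Finset.mem_erase.2 ⟨hj.1, hG hj.2⟩, ?_⟩
      have h2 := norm_sub_le (x i - xs) (x j - xs)
      rw [sub_sub_sub_cancel_right] at h2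
      linarith [hGd i hi, hGd j hj.2]
    have h2 := Finset.card_le_card h1
    rw [Finset.card_erase_of_mem hi] at h2
    omega
  have hi₀ := (hc.2 i (hG hi)).trans hstat
  have hcount := le_card_of_orderStat_le (by
    rw [Finset.card_erase_of_mem hc.1, Finset.card_range]; omega) hi₀
  set near := insert i₀ (((Finset.range L).erase i₀).filter (fun j => ‖x i₀ - x j‖ ≤ 2 * d))
    with hnear
  have hd0 : 0 ≤ d := (norm_nonneg _).trans (hGd i hi)
  have hnearcard : L / 2 + 2 ≤ near.card := by
    rw [hnear, Finset.card_insert_of_notMem (by simp)]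
    omega
  have hnearL : ∀ j ∈ near, j ∈ Finset.range L ∧ ‖x j - x i₀‖ ≤ 2 * d := by
    intro j hj
    rw [hnear, Finset.mem_insert] at hj
    rcases hj with rfl | hj
    · exact ⟨hc.1, by simp; exact hd0⟩
    · rw [Finset.mem_filter, Finset.mem_erase] at hj
      exact ⟨hj.1.2, by rw [norm_sub_rev]; exact hj.2⟩
  obtain ⟨hIL, hIc, hIcl⟩ := hI
  have hrad : ∀ i ∈ I, ‖x i - x i₀‖ ≤ 2 * d := by
    intro i hiI
    by_contra! hfar
    have hsub : near ⊆ I := by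
      intro j hj
      by_contra hjI
      have h1 := hIcl i hiI j (hnearL j hj).1 hjI
      linarith [(hnearL j hj).2]
    have := Finset.card_le_card hsub
    omega
  constructor
  · intro i hi j hj
    have h2 := norm_sub_le (x i - x i₀) (x j - x i₀)
    rw [sub_sub_sub_cancel_right] at h2
    linarith [hrad i hi, hrad j hj]
  · by_contra! hdis
    have hd : Disjoint I G := Finset.disjoint_left.2 hdis
    have h1 := Finset.card_le_card (Finset.union_subset hIL hG)
    rw [Finset.card_union_of_disjoint hd, Finset.card_range] at h1
    omega

end Closest

/-! ### Counting failures over disjoint blocks -/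

section Blocks

variable {Ω A : Type*} [MeasurableSpace Ω] [MeasurableSpace A] [Inhabited A]
  {P : Measure Ω} [IsProbabilityMeasure P] {w : ℕ → Ω → A} {π : Measure A}

open Classical in
/-- Exponential bound for the number of blocks of length `M` on which the event `B` occurs. -/
theorem IsIIDSeq.block_count_bound (hw : IsIIDSeq P w π) {B : Set (ℕ → A)} (hB : MeasurableSet B)
    {M : ℕ} (hdep : ∀ v v' : ℕ → A, (∀ j < M, v j = v' j) → (v ∈ B ↔ v' ∈ B)) {p : ℝ}
    (hp : ∀ l, P.real {ω | (fun i => w (l * M + i) ω) ∈ B} ≤ p) {s : ℝ} (hs : 1 ≤ s)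
    (q k L : ℕ) :
    P.real {ω | k ≤ q * ((Finset.range L).filter
      (fun l => (fun i => w (l * M + i) ω) ∈ B)).card} ≤ (1 + p * (s ^ q - 1)) ^ L / s ^ k := by
  have hs0 : 0 < s := by linarith
  -- Chernoff weights: their product over the blocks is s to the power q times the number of bad
  -- blocks, its mean factorizes by independence, and Markov's inequality is applied at s^k.
  set z : ℕ → (ℕ → A) → ℝ := fun l v => if (fun i => v (l * M + i)) ∈ B then s ^ q else 1 with hz
  have hBm : ∀ l, MeasurableSet {v : ℕ → A | (fun i => v (l * M + i)) ∈ B} := fun l => by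
    have : Measurable fun v : ℕ → A => fun i => v (l * M + i) :=
      measurable_pi_lambda _ fun i => measurable_pi_apply _
    exact this hB
  have hzm : ∀ l, Measurable (z l) := fun l =>
    Measurable.ite (hBm l) measurable_const measurable_const
  have hsq : 1 ≤ s ^ q := one_le_pow₀ hs
  have hz1 : ∀ l v, 1 ≤ z l v := fun l v => by simp only [hz]; split_ifs <;> simp [hsq]
  have hzle : ∀ l v, z l v ≤ s ^ q := fun l v => by simp only [hz]; split_ifs <;> simp [hsq]
  have hwm : Measurable fun ω => fun i => w i ω := measurable_pi_lambda _ hw.meas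
  set Z : ℕ → Ω → ℝ := fun l ω => z l fun i => w i ω with hZ
  have hZm : ∀ l, Measurable (Z l) := fun l => (hzm l).comp hwm
  have hZI : ∀ l, Integrable (Z l) P := fun l =>
    Integrable.of_bound (hZm l).aestronglyMeasurable (s ^ q) (Filter.Eventually.of_forall fun ω => by
      rw [Real.norm_eq_abs, abs_of_nonneg (by linarith [hz1 l fun i => w i ω])]
      exact hzle l fun i => w i ω)
  have hZE : ∀ l, ∫ ω, Z l ω ∂P ≤ 1 + p * (s ^ q - 1) := by
    intro l
    set D := {ω | (fun i => w (l * M + i) ω) ∈ B} with hD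
    have hDm : MeasurableSet D := hwm (hBm l)
    have e : ∀ ω, Z l ω = 1 + D.indicator (fun _ => s ^ q - 1) ω := fun ω => by
      by_cases h : ω ∈ D
      · have h' : (fun i => w (l * M + i) ω) ∈ B := h
        simp [hZ, hz, h', h]
      · have h' : ¬ (fun i => w (l * M + i) ω) ∈ B := h
        simp [hZ, hz, h', h]
    simp_rw [e]
    rw [integral_add (integrable_const _) ((integrable_const _).indicator hDm),
      integral_indicator_const _ hDm]
    simp only [integral_const, probReal_univ, smul_eq_mul]
    have := mul_le_mul_of_nonneg_right (hp l) (by linarith : 0 ≤ s ^ q - 1)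
    linarith
  have hp0 : 0 ≤ p := measureReal_nonneg.trans (hp 0)
  have hc0 : 0 ≤ 1 + p * (s ^ q - 1) := by
    have := mul_nonneg hp0 (by linarith : 0 ≤ s ^ q - 1)
    linarith
  have hprodm : ∀ L, Measurable fun v : ℕ → A => ∏ l ∈ Finset.range L, z l v := fun L =>
    Finset.measurable_fun_prod _ fun l _ => hzm l
  have hprodI : ∀ L, Integrable (fun ω => ∏ l ∈ Finset.range L, Z l ω) P := fun L => by
    refine Integrable.of_bound ((hprodm L).comp hwm).aestronglyMeasurable ((s ^ q) ^ L)
      (Filter.Eventually.of_forall fun ω => ?_)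
    rw [Real.norm_eq_abs, abs_of_nonneg (Finset.prod_nonneg fun l _ => by linarith [hz1 l fun i => w i ω])]
    calc ∏ l ∈ Finset.range L, Z l ω ≤ ∏ _l ∈ Finset.range L, s ^ q :=
          Finset.prod_le_prod (fun l _ => by linarith [hz1 l fun i => w i ω]) fun l _ =>
            hzle l fun i => w i ω
      _ = _ := by simp
  have hprod : ∀ L, ∫ ω, ∏ l ∈ Finset.range L, Z l ω ∂P ≤ (1 + p * (s ^ q - 1)) ^ L := by
    intro L
    induction L with
    | zero => simp
    | succ L ih =>
      have hind : IndepFun (fun ω => ∏ l ∈ Finset.range L, Z l ω) (Z L) P := by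
        refine hw.indepFun (hprodm L) (hzm L) (s := Finset.range (L * M))
          (t := Finset.Ico (L * M) (L * M + M)) ?_ ?_ ?_
        · rw [Finset.disjoint_left]
          intro j hj hj'
          simp at hj hj'
          omega
        · intro v v' hv
          refine Finset.prod_congr rfl fun l hl => ?_
          have hl := Finset.mem_range.1 hl
          simp only [hz]
          rw [hdep (fun i => v (l * M + i)) (fun i => v' (l * M + i)) fun j hj => hv _ ?_]
          have : (l + 1) * M ≤ L * M := Nat.mul_le_mul_right _ hl
          simp only [Finset.coe_range, Set.mem_Iio]
          linarith
        · intro v v' hv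
          simp only [hz]
          rw [hdep (fun i => v (L * M + i)) (fun i => v' (L * M + i)) fun j hj => hv _ ?_]
          simp [hj]
      simp only [Finset.prod_range_succ]
      rw [pow_succ]
      have h1 := hind.integral_mul_eq_mul_integral (hprodI L).aestronglyMeasurable
        (hZI L).aestronglyMeasurable
      simp only [Pi.mul_apply] at h1
      rw [h1]
      exact mul_le_mul ih (hZE L) (integral_nonneg fun ω => by
        have := hz1 L fun i => w i ω
        simp only [hZ, Pi.zero_apply]; linarith) (by positivity)
  have hval : ∀ ω, ∏ l ∈ Finset.range L, Z l ω = s ^ (q * ((Finset.range L).filter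
      (fun l => (fun i => w (l * M + i) ω) ∈ B)).card) := fun ω => by
    simp only [hZ, hz]
    rw [Finset.prod_ite]
    simp [pow_mul]
  have hmark := mul_meas_ge_le_integral_of_nonneg (μ := P)
    (Filter.Eventually.of_forall fun ω => Finset.prod_nonneg fun l _ => by
      have := hz1 l fun i => w i ω
      simp only [hZ]; linarith) (hprodI L) (s ^ k)
  rw [le_div_iff₀ (by positivity), mul_comm]
  refine le_trans (mul_le_mul_of_nonneg_left (measureReal_mono fun ω hω => ?_) (by positivity))
    (hmark.trans (hprod L))
  simp only [Set.mem_ofPred_eq] at hω ⊢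
  rw [hval]
  exact pow_le_pow_right₀ hs hω

end Blocks

/-! ### The observations used by the multistage algorithm -/

section Usage

variable {n : ℕ} {S : Setup n}

/-- Independence of the runs rests on this: no run reads past the end of its own subsample. -/
theorem sum_stageLen_le (S : Setup n) (N : ℕ) :
    ∑ k ∈ Finset.range (numPrelim S N + numAsym S N), stageLen S N k ≤ N := by
  have h1 : ∑ k ∈ Finset.range (numPrelim S N), stageLen S N k = numPrelim S N * m0 S := by
    rw [Finset.sum_congr rfl (g := fun _ => m0 S) fun k hk => ?_]
    · simp
    · simp [stageLen, Finset.mem_range.1 hk]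
  have h2 : ∑ k ∈ Finset.range (numAsym S N), stageLen S N (numPrelim S N + k)
      = ∑ k ∈ Finset.range (numAsym S N), mAsym S (k + 1) :=
    Finset.sum_congr rfl fun k _ => by simp [stageLen]
  rw [Finset.sum_range_add, h1, h2]
  have h3 := Nat.div_mul_le_self N (m0 S)
  by_cases hsig : S.sig = 0
  · simpa [numPrelim, numAsym, hsig] using h3
  · have h4 : ∑ k ∈ Finset.range (numAsym S N), mAsym S (k + 1) ≤ N - m0 S * kBar S := by
      simp only [numAsym, hsig, if_false]
      exact Nat.findGreatest_spec (P := fun k => (∑ i ∈ Finset.range k, mAsym S (i + 1))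
        ≤ N - m0 S * kBar S) (Nat.zero_le N) (by simp)
    have h5 : numPrelim S N * m0 S ≤ N / m0 S * m0 S := by
      simp only [numPrelim, hsig, if_false]
      exact Nat.mul_le_mul_right _ (min_le_left _ _)
    have h6 : numPrelim S N * m0 S ≤ m0 S * kBar S := by
      simp only [numPrelim, hsig, if_false]
      rw [mul_comm (m0 S)]
      exact Nat.mul_le_mul_right _ (min_le_right _ _)
    omega

theorem algOne_congr (sp : E n → E n) (N : ℕ) {w w' : ℕ → E n × ℝ}
    (h : ∀ j < N, w j = w' j) : algOne S sp N w = algOne S sp N w' := by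
  unfold algOne
  rw [stageState_congr sp N fun j hj => h j (hj.trans_le (sum_stageLen_le S N))]

theorem candidate_congr (sp : E n → E n) {N L l : ℕ} (hl : l < L) {w w' : ℕ → E n × ℝ}
    (h : ∀ j < N, w j = w' j) : candidate S sp N L w l = candidate S sp N L w' l := by
  refine algOne_congr sp _ fun j hj => h _ ?_
  have h1 : (l + 1) * (N / L) ≤ L * (N / L) := Nat.mul_le_mul_right _ hl
  have h2 := Nat.mul_div_le N L
  have h3 : (l + 1) * (N / L) = l * (N / L) + N / L := by ring
  omega

theorem measurable_candidate (hn : 3 ≤ n) (hS : S.Valid) (hnu : 0 < S.nu) {sp : E n → E n}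
    (hspm : Measurable sp) (N L l : ℕ) :
    Measurable fun w : ℕ → E n × ℝ => candidate S sp N L w l := by
  have h : Measurable fun w : ℕ → E n × ℝ => fun i => w (l * (N / L) + i) :=
    measurable_pi_lambda _ fun i => measurable_pi_apply _
  exact (measurable_algOne hn hS hnu hspm (N / L)).comp h

variable {μφ : Measure (E n)} {μξ : Measure ℝ} {Ω : Type*} [MeasurableSpace Ω] {P : Measure Ω}

theorem IsIIDSample.isIIDSeq (hS : S.Valid) {φ : ℕ → Ω → E n} {ξ : ℕ → Ω → ℝ}
    (h : IsIIDSample P φ ξ μφ μξ) (xs : E n) :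
    IsIIDSeq P (fun i ω => observations S φ ξ xs ω i) (obsLaw S μφ μξ xs) := by
  have hm : ∀ i, Measurable fun ω => (φ i ω, ξ i ω) := fun i => (h.measφ i).prodMk (h.measξ i)
  refine ⟨fun i => (measurable_response hS xs).comp (hm i),
    h.indep.comp (fun _ w => (w.1, response S xs w.1 w.2)) fun _ => measurable_response hS xs,
    fun i => ?_⟩
  rw [obsLaw, ← h.law i, Measure.map_map (measurable_response hS xs) (hm i)]
  rfl

end Usage

/-! ### Estimating differences of the objective -/

section Comparison

variable {n : ℕ} {S : Setup n} {μφ : Measure (E n)} {μξ : Measure ℝ} {xs : E n}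

theorem matNorm_smul_sq (hL : LawAssumptions S μφ μξ) (t : ℝ) (z : E n) :
    matNorm (secondMoment μφ) (t • z) ^ 2 = t ^ 2 * matNorm (secondMoment μφ) z ^ 2 := by
  rw [matNorm_sq_eq_integral hL, matNorm_sq_eq_integral hL, ← integral_const_mul]
  refine integral_congr_ae (Filter.Eventually.of_forall fun f => ?_)
  simp only [inner_smul_right]
  ring

/-- The error of the midpoint rule for the increment of the objective. -/
theorem midpoint_rule_error (hS : S.Valid) (hL : LawAssumptions S μφ μξ) (xs a b : E n) {m : ℕ}
    (hm : 0 < m) :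
    |(m : ℝ)⁻¹ * ∑ k ∈ Finset.range m, inner ℝ (gradField S μφ xs
        (a + ((2 * (k + 1 : ℝ) - 1) / (2 * m)) • (b - a))) (b - a)
      - (excess S μφ μξ xs b - excess S μφ μξ xs a)|
      ≤ S.uHi * matNorm (secondMoment μφ) (b - a) ^ 2 / (8 * m) := by
  have hm' : (0 : ℝ) < m := by exact_mod_cast hm
  set q := matNorm (secondMoment μφ) (b - a) ^ 2 with hq
  set F : ℕ → ℝ := fun k => objective S μφ μξ xs (a + ((k : ℝ) / m) • (b - a)) with hF
  have htel : excess S μφ μξ xs b - excess S μφ μξ xs a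
      = ∑ k ∈ Finset.range m, (F (k + 1) - F k) := by
    rw [Finset.sum_range_sub]
    simp only [hF, excess]
    rw [div_self hm'.ne', one_smul, add_sub_cancel]
    simp
  rw [htel, Finset.mul_sum, ← Finset.sum_sub_distrib]
  have hterm : ∀ k ∈ Finset.range m, |(m : ℝ)⁻¹ * inner ℝ (gradField S μφ xs
      (a + ((2 * (k + 1 : ℝ) - 1) / (2 * m)) • (b - a))) (b - a) - (F (k + 1) - F k)|
      ≤ S.uHi * q / (8 * m ^ 2) := by
    intro k _
    set p := a + ((2 * (k + 1 : ℝ) - 1) / (2 * m)) • (b - a) with hp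
    set D := inner ℝ (gradField S μφ xs p) (b - a) with hD
    have e1 : a + (((k + 1 : ℕ) : ℝ) / m) • (b - a) - p = (1 / (2 * m) : ℝ) • (b - a) := by
      have : (((k + 1 : ℕ) : ℝ) / m) = (2 * (k + 1 : ℝ) - 1) / (2 * m) + 1 / (2 * m) := by
        push_cast; field_simp; ring
      rw [this, hp]; module
    have e2 : a + ((k : ℝ) / m) • (b - a) - p = (-(1 / (2 * m)) : ℝ) • (b - a) := by
      have : ((k : ℝ) / m) = (2 * (k + 1 : ℝ) - 1) / (2 * m) - 1 / (2 * m) := by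
        field_simp; ring
      rw [this, hp]; module
    -- Both ends of a cell are expanded at its midpoint. The linear terms add up to the midpoint
    -- value, while the two remainders lie in [0, ūq/(8m²)] and enter with opposite signs, so they
    -- do not accumulate.
    have h1 := objective_bounds (μξ := μξ) hS hL xs p (a + (((k + 1 : ℕ) : ℝ) / m) • (b - a))
    have h2 := objective_bounds (μξ := μξ) hS hL xs p (a + ((k : ℝ) / m) • (b - a))
    rw [e1, matNorm_smul_sq hL, inner_smul_right] at h1
    rw [e2, matNorm_smul_sq hL, inner_smul_right] at h2
    have hF1 : F (k + 1) = objective S μφ μξ xs (a + (((k + 1 : ℕ) : ℝ) / m) • (b - a)) := rfl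
    have hF0 : F k = objective S μφ μξ xs (a + ((k : ℝ) / m) • (b - a)) := rfl
    rw [← hF1, ← hD, ← hq] at h1
    rw [← hF0, ← hD, ← hq] at h2
    have hq0 : 0 ≤ q := sq_nonneg _
    have hul := hS.uLo_pos
    have h3 : 0 ≤ S.uLo / 2 * ((1 / (2 * m)) ^ 2 * q) := by positivity
    have h4 : 0 ≤ S.uLo / 2 * ((-(1 / (2 * m))) ^ 2 * q) := by positivity
    have e3 : S.uHi / 2 * ((1 / (2 * m)) ^ 2 * q) = S.uHi * q / (8 * m ^ 2) := by
      field_simp; ring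
    have e4 : S.uHi / 2 * ((-(1 / (2 * m))) ^ 2 * q) = S.uHi * q / (8 * m ^ 2) := by
      field_simp; ring
    rw [e3] at h1
    rw [e4] at h2
    have e5 : (m : ℝ)⁻¹ * D = 1 / (2 * m) * D + 1 / (2 * m) * D := by field_simp; ring
    rw [e5, abs_le]
    constructor <;> linarith [h1.1, h1.2, h2.1, h2.2]
  calc _ ≤ ∑ k ∈ Finset.range m, S.uHi * q / (8 * m ^ 2) :=
        (Finset.abs_sum_le_sum_abs _ _).trans (Finset.sum_le_sum hterm)
    _ = _ := by
        rw [Finset.sum_const, Finset.card_range, nsmul_eq_mul]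
        field_simp

/-- A bound on the variance of the estimate of the increment of the objective from `a` to `b`
with `m` observations. -/
def cmpVar (S : Setup n) (μφ : Measure (E n)) (μξ : Measure ℝ) (xs : E n) (m : ℕ) (a b : E n) : ℝ :=
  (m : ℝ)⁻¹ * (S.chi * (S.uHi * sigma1 (secondMoment μφ)) * ‖b - a‖ ^ 2
      * ((excess S μφ μξ xs a + excess S μφ μξ xs b) / 2)
    + S.sig ^ 2 * matNorm (secondMoment μφ) (b - a) ^ 2)

/-- The accuracy of the estimate of the increment of the objective from `a` to `b` with `m`
observations. -/
def cmpErr (S : Setup n) (μφ : Measure (E n)) (μξ : Measure ℝ) (xs : E n) (m : ℕ) (a b : E n) : ℝ :=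
  2 * Real.sqrt (cmpVar S μφ μξ xs m a b)
    + S.uHi * matNorm (secondMoment μφ) (b - a) ^ 2 / (8 * m)

theorem cmpVar_nonneg (hS : S.Valid) (hL : LawAssumptions S μφ μξ) (xs : E n) (m : ℕ) (a b : E n) :
    0 ≤ cmpVar S μφ μξ xs m a b := by
  have h1 := excess_nonneg hS hL xs a
  have h2 := excess_nonneg hS hL xs b
  have h3 := hS.uHi_pos
  have h4 : 0 < S.chi := by linarith [hS.one_le_chi]
  have h5 := sigma1_nonneg (secondMoment μφ)
  unfold cmpVar
  positivity

/-- The midpoints average to 1/2, which explains the mean of the two excesses in `cmpVar`. -/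
theorem sum_midpoints (m : ℕ) :
    ∑ k ∈ Finset.range m, (2 * (k + 1 : ℝ) - 1) / (2 * m) = m / 2 := by
  rcases Nat.eq_zero_or_pos m with rfl | hm
  · simp
  have h : ∀ j : ℕ, ∑ k ∈ Finset.range j, (2 * (k + 1 : ℝ) - 1) = j ^ 2 := fun j => by
    induction j with
    | zero => simp
    | succ j ih => rw [Finset.sum_range_succ, ih]; push_cast; ring
  have hm' : (0 : ℝ) < m := by exact_mod_cast hm
  rw [← Finset.sum_div, h]
  field_simp

variable {Ω : Type*} [MeasurableSpace Ω] {P : Measure Ω} [IsProbabilityMeasure P]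

/-- For fixed a and b the summands are independent, so their variances add. Each second moment is
affine in the excess at a point of the segment, which convexity interpolates between the ends.
Chebyshev's inequality at twice the standard deviation bound gives 1/4, and the midpoint bias is
added on top. -/
theorem diffEst_tail_bound (hS : S.Valid) (hL : LawAssumptions S μφ μξ)
    (hF : FourthMomentCond S μφ xs) {w : ℕ → Ω → E n × ℝ} (hw : IsIIDSeq P w (obsLaw S μφ μξ xs))
    {m : ℕ} (hm : 0 < m) {a b : E n} (ha : a ∈ S.X) (hb : b ∈ S.X) :
    P.real {ω | cmpErr S μφ μξ xs m a b < |diffEst S m (fun i => w i ω) a b 0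
      - (excess S μφ μξ xs b - excess S μφ μξ xs a)|} ≤ 1 / 4 := by
  have hm' : (0 : ℝ) < m := by exact_mod_cast hm
  set t : ℕ → ℝ := fun k => (2 * (k + 1 : ℝ) - 1) / (2 * m) with ht
  set p : ℕ → E n := fun k => a + t k • (b - a) with hp
  have ht01 : ∀ k ∈ Finset.range m, 0 ≤ t k ∧ t k ≤ 1 := fun k hk => by
    have h1 : (k : ℝ) + 1 ≤ m := by exact_mod_cast Finset.mem_range.1 hk
    have h0 : (0 : ℝ) ≤ k := Nat.cast_nonneg k
    constructor
    · exact div_nonneg (by linarith) (by linarith)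
    · rw [ht]; simp only; rw [div_le_one (by linarith)]; linarith
  have hpX : ∀ k ∈ Finset.range m, p k ∈ S.X := fun k hk =>
    hS.X_convex.add_smul_sub_mem ha hb ⟨(ht01 k hk).1, (ht01 k hk).2⟩
  set q := matNorm (secondMoment μφ) (b - a) ^ 2 with hq
  set cA := S.chi * (S.uHi * sigma1 (secondMoment μφ)) * ‖b - a‖ ^ 2 with hcA
  have hcA0 : 0 ≤ cA := by
    have h3 := hS.uHi_pos
    have h4 : 0 < S.chi := by linarith [hS.one_le_chi]
    have h5 := sigma1_nonneg (secondMoment μφ)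
    positivity
  set Y : ℕ → E n × ℝ → ℝ := fun k v => inner ℝ (stochGrad S.u (p k) v) (b - a) with hY
  have hYm : ∀ k, Measurable (Y k) := fun k => measurable_inner_stochGrad hS _ _
  have hYb : ∀ k ∈ Finset.range m, MemLp (Y k) 2 (obsLaw S μφ μξ xs) ∧
      ∫ v, Y k v ^ 2 ∂(obsLaw S μφ μξ xs) ≤ cA * excess S μφ μξ xs (p k) + S.sig ^ 2 * q :=
    fun k hk => directional_sq_bound hS hL hF (hpX k hk) (b - a)
  set Z : ℕ → Ω → ℝ := fun k ω => Y k (w k ω) with hZ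
  have hZL : ∀ k ∈ Finset.range m, MemLp (Z k) 2 P := fun k hk => by
    have := (hYb k hk).1
    rw [← hw.law k] at this
    exact this.comp_of_map (hw.meas k).aemeasurable
  have hZE : ∀ k, ∫ ω, Z k ω ∂P = inner ℝ (gradField S μφ xs (p k)) (b - a) := fun k => by
    rw [← integral_inner_stochGrad (μξ := μξ) hS hL, ← hw.law k,
      integral_map (hw.meas k).aemeasurable (hYm k).aestronglyMeasurable]
  have hZ2 : ∀ k, ∫ ω, Z k ω ^ 2 ∂P = ∫ v, Y k v ^ 2 ∂(obsLaw S μφ μξ xs) := fun k => by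
    rw [← hw.law k,
      integral_map (hw.meas k).aemeasurable ((hYm k).pow_const 2).aestronglyMeasurable]
  set D : Ω → ℝ := fun ω => (m : ℝ)⁻¹ * ∑ k ∈ Finset.range m, Z k ω with hD
  have hDd : ∀ ω, diffEst S m (fun i => w i ω) a b 0 = D ω := fun ω => by
    simp only [diffEst, hD, hZ, hY, hp, ht, zero_mul, zero_add]
  set S0 : Ω → ℝ := ∑ k ∈ Finset.range m, Z k with hS0
  have hSL : MemLp S0 2 P := memLp_finsetSum' _ hZL
  have hDS : D = fun ω => (m : ℝ)⁻¹ * S0 ω := by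
    funext ω; simp [hD, hS0]
  have hDL : MemLp D 2 P := by rw [hDS]; exact hSL.const_mul _
  have hDE : ∫ ω, D ω ∂P = (m : ℝ)⁻¹ * ∑ k ∈ Finset.range m,
      inner ℝ (gradField S μφ xs (p k)) (b - a) := by
    simp only [hD]
    rw [integral_const_mul, integral_finsetSum _ fun k hk => (hZL k hk).integrable one_le_two]
    simp only [hZE]
  have hvar : variance D P ≤ cmpVar S μφ μξ xs m a b := by
    rw [hDS, variance_const_mul, hS0, IndepFun.variance_sum hZL fun i _ j _ hij =>
      (hw.indep.indepFun hij).comp (hYm i) (hYm j)]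
    have h1 : ∀ k ∈ Finset.range m, variance (Z k) P
        ≤ cA * ((1 - t k) * excess S μφ μξ xs a + t k * excess S μφ μξ xs b)
          + S.sig ^ 2 * q := fun k hk => by
      have h2 := variance_le_expectation_sq (μ := P) (X := Z k) (hZL k hk).aestronglyMeasurable
      simp only [Pi.pow_apply] at h2
      rw [hZ2] at h2
      have h3 := (convexOn_excess (μξ := μξ) hS hL xs).2 (Set.mem_univ a) (Set.mem_univ b)
        (by linarith [(ht01 k hk).2] : 0 ≤ 1 - t k) (ht01 k hk).1 (by ring)
      have e1 : (1 - t k) • a + t k • b = p k := by simp only [hp]; module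
      rw [e1] at h3
      simp only [smul_eq_mul] at h3
      have h4 := mul_le_mul_of_nonneg_left h3 hcA0
      linarith [(hYb k hk).2]
    have h5 := Finset.sum_le_sum h1
    have h6 : ∑ k ∈ Finset.range m, (cA * ((1 - t k) * excess S μφ μξ xs a
        + t k * excess S μφ μξ xs b) + S.sig ^ 2 * q)
        = m * (cA * ((excess S μφ μξ xs a + excess S μφ μξ xs b) / 2) + S.sig ^ 2 * q) := by
      have e2 : ∀ k ∈ Finset.range m, cA * ((1 - t k) * excess S μφ μξ xs a
          + t k * excess S μφ μξ xs b) + S.sig ^ 2 * q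
          = (cA * excess S μφ μξ xs a + S.sig ^ 2 * q)
            + t k * (cA * (excess S μφ μξ xs b - excess S μφ μξ xs a)) := fun k _ => by ring
      rw [Finset.sum_congr rfl e2, Finset.sum_add_distrib, ← Finset.sum_mul, sum_midpoints,
        Finset.sum_const, Finset.card_range, nsmul_eq_mul]
      ring
    rw [h6] at h5
    calc _ ≤ ((m : ℝ)⁻¹) ^ 2 * (m * (cA * ((excess S μφ μξ xs a + excess S μφ μξ xs b) / 2)
          + S.sig ^ 2 * q)) := by gcongr
      _ = cmpVar S μφ μξ xs m a b := by
        unfold cmpVar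
        rw [hcA, hq]
        field_simp
  have hvint : Integrable (fun ω => (D ω - ∫ ω', D ω' ∂P) ^ 2) P :=
    (hDL.sub (memLp_const _)).integrable_sq
  have hV0 := cmpVar_nonneg hS hL xs m a b
  have hcheb := measure_lt_le_of_integral_le (P := P) (fun ω => sq_nonneg (D ω - ∫ ω', D ω' ∂P))
    hvint (p := 1 / 4) (t := 4 * cmpVar S μφ μξ xs m a b) (by norm_num) (by linarith) (by
      rw [← variance_eq_integral hDL.aestronglyMeasurable.aemeasurable]
      linarith)
  refine (measureReal_mono fun ω hω => ?_).trans hcheb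
  simp only [Set.mem_ofPred_eq] at hω ⊢
  rw [hDd] at hω
  have hbias := midpoint_rule_error (μξ := μξ) hS hL xs a b hm
  rw [← hDE] at hbias
  unfold cmpErr at hω
  have h1 := abs_sub_le (D ω) (∫ ω', D ω' ∂P) (excess S μφ μξ xs b - excess S μφ μξ xs a)
  have h2 : 2 * Real.sqrt (cmpVar S μφ μξ xs m a b) < |D ω - ∫ ω', D ω' ∂P| := by linarith
  have h3 := pow_lt_pow_left₀ h2 (by positivity) two_ne_zero
  rw [mul_pow, Real.sq_sqrt hV0, sq_abs] at h3
  linarith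

end Comparison

/-! ### Reliable comparison of the approximate solutions -/

section Reliable

/-- This freezes the candidates, which are random but computed from the first sample, so that bounds
for fixed points apply to them. -/
theorem measureReal_le_of_indepFun {Ω A B : Type*} [MeasurableSpace Ω] [MeasurableSpace A]
    [MeasurableSpace B] {P : Measure Ω} [IsProbabilityMeasure P] {H : Ω → A} {W : Ω → B}
    (hH : Measurable H) (hW : Measurable W) (hind : IndepFun H W P) {X : Set A} (hHX : ∀ ω, H ω ∈ X)
    (hX : MeasurableSet X) {T : Set (A × B)} (hT : MeasurableSet T) {p : ℝ} (hp : 0 ≤ p)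
    (h : ∀ a ∈ X, P.real {ω | (a, W ω) ∈ T} ≤ p) : P.real {ω | (H ω, W ω) ∈ T} ≤ p := by
  have hPH : IsProbabilityMeasure (P.map H) := Measure.isProbabilityMeasure_map hH.aemeasurable
  have hPW : IsProbabilityMeasure (P.map W) := Measure.isProbabilityMeasure_map hW.aemeasurable
  refine ENNReal.toReal_le_of_le_ofReal hp ?_
  have h1 : P {ω | (H ω, W ω) ∈ T} = ((P.map H).prod (P.map W)) T := by
    rw [← map_prodMk_of_indepFun hH hW hind rfl, Measure.map_apply (hH.prodMk hW) hT]
    rfl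
  rw [h1, Measure.prod_apply hT]
  have h2 : ∀ᵐ a ∂(P.map H), (P.map W) (Prod.mk a ⁻¹' T) ≤ ENNReal.ofReal p := by
    have h3 : ∀ᵐ a ∂(P.map H), a ∈ X :=
      (ae_map_iff hH.aemeasurable hX).2 (Filter.Eventually.of_forall hHX)
    filter_upwards [h3] with a ha
    rw [Measure.map_apply hW (measurable_prodMk_left hT)]
    exact (ENNReal.le_ofReal_iff_toReal_le (measure_ne_top _ _) hp).2 (h a ha)
  calc _ ≤ ∫⁻ _, ENNReal.ofReal p ∂(P.map H) := lintegral_mono_ae h2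
    _ = _ := by simp

variable {n : ℕ} {S : Setup n} {μφ : Measure (E n)} {μξ : Measure ℝ} {xs : E n}

theorem diffEst_shift (m : ℕ) (w : ℕ → E n × ℝ) (a b : E n) (l : ℕ) :
    diffEst S m w a b l = diffEst S m (fun i => w (l * m + i)) a b 0 := by
  simp [diffEst]

theorem diffEst_congr {m l : ℕ} {w w' : ℕ → E n × ℝ} (a b : E n)
    (h : ∀ k < m, w (l * m + k) = w' (l * m + k)) :
    diffEst S m w a b l = diffEst S m w' a b l := by
  unfold diffEst
  congr 1
  exact Finset.sum_congr rfl fun k hk => by rw [h k (Finset.mem_range.1 hk)]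

theorem measurable_diffEst {Y : Type*} [MeasurableSpace Y] (hS : S.Valid) (m l : ℕ) {a b : Y → E n}
    (ha : Measurable a) (hb : Measurable b) {v : Y → ℕ → E n × ℝ}
    (hv : ∀ k, Measurable fun y => v y k) :
    Measurable fun y => diffEst S m (v y) (a y) (b y) l := by
  unfold diffEst
  refine measurable_const.mul (Finset.measurable_fun_sum _ fun k _ => ?_)
  have h1 : Measurable fun y =>
      a y + ((2 * (k + 1 : ℝ) - 1) / (2 * m)) • (b y - a y) := by fun_prop
  exact (measurable_stochGrad hS h1 (hv (l * m + k))).inner (hb.sub ha)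

theorem continuous_matNorm (Q : Matrix (Fin n) (Fin n) ℝ) : Continuous (matNorm Q) := by
  have h : Continuous fun x : E n => WithLp.ofLp x ⬝ᵥ Q.mulVec (WithLp.ofLp x) := by
    simp only [dotProduct, Matrix.mulVec]
    fun_prop
  exact Real.continuous_sqrt.comp h

theorem continuous_cmpErr (hS : S.Valid) (hL : LawAssumptions S μφ μξ) (xs : E n) (m : ℕ) :
    Continuous fun q : E n × E n => cmpErr S μφ μξ xs m q.1 q.2 := by
  have h1 := continuous_excess hS hL xs
  have h2 := continuous_matNorm (secondMoment μφ)
  unfold cmpErr cmpVar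
  fun_prop

variable {Ω : Type*} [MeasurableSpace Ω] {P : Measure Ω} [IsProbabilityMeasure P]

/-- For fixed points, the median of the estimates fails with exponentially small probability. -/
theorem failure_count_bound (hS : S.Valid) (hL : LawAssumptions S μφ μξ)
    (hF : FourthMomentCond S μφ xs) {w : ℕ → Ω → E n × ℝ} (hw : IsIIDSeq P w (obsLaw S μφ μξ xs))
    {m : ℕ} (hm : 0 < m) {a b : E n} (ha : a ∈ S.X) (hb : b ∈ S.X) (L' : ℕ) :
    P.real {ω | L' ≤ 2 * ((Finset.range L').filter (fun l => cmpErr S μφ μξ xs m a b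
      < |diffEst S m (fun i => w i ω) a b l
        - (excess S μφ μξ xs b - excess S μφ μξ xs a)|)).card} ≤ (7 / 8) ^ L' := by
  classical
  set B : Set (ℕ → E n × ℝ) := {v | cmpErr S μφ μξ xs m a b < |diffEst S m v a b 0
        - (excess S μφ μξ xs b - excess S μφ μξ xs a)|} with hB
  have hd : Measurable fun v : ℕ → E n × ℝ => diffEst S m v a b 0 :=
    measurable_diffEst hS m 0 measurable_const measurable_const fun k => measurable_pi_apply k
  have hBm : MeasurableSet B := by
    have h : Measurable fun v : ℕ → E n × ℝ => |diffEst S m v a b 0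
        - (excess S μφ μξ xs b - excess S μφ μξ xs a)| := (hd.sub_const _).abs
    exact measurableSet_lt measurable_const h
  -- With weight 2² for a failing block, the bound is ((1 + (1/4)·3)/2)^L' = (7/8)^L'.
  have h := hw.block_count_bound hBm (M := m) (fun v v' hv => by
      simp only [hB, Set.mem_ofPred_eq]
      rw [diffEst_congr (w' := v') a b fun k hk => hv _ (by omega)]) (p := 1 / 4) (fun l =>
      diffEst_tail_bound hS hL hF (hw.reindex (g := fun i => l * m + i)
        (add_right_injective _)) hm ha hb) (s := 2) (by norm_num) 2 L' L'
  have e : (1 + 1 / 4 * ((2 : ℝ) ^ 2 - 1)) ^ L' / 2 ^ L' = (7 / 8) ^ L' := by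
    rw [← div_pow]; norm_num
  rw [e] at h
  refine le_trans (le_of_eq ?_) h
  congr 1
  ext ω
  simp only [Set.mem_ofPred_eq, hB]
  have e2 : ∀ l, diffEst S m (fun i => w i ω) a b l
      = diffEst S m (fun i => w (l * m + i) ω) a b 0 := fun l => diffEst_shift m _ a b l
  simp only [e2]

/-- The medians comparing approximate solutions computed from earlier observations. -/
theorem median_error_bound (hn : 3 ≤ n) (hS : S.Valid) (hL : LawAssumptions S μφ μξ)
    (hsig : xs ∈ signals S μφ μξ) {sp : E n → E n} (hspm : Measurable sp)
    (hsp : ∀ x ∈ S.X, IsSparseApprox S.X S.s x (sp x)) {w : ℕ → Ω → E n × ℝ}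
    (hw : IsIIDSeq P w (obsLaw S μφ μξ xs)) {N L L' m i j : ℕ} (hi : i < L) (hj : j < L)
    (hm : 0 < m) :
    P.real {ω | cmpErr S μφ μξ xs m (candidate S sp N L (fun k => w k ω) j)
        (candidate S sp N L (fun k => w k ω) i)
      < |median L' (fun l => diffEst S m (fun k => w (N + k) ω)
            (candidate S sp N L (fun k => w k ω) j) (candidate S sp N L (fun k => w k ω) i) l)
        - (excess S μφ μξ xs (candidate S sp N L (fun k => w k ω) i)
          - excess S μφ μξ xs (candidate S sp N L (fun k => w k ω) j))|} ≤ (7 / 8) ^ L' := by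
  have hsm := hsig.2.2.2.1
  have hnu : 0 < S.nu := hS.kLow_pos.trans_le (hsm.kLow_le_nu (by omega) hS hL)
  set T : Set ((E n × E n) × (ℕ → E n × ℝ)) := {q | L' ≤ 2 * ((Finset.range L').filter
    (fun l => cmpErr S μφ μξ xs m q.1.1 q.1.2 < |diffEst S m q.2 q.1.1 q.1.2 l
        - (excess S μφ μξ xs q.1.2 - excess S μφ μξ xs q.1.1)|)).card} with hT
  have hTm : MeasurableSet T := by
    have h1 : Measurable fun q : (E n × E n) × (ℕ → E n × ℝ) =>
        cmpErr S μφ μξ xs m q.1.1 q.1.2 :=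
      (continuous_cmpErr hS hL xs m).measurable.comp measurable_fst
    have he := (continuous_excess hS hL xs).measurable
    have h2 : ∀ l, Measurable fun q : (E n × E n) × (ℕ → E n × ℝ) =>
        |diffEst S m q.2 q.1.1 q.1.2 l
          - (excess S μφ μξ xs q.1.2 - excess S μφ μξ xs q.1.1)| := fun l =>
      ((measurable_diffEst hS m l measurable_fst.fst measurable_fst.snd
        fun k => (measurable_pi_apply k).comp measurable_snd).sub ((he.comp measurable_fst.snd).sub
        (he.comp measurable_fst.fst))).abs
    have h3 : Measurable fun q : (E n × E n) × (ℕ → E n × ℝ) => ((Finset.range L').filter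
        (fun l => cmpErr S μφ μξ xs m q.1.1 q.1.2 < |diffEst S m q.2 q.1.1 q.1.2 l
        - (excess S μφ μξ xs q.1.2 - excess S μφ μξ xs q.1.1)|)).card := by
      simp only [Finset.card_filter]
      exact Finset.measurable_fun_sum _ fun l _ =>
        Measurable.ite (measurableSet_lt h1 (h2 l)) measurable_const measurable_const
    exact measurableSet_le measurable_const (measurable_const.mul h3)
  set F : (ℕ → E n × ℝ) → E n × E n :=
    fun v => (candidate S sp N L v j, candidate S sp N L v i) with hFd
  have hFm : Measurable F := (measurable_candidate hn hS hnu hspm N L j).prodMk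
    (measurable_candidate hn hS hnu hspm N L i)
  set F' : (ℕ → E n × ℝ) → ℕ → E n × ℝ :=
    fun v k => if k < L' * m then v (N + k) else default with hF'd
  have hF'm : Measurable F' := measurable_pi_lambda _ fun k => by
    by_cases hk : k < L' * m
    · simp only [hF'd, hk, if_true]; exact measurable_pi_apply _
    · simp only [hF'd, hk, if_false]; exact measurable_const
  have hind := hw.indepFun hFm hF'm (s := Finset.range N) (t := Finset.Ico N (N + L' * m))
    (by
      rw [Finset.disjoint_left]
      intro k hk hk'
      simp at hk hk'
      omega)
    (fun v v' hv => by
      simp only [hFd]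
      rw [candidate_congr sp hj fun k hk => hv k (by simpa using hk),
        candidate_congr sp hi fun k hk => hv k (by simpa using hk)])
    (fun v v' hv => by
      funext k
      simp only [hF'd]
      by_cases hk : k < L' * m
      · simp only [hk, if_true]
        exact hv _ (by simp [hk])
      · simp only [hk, if_false])
  have hwm : Measurable fun ω => fun k => w k ω := measurable_pi_lambda _ hw.meas
  have htrunc : ∀ (ω : Ω) (a b : E n), ∀ l ∈ Finset.range L',
      diffEst S m (F' fun k => w k ω) a b l = diffEst S m (fun k => w (N + k) ω) a b l := by
    intro ω a b l hl
    refine diffEst_congr a b fun k hk => ?_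
    have h1 : (l + 1) * m ≤ L' * m := Nat.mul_le_mul_right _ (Finset.mem_range.1 hl)
    have h2 : l * m + k < L' * m := by linarith
    simp [hF'd, h2]
  have hcount : ∀ (ω : Ω) (a b : E n), ((Finset.range L').filter
      (fun l => cmpErr S μφ μξ xs m a b < |diffEst S m (F' fun k => w k ω) a b l
        - (excess S μφ μξ xs b - excess S μφ μξ xs a)|)) = ((Finset.range L').filter
      (fun l => cmpErr S μφ μξ xs m a b < |diffEst S m (fun k => w (N + k) ω) a b l
        - (excess S μφ μξ xs b - excess S μφ μξ xs a)|)) := fun ω a b =>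
    Finset.filter_congr fun l hl => by rw [htrunc ω a b l hl]
  have hmain := measureReal_le_of_indepFun (P := P) (hFm.comp hwm) (hF'm.comp hwm) hind
    (X := S.X ×ˢ S.X) (fun ω => ⟨algOne_mem hn hS hnu hsp _ _, algOne_mem hn hS hnu hsp _ _⟩)
    (hS.X_closed.measurableSet.prod hS.X_closed.measurableSet) hTm
    (p := (7 / 8) ^ L') (by positivity) (by
      rintro ⟨a, b⟩ ⟨ha, hb⟩
      refine le_trans (le_of_eq ?_) (failure_count_bound hS hL hsig.2.2.2.2.2
        (hw.reindex (g := fun k => N + k) (add_right_injective N)) hm ha hb L')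
      congr 1
      ext ω
      simp only [Set.mem_ofPred_eq, hT, Function.comp_apply]
      rw [hcount])
  refine (measureReal_mono fun ω hω => ?_).trans hmain
  simp only [Set.mem_ofPred_eq, hT, Function.comp_apply] at hω ⊢
  rw [hcount]
  by_contra! hlt
  exact absurd (abs_median_sub_le hlt) (not_le.2 hω)

/-- With large probability few approximate solutions are bad, and all comparisons are accurate. -/
theorem aggregation_event_bound (hn : 3 ≤ n) (hS : S.Valid) (hL : LawAssumptions S μφ μξ)
    (hsig : xs ∈ signals S μφ μξ) {sp : E n → E n} (hspm : Measurable sp)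
    (hsp : ∀ x ∈ S.X, IsSparseApprox S.X S.s x (sp x)) {w : ℕ → Ω → E n × ℝ}
    (hw : IsIIDSeq P w (obsLaw S μφ μξ xs)) {N L : ℕ} (L' : ℕ) {m : ℕ} (hm : 0 < m)
    (hN : 8192 * stageUnit S ≤ ((N / L : ℕ) : ℝ)) :
    P.real {ω | ¬ (4 * ((Finset.range L).filter (fun l => tauSq S (1 / 2048) 2654208 (N / L)
          < excess S μφ μξ xs (candidate S sp N L (fun k => w k ω) l))).card < L ∧
        ∀ i < L, ∀ j < L, |median L' (fun l => diffEst S m (fun k => w (N + k) ω)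
            (candidate S sp N L (fun k => w k ω) j) (candidate S sp N L (fun k => w k ω) i) l)
          - (excess S μφ μξ xs (candidate S sp N L (fun k => w k ω) i)
            - excess S μφ μξ xs (candidate S sp N L (fun k => w k ω) j))|
          ≤ cmpErr S μφ μξ xs m (candidate S sp N L (fun k => w k ω) j)
            (candidate S sp N L (fun k => w k ω) i))}
      ≤ (2 / 3) ^ L + L ^ 2 * (7 / 8) ^ L' := by
  classical
  have hsm := hsig.2.2.2.1
  have hnu : 0 < S.nu := hS.kLow_pos.trans_le (hsm.kLow_le_nu (by omega) hS hL)
  set τ := tauSq S (1 / 2048) 2654208 (N / L) with hτ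
  set B : Set (ℕ → E n × ℝ) := {v | τ < excess S μφ μξ xs (algOne S sp (N / L) v)} with hB
  have hBm : MeasurableSet B := measurableSet_lt measurable_const
    ((continuous_excess hS hL xs).measurable.comp (measurable_algOne hn hS hnu hspm (N / L)))
  -- Weight 3⁴ = 81 matches the failure probability 1/81: a block contributes 1 + 80/81 < 2, and a
  -- quarter of bad blocks gives 3^L in the denominator.
  have h1 := hw.block_count_bound hBm (M := N / L) (fun v v' hv => by
      simp only [hB, Set.mem_ofPred_eq]
      rw [algOne_congr sp (N / L) hv]) (p := 1 / 81) (fun l =>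
      algOne_tail_bound hn hS hL hsig hspm hsp (hw.reindex (g := fun i => l * (N / L) + i)
        (add_right_injective _)) hN) (s := 3) (by norm_num) 4 L L
  have e1 : (1 + 1 / 81 * ((3 : ℝ) ^ 4 - 1)) ^ L / 3 ^ L ≤ (2 / 3) ^ L := by
    rw [← div_pow]
    exact pow_le_pow_left₀ (by norm_num) (by norm_num) L
  set A₁ : Set Ω := {ω | L ≤ 4 * ((Finset.range L).filter
    (fun l => (fun i => w (l * (N / L) + i) ω) ∈ B)).card} with hA₁
  set A₂ : ℕ × ℕ → Set Ω := fun q => {ω | cmpErr S μφ μξ xs m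
        (candidate S sp N L (fun k => w k ω) q.2) (candidate S sp N L (fun k => w k ω) q.1)
      < |median L' (fun l => diffEst S m (fun k => w (N + k) ω)
            (candidate S sp N L (fun k => w k ω) q.2) (candidate S sp N L (fun k => w k ω) q.1) l)
        - (excess S μφ μξ xs (candidate S sp N L (fun k => w k ω) q.1)
          - excess S μφ μξ xs (candidate S sp N L (fun k => w k ω) q.2))|} with hA₂
  have h2 : P.real (⋃ q ∈ Finset.range L ×ˢ Finset.range L, A₂ q) ≤ L ^ 2 * (7 / 8) ^ L' := by
    refine (measureReal_biUnion_finset_le _ _).trans ?_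
    calc _ ≤ ∑ _q ∈ Finset.range L ×ˢ Finset.range L, (7 / 8 : ℝ) ^ L' := by
          refine Finset.sum_le_sum fun q hq => ?_
          rw [Finset.mem_product, Finset.mem_range, Finset.mem_range] at hq
          exact median_error_bound hn hS hL hsig hspm hsp hw hq.1 hq.2 hm
      _ = _ := by
          rw [Finset.sum_const, Finset.card_product, Finset.card_range, nsmul_eq_mul]
          push_cast; ring
  have h3 : P.real (A₁ ∪ ⋃ q ∈ Finset.range L ×ˢ Finset.range L, A₂ q)
      ≤ (2 / 3) ^ L + L ^ 2 * (7 / 8) ^ L' :=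
    (measureReal_union_le _ _).trans (add_le_add (h1.trans e1) h2)
  refine (measureReal_mono fun ω hω => ?_).trans h3
  by_contra hnot
  rw [Set.mem_union, not_or] at hnot
  refine hω ⟨?_, fun i hi j hj => ?_⟩
  · have h4 := hnot.1
    simp only [hA₁, Set.mem_ofPred_eq, not_le, hB] at h4
    convert! h4 using 3
  · by_contra! hlt
    refine hnot.2 (Set.mem_biUnion (x := (i, j)) ?_ hlt)
    simp [hi, hj]

end Reliable

/-! ### Selection among the approximate solutions -/

section Selection

variable {n : ℕ} {S : Setup n} {μφ : Measure (E n)} {μξ : Measure ℝ} {xs : E n}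

/-- For L ≥ 8, fewer than L/4 bad points leave at least L/2 + 2 good ones. These lie within d of x_*
with d² = 2T/κ̲, and κ̲(4d)² = 32T. -/
theorem closestSet_of_few_bad (hS : S.Valid) (hL : LawAssumptions S μφ μξ) {L : ℕ} (hL8 : 8 ≤ L)
    {x : ℕ → E n} {T : ℝ} (hbad : 4 * ((Finset.range L).filter
      (fun l => T < excess S μφ μξ xs (x l))).card < L) {i₀ : ℕ} {I : Finset ℕ}
    (hc : IsCenter L x i₀) (hI : IsClosestSet L x i₀ I) :
    (∀ i ∈ I, ∀ j ∈ I, S.kLow * ‖x i - x j‖ ^ 2 ≤ 32 * T) ∧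
      ∃ j ∈ I, excess S μφ μξ xs (x j) ≤ T := by
  have hk := hS.kLow_pos
  set G := (Finset.range L).filter (fun l => ¬ T < excess S μφ μξ xs (x l)) with hG
  have hcount := Finset.card_filter_add_card_filter_not (s := Finset.range L)
    (fun l => T < excess S μφ μξ xs (x l))
  rw [Finset.card_range, ← hG] at hcount
  have hGT : ∀ l ∈ G, excess S μφ μξ xs (x l) ≤ T := fun l hl =>
    not_lt.1 (Finset.mem_filter.1 hl).2
  have hT0 : 0 ≤ T := by
    obtain ⟨l, hl⟩ := Finset.card_pos.1 (by omega : 0 < G.card)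
    exact (excess_nonneg hS hL xs _).trans (hGT l hl)
  have hGd : ∀ l ∈ G, ‖x l - xs‖ ≤ Real.sqrt (2 * T / S.kLow) := fun l hl => by
    refine Real.le_sqrt_of_sq_le ?_
    have h1 := norm_sq_le_excess hS hL xs (x l)
    have h2 := hGT l hl
    rw [le_div_iff₀ hk]
    linarith
  obtain ⟨h1, j, hjI, hjG⟩ := closestSet_geometry (G := G) (Finset.filter_subset _ _) hGd (by omega)
    hc hI
  refine ⟨fun i hi j hj => ?_, j, hjI, hGT j hjG⟩
  have h2 := pow_le_pow_left₀ (norm_nonneg _) (h1 i hi j hj) 2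
  rw [mul_pow, Real.sq_sqrt (by positivity)] at h2
  calc S.kLow * ‖x i - x j‖ ^ 2 ≤ S.kLow * (4 ^ 2 * (2 * T / S.kLow)) := by gcongr
    _ = 32 * T := by field_simp; ring

theorem matNorm_sub_sq_le (hS : S.Valid) (hL : LawAssumptions S μφ μξ) (xs a b : E n) :
    matNorm (secondMoment μφ) (b - a) ^ 2
      ≤ 4 * (excess S μφ μξ xs a + excess S μφ μξ xs b) / S.uLo := by
  have hul := hS.uLo_pos
  have h1 := (excess_bounds hS hL xs a).1
  have h2 := (excess_bounds hS hL xs b).1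
  have h3 : matNorm (secondMoment μφ) (b - a) ^ 2 ≤ 2 * matNorm (secondMoment μφ) (a - xs) ^ 2
      + 2 * matNorm (secondMoment μφ) (b - xs) ^ 2 := by
    rw [matNorm_sq_eq_integral hL, matNorm_sq_eq_integral hL, matNorm_sq_eq_integral hL,
      ← integral_const_mul, ← integral_const_mul,
      ← integral_add ((hL.memLp_inner (a - xs)).integrable_sq.const_mul 2)
        ((hL.memLp_inner (b - xs)).integrable_sq.const_mul 2)]
    refine integral_mono (hL.memLp_inner (b - a)).integrable_sq
      (((hL.memLp_inner (a - xs)).integrable_sq.const_mul 2).add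
        ((hL.memLp_inner (b - xs)).integrable_sq.const_mul 2)) fun f => ?_
    have e : inner ℝ f (b - a) = inner ℝ f (b - xs) - inner ℝ f (a - xs) := by
      rw [← inner_sub_right, sub_sub_sub_cancel_right]
    simp only [e]
    linarith [sq_nonneg (inner ℝ f (b - xs) + inner ℝ f (a - xs))]
  rw [le_div_iff₀ hul]
  have h4 := mul_le_mul_of_nonneg_right h3 hul.le
  linarith

/-- Since χ ≥ 1, the bias is measured by the same ratio χūσ₁/m as the variance. -/
theorem bias_le (hS : S.Valid) (hL : LawAssumptions S μφ μξ) (m : ℕ) (a b : E n) :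
    S.uHi * matNorm (secondMoment μφ) (b - a) ^ 2 / (8 * m)
      ≤ S.chi * (S.uHi * sigma1 (secondMoment μφ)) / m * ‖b - a‖ ^ 2 / 8 := by
  have h1 := matNorm_sq_le_sigma1 hL (b - a)
  have hu := hS.uHi_pos
  have hs := sigma1_nonneg (secondMoment μφ)
  have hc := hS.one_le_chi
  calc S.uHi * matNorm (secondMoment μφ) (b - a) ^ 2 / (8 * m)
      ≤ 1 * (S.uHi * (sigma1 (secondMoment μφ) * ‖b - a‖ ^ 2)) / (8 * m) := by
        rw [one_mul]; gcongr
    _ ≤ S.chi * (S.uHi * (sigma1 (secondMoment μφ) * ‖b - a‖ ^ 2)) / (8 * m) := by gcongr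
    _ = _ := by ring

/-- The accuracy of a comparison, up to a fraction of the values compared. -/
theorem cmpErr_le_quarter (hS : S.Valid) (hL : LawAssumptions S μφ μξ) {m : ℕ} {a b : E n}
    {T B : ℝ} (hTB : T ≤ B)
    (hΛ : S.chi * (S.uHi * sigma1 (secondMoment μφ)) / m ≤ S.kLow / 65536)
    (hσ : S.sig ^ 2 / (S.uLo * m) ≤ B) (hr : S.kLow * ‖b - a‖ ^ 2 ≤ 32 * T) :
    cmpErr S μφ μξ xs m a b ≤ (excess S μφ μξ xs a + excess S μφ μξ xs b) / 4 + 21 * B := by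
  have hea := excess_nonneg hS hL xs a
  have heb := excess_nonneg hS hL xs b
  have hul := hS.uLo_pos
  set s := excess S μφ μξ xs a + excess S μφ μξ xs b with hs
  have hs0 : 0 ≤ s := by linarith
  set Λ := S.chi * (S.uHi * sigma1 (secondMoment μφ)) / m with hΛd
  have hΛr : Λ * ‖b - a‖ ^ 2 ≤ B := by
    have := mul_le_mul_of_nonneg_right hΛ (sq_nonneg ‖b - a‖)
    have hk := hS.kLow_pos
    have h1 : 0 ≤ S.kLow * ‖b - a‖ ^ 2 := by positivity
    linarith
  have hB0 : 0 ≤ B := by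
    refine le_trans ?_ hσ
    positivity
  have hV : cmpVar S μφ μξ xs m a b ≤ s * (5 * B) := by
    have h1 := matNorm_sub_sq_le hS hL xs a b
    have e : cmpVar S μφ μξ xs m a b = Λ * ‖b - a‖ ^ 2 * (s / 2)
        + (S.sig ^ 2 / m) * matNorm (secondMoment μφ) (b - a) ^ 2 := by
      rw [cmpVar, hΛd, hs]; ring
    have h2 : (S.sig ^ 2 / m) * matNorm (secondMoment μφ) (b - a) ^ 2
        ≤ (S.sig ^ 2 / m) * (4 * s / S.uLo) := by gcongr
    have h3 : (S.sig ^ 2 / m) * (4 * s / S.uLo) = S.sig ^ 2 / (S.uLo * m) * (4 * s) := by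
      rw [div_mul_div_comm, div_mul_eq_mul_div, mul_comm (m : ℝ)]
    have h4 : S.sig ^ 2 / (S.uLo * m) * (4 * s) ≤ B * (4 * s) := by gcongr
    have h5 : Λ * ‖b - a‖ ^ 2 * (s / 2) ≤ B * (s / 2) := by gcongr
    have h6 : 0 ≤ B * s := by positivity
    rw [e]
    linarith
  -- The variance is at most 5Bs, and 2√(5Bs) ≤ s/4 + 20B is the arithmetic-geometric mean
  -- inequality; the bias fits in one more B.
  have h7 : 2 * Real.sqrt (cmpVar S μφ μξ xs m a b) ≤ s / 4 + 20 * B := by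
    have h8 : Real.sqrt (cmpVar S μφ μξ xs m a b) ≤ (s / 4 + 20 * B) / 2 := by
      rw [Real.sqrt_le_left (by positivity)]
      linarith [sq_nonneg (s / 4 - 20 * B)]
    linarith
  have h9 := bias_le hS hL m a b
  unfold cmpErr
  linarith

/-- The accuracy of a comparison in terms of the known parameters. -/
theorem cmpErr_le_explicit (hS : S.Valid) (hL : LawAssumptions S μφ μξ) (m : ℕ) (a b : E n) :
    cmpErr S μφ μξ xs m a b
      ≤ 2 * (‖b - a‖ * Real.sqrt (S.chi * (S.uHi * sigma1 (secondMoment μφ)) / m))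
          * Real.sqrt ((excess S μφ μξ xs a + excess S μφ μξ xs b) / 2)
        + 2 * (‖b - a‖ * S.sig * Real.sqrt (sigma1 (secondMoment μφ) / m))
        + (‖b - a‖ * Real.sqrt (S.chi * (S.uHi * sigma1 (secondMoment μφ)) / m)) ^ 2 / 8 := by
  have hea := excess_nonneg hS hL xs a
  have heb := excess_nonneg hS hL xs b
  have hu := hS.uHi_pos
  have hs1 := sigma1_nonneg (secondMoment μφ)
  have hc : 0 < S.chi := by linarith [hS.one_le_chi]
  have hsig := hS.sig_nonneg
  set Λ := S.chi * (S.uHi * sigma1 (secondMoment μφ)) / m with hΛd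
  have hΛ0 : 0 ≤ Λ := by positivity
  set s := excess S μφ μξ xs a + excess S μφ μξ xs b with hs
  set D := ‖b - a‖ * S.sig * Real.sqrt (sigma1 (secondMoment μφ) / m) with hD
  have hD0 : 0 ≤ D := by positivity
  set A := ‖b - a‖ * Real.sqrt Λ with hA
  have hA0 : 0 ≤ A := by positivity
  have hA2 : A ^ 2 = Λ * ‖b - a‖ ^ 2 := by rw [hA, mul_pow, Real.sq_sqrt hΛ0]; ring
  have hD2 : D ^ 2 = S.sig ^ 2 / m * (sigma1 (secondMoment μφ) * ‖b - a‖ ^ 2) := by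
    rw [hD, mul_pow, Real.sq_sqrt (by positivity)]; ring
  have hV : cmpVar S μφ μξ xs m a b ≤ (A * Real.sqrt (s / 2) + D) ^ 2 := by
    have h1 := matNorm_sq_le_sigma1 hL (b - a)
    have e : cmpVar S μφ μξ xs m a b = A ^ 2 * (s / 2)
        + (S.sig ^ 2 / m) * matNorm (secondMoment μφ) (b - a) ^ 2 := by
      rw [hA2, cmpVar, hΛd, hs]; ring
    have h2 : (S.sig ^ 2 / m) * matNorm (secondMoment μφ) (b - a) ^ 2 ≤ D ^ 2 := by
      rw [hD2]; gcongr
    have h3 : (A * Real.sqrt (s / 2) + D) ^ 2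
        = A ^ 2 * (s / 2) + D ^ 2 + 2 * (A * Real.sqrt (s / 2) * D) := by
      have := Real.sq_sqrt (by positivity : 0 ≤ s / 2)
      calc _ = A ^ 2 * Real.sqrt (s / 2) ^ 2 + D ^ 2 + 2 * (A * Real.sqrt (s / 2) * D) := by ring
        _ = _ := by rw [this]
    have h4 : 0 ≤ A * Real.sqrt (s / 2) * D := by positivity
    rw [e, h3]
    linarith
  have h5 : Real.sqrt (cmpVar S μφ μξ xs m a b) ≤ A * Real.sqrt (s / 2) + D :=
    (Real.sqrt_le_left (by positivity)).2 hV
  have h6 := bias_le hS hL m a b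
  unfold cmpErr
  rw [hA2]
  linarith

/-- Here q is the smallest excess in Î, p that of a competitor, A and D the multiplicative and
additive noise scales. The gap p - q pays for the error growing with √p: completing the square
leaves 2A√q + A², covered by τ ≥ √q and γ ≥ 4A. -/
theorem explicit_threshold_admissible {A D τ γ p q : ℝ} (hA : 0 ≤ A) (hγ : 4 * A ≤ γ) (hq : 0 ≤ q)
    (hqp : q ≤ p) (hqτ : q ≤ τ ^ 2) (hτ : 0 ≤ τ) :
    q - p + (2 * A * Real.sqrt ((p + q) / 2) + 2 * D + A ^ 2 / 8) ≤ 2 * A * (γ + τ) + 2 * D := by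
  have hp2 : Real.sqrt p ^ 2 = p := Real.sq_sqrt (hq.trans hqp)
  have hq2 : Real.sqrt q ^ 2 = q := Real.sq_sqrt hq
  have hqp' : Real.sqrt q ≤ Real.sqrt p := Real.sqrt_le_sqrt hqp
  have hqτ' : Real.sqrt q ≤ τ := (Real.sqrt_le_left hτ).2 hqτ
  have h4 : Real.sqrt ((p + q) / 2) ≤ Real.sqrt p := Real.sqrt_le_sqrt (by linarith)
  have h5 : 2 * A * Real.sqrt ((p + q) / 2) ≤ 2 * A * Real.sqrt p := by gcongr
  have h6 : 2 * A * Real.sqrt p - (Real.sqrt p ^ 2 - Real.sqrt q ^ 2)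
      ≤ 2 * A * Real.sqrt q + A ^ 2 := by
    linarith [sq_nonneg (Real.sqrt p - Real.sqrt q - A),
      mul_nonneg (Real.sqrt_nonneg q) (sub_nonneg.2 hqp')]
  have h7 : 2 * A * Real.sqrt q ≤ 2 * A * τ := by gcongr
  have h8 : 2 * A * (4 * A) ≤ 2 * A * γ := by gcongr
  rw [hp2, hq2] at h6
  linarith [sq_nonneg A]

/-- Now p is the excess of a good point and q that of a selected one. Since 8A ≤ √T and D ≤ 6B, all
terms are multiples of B except 2A√((p+q)/2) ≤ A² + (p+q)/2, half of whose q is absorbed on the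
left. -/
theorem explicit_threshold_excess {A D T B p q : ℝ} (hA : 0 ≤ A) (hA2 : 64 * A ^ 2 ≤ T)
    (hD2 : D ^ 2 ≤ B * (32 * B)) (hTB : T ≤ B) (hp : 0 ≤ p) (hpT : p ≤ T)
    (hq : 0 ≤ q) (h : q - p ≤ 2 * A * (Real.sqrt ((4 * A + Real.sqrt T) ^ 2 + 4 * D) + Real.sqrt T)
      + 2 * D + (2 * A * Real.sqrt ((p + q) / 2) + 2 * D + A ^ 2 / 8)) :
    q ≤ 104 * B := by
  have hT0 : 0 ≤ T := hp.trans hpT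
  have hB0 : 0 ≤ B := hT0.trans hTB
  have hD6 : D ≤ 6 * B := le_of_sq_le_sq (by nlinarith) (by positivity)
  have hτ0 := Real.sqrt_nonneg T
  have hAτ : 8 * A ≤ Real.sqrt T := Real.le_sqrt_of_sq_le (by linarith)
  have hϑ0 := Real.sqrt_nonneg B
  have hϑ2 : Real.sqrt B ^ 2 = B := Real.sq_sqrt hB0
  have hτϑ : Real.sqrt T ≤ Real.sqrt B := Real.sqrt_le_sqrt hTB
  have hγ6 : Real.sqrt ((4 * A + Real.sqrt T) ^ 2 + 4 * D) ≤ 6 * Real.sqrt B := by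
    refine (Real.sqrt_le_left (by positivity)).2 ?_
    have h4 : (4 * A + Real.sqrt T) ^ 2 ≤ (2 * Real.sqrt B) ^ 2 :=
      pow_le_pow_left₀ (by positivity) (by linarith) 2
    rw [mul_pow, hϑ2] at h4 ⊢
    linarith
  have h4 : 2 * A * (Real.sqrt ((4 * A + Real.sqrt T) ^ 2 + 4 * D) + Real.sqrt T)
      ≤ 2 * (Real.sqrt B / 8) * (7 * Real.sqrt B) :=
    mul_le_mul (by linarith) (by linarith) (by positivity) (by positivity)
  have h5 : 2 * (Real.sqrt B / 8) * (7 * Real.sqrt B) = 7 / 4 * Real.sqrt B ^ 2 := by ring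
  have h7 := Real.sq_sqrt (by positivity : 0 ≤ (p + q) / 2)
  rw [hϑ2] at h5
  linarith [sq_nonneg (A - Real.sqrt ((p + q) / 2))]

variable {x : ℕ → E n} {I : Finset ℕ} {m : ℕ} {T B : ℝ} {med : ℕ → ℕ → ℝ} {ρ : ℝ → ℝ}

/-- Selection with thresholds which dominate the accuracy of the comparisons. -/
theorem selection_of_threshold (hS : S.Valid) (hL : LawAssumptions S μφ μξ)
    (hr : ∀ i ∈ I, ∀ j ∈ I, S.kLow * ‖x i - x j‖ ^ 2 ≤ 32 * T)
    (hgood : ∃ j ∈ I, excess S μφ μξ xs (x j) ≤ T) (hTB : T ≤ B)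
    (hΛ : S.chi * (S.uHi * sigma1 (secondMoment μφ)) / m ≤ S.kLow / 65536)
    (hσ : S.sig ^ 2 / (S.uLo * m) ≤ B)
    (hmed : ∀ i ∈ I, ∀ j ∈ I, |med j i - (excess S μφ μξ xs (x i) - excess S μφ μξ xs (x j))|
      ≤ cmpErr S μφ μξ xs m (x j) (x i))
    (hρ : ∀ r, 0 ≤ r → 23 * B ≤ ρ r ∧ ρ r ≤ 23 * B + S.kLow * r ^ 2) :
    (∃ i ∈ I, ∀ j ∈ I, j ≠ i → med j i - ρ ‖x i - x j‖ ≤ 0) ∧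
    ∀ i ∈ I, (∀ j ∈ I, j ≠ i → med j i - ρ ‖x i - x j‖ ≤ 0) →
      excess S μφ μξ xs (x i) ≤ 104 * B := by
  obtain ⟨j₀, hj₀, hej₀⟩ := hgood
  have hB0 : 0 ≤ B := ((excess_nonneg hS hL xs _).trans hej₀).trans hTB
  have herr : ∀ i ∈ I, ∀ j ∈ I, |med j i - (excess S μφ μξ xs (x i) - excess S μφ μξ xs (x j))|
      ≤ (excess S μφ μξ xs (x j) + excess S μφ μξ xs (x i)) / 4 + 21 * B := fun i hi j hj =>
    (hmed i hi j hj).trans (cmpErr_le_quarter hS hL hTB hΛ hσ (hr i hi j hj))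
  constructor
  -- Any good point passes: its comparisons are at most (5/4)T + 21B, the competitor's excess
  -- entering with a negative coefficient.
  · refine ⟨j₀, hj₀, fun j hj _ => ?_⟩
    have h1 := (abs_le.1 (herr j₀ hj₀ j hj)).2
    have h2 := (hρ ‖x j₀ - x j‖ (norm_nonneg _)).1
    have h3 := excess_nonneg (μξ := μξ) hS hL xs (x j)
    linarith
  -- Comparison with the good point j₀ gives (3/4) e_i ≤ (5/4)T + (21 + 23)B + 32T, where 32T bounds
  -- the quadratic part of the threshold.
  · intro i hi hadm
    by_cases hij : j₀ = i
    · subst hij; linarith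
    · have h1 := (abs_le.1 (herr i hi j₀ hj₀)).1
      have h2 := hadm j₀ hj₀ hij
      have h3 := (hρ ‖x i - x j₀‖ (norm_nonneg _)).2
      have h4 := hr i hi j₀ hj₀
      linarith

/-- Selection with the explicit thresholds. -/
theorem selection_of_explicitRho (hS : S.Valid) (hL : LawAssumptions S μφ μξ)
    (hr : ∀ i ∈ I, ∀ j ∈ I, S.kLow * ‖x i - x j‖ ^ 2 ≤ 32 * T)
    (hgood : ∃ j ∈ I, excess S μφ μξ xs (x j) ≤ T) (hTB : T ≤ B)
    (hΛ : S.chi * (S.uHi * sigma1 (secondMoment μφ)) / m ≤ S.kLow / 65536)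
    (hσ : S.sig ^ 2 * sigma1 (secondMoment μφ) / (S.kLow * m) ≤ B)
    (hmed : ∀ i ∈ I, ∀ j ∈ I, |med j i - (excess S μφ μξ xs (x i) - excess S μφ μξ xs (x j))|
      ≤ cmpErr S μφ μξ xs m (x j) (x i))
    (hρ : ρ = explicitRho S (sigma1 (secondMoment μφ)) (Real.sqrt T) m) :
    (∃ i ∈ I, ∀ j ∈ I, j ≠ i → med j i - ρ ‖x i - x j‖ ≤ 0) ∧
    ∀ i ∈ I, (∀ j ∈ I, j ≠ i → med j i - ρ ‖x i - x j‖ ≤ 0) →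
      excess S μφ μξ xs (x i) ≤ 104 * B := by
  obtain ⟨j₀, hj₀, hej₀⟩ := hgood
  have hk := hS.kLow_pos
  have hu := hS.uHi_pos
  have hc : 0 < S.chi := by linarith [hS.one_le_chi]
  have hsig := hS.sig_nonneg
  set e : ℕ → ℝ := fun l => excess S μφ μξ xs (x l) with he
  have he0 : ∀ l, 0 ≤ e l := fun l => excess_nonneg hS hL xs (x l)
  have hT0 : 0 ≤ T := (he0 j₀).trans hej₀
  have hB0 : 0 ≤ B := hT0.trans hTB
  set σ₁ := sigma1 (secondMoment μφ) with hσ₁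
  have hs1 : 0 ≤ σ₁ := sigma1_nonneg _
  set Λ := S.chi * (S.uHi * σ₁) / m with hΛd
  have hΛ0 : 0 ≤ Λ := by positivity
  have hΛ' : S.uHi * σ₁ * S.chi / m = Λ := by rw [hΛd]; ring
  set τ := Real.sqrt T with hτ
  have hτ0 : 0 ≤ τ := Real.sqrt_nonneg _
  have hτ2 : τ ^ 2 = T := Real.sq_sqrt hT0
  set A : ℕ → ℕ → ℝ := fun i j => ‖x i - x j‖ * Real.sqrt Λ with hA
  set D : ℕ → ℕ → ℝ := fun i j => ‖x i - x j‖ * S.sig * Real.sqrt (σ₁ / m) with hD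
  set γ : ℕ → ℕ → ℝ := fun i j => Real.sqrt ((4 * A i j + τ) ^ 2 + 4 * D i j) with hγ
  have hA0 : ∀ i j, 0 ≤ A i j := fun i j => by positivity
  have hD0 : ∀ i j, 0 ≤ D i j := fun i j => by positivity
  have hγA : ∀ i j, 4 * A i j ≤ γ i j := fun i j => by
    refine Real.le_sqrt_of_sq_le ?_
    have h1 := hA0 i j
    have h2 := hD0 i j
    have h3 : (4 * A i j) ^ 2 ≤ (4 * A i j + τ) ^ 2 := by gcongr; linarith
    linarith
  have hρ' : ∀ i j, ρ ‖x i - x j‖ = 2 * A i j * (γ i j + τ) + 2 * D i j := fun i j => by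
    have h1 : gammaFun S σ₁ τ m ‖x i - x j‖ = γ i j := by
      simp only [gammaFun, hγ, hA, hD, ← hΛd]
      congr 1; ring
    rw [hρ, explicitRho, h1, hΛ']
    simp only [hA, hD]
    ring
  have herr : ∀ i ∈ I, ∀ j ∈ I, |med j i - (e i - e j)|
      ≤ 2 * A i j * Real.sqrt ((e j + e i) / 2) + 2 * D i j + A i j ^ 2 / 8 := fun i hi j hj =>
    (hmed i hi j hj).trans (cmpErr_le_explicit hS hL m (x j) (x i))
  constructor
  -- The explicit thresholds need the witness to have no larger excess than each competitor, so the
  -- minimizer over I is taken rather than an arbitrary good point.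
  · obtain ⟨i, hi, hmin⟩ := I.exists_min_image e ⟨j₀, hj₀⟩
    refine ⟨i, hi, fun j hj _ => ?_⟩
    have h1 := (abs_le.1 (herr i hi j hj)).2
    have h3 : e i ≤ τ ^ 2 := by rw [hτ2]; exact (hmin j₀ hj₀).trans hej₀
    have h2 := explicit_threshold_admissible (D := D i j) (hA0 i j) (hγA i j) (he0 i) (hmin j hj)
      h3 hτ0
    rw [hρ']
    linarith only [h1, h2]
  · intro i hi hadm
    by_cases hij : j₀ = i
    · subst hij
      exact hej₀.trans (by linarith only [hTB, hB0])
    have h1 := (abs_le.1 (herr i hi j₀ hj₀)).1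
    have h2 := hadm j₀ hj₀ hij
    rw [hρ'] at h2
    have h4 := hr i hi j₀ hj₀
    have hA2 : 64 * A i j₀ ^ 2 ≤ T := by
      have h5 := mul_le_mul_of_nonneg_right hΛ (sq_nonneg ‖x i - x j₀‖)
      have h6 : A i j₀ ^ 2 = Λ * ‖x i - x j₀‖ ^ 2 := by
        simp only [hA]; rw [mul_pow, Real.sq_sqrt hΛ0]; ring
      rw [h6]
      linarith only [h4, h5, hT0]
    have hD2 : D i j₀ ^ 2 ≤ B * (32 * B) := by
      have h5 : D i j₀ ^ 2 = (S.sig ^ 2 * σ₁ / (S.kLow * m)) * (S.kLow * ‖x i - x j₀‖ ^ 2) := by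
        simp only [hD]
        rw [mul_pow, Real.sq_sqrt (by positivity), mul_pow]
        field_simp
      rw [h5]
      exact mul_le_mul hσ (by linarith only [h4, hTB]) (by positivity) hB0
    exact explicit_threshold_excess (hA0 i j₀) hA2 hD2 hTB (he0 j₀) hej₀ (he0 i)
      (by linarith only [h1, h2])

/-- The output of the aggregation when the selection is reliable. -/
theorem IsAggregate.excess_le {sp : E n → E n} {N L L' : ℕ} {w : ℕ → E n × ℝ} {xbar : E n} {Q : ℝ}
    (hagg : IsAggregate S sp N L L' ρ w xbar)
    (hsel : ∀ i₀ I, IsCenter L (candidate S sp N L w) i₀ →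
      IsClosestSet L (candidate S sp N L w) i₀ I →
      (∃ i ∈ I, IsAdmissible S L' (N / L') ρ (fun k => w (N + k)) (candidate S sp N L w) I i) ∧
      ∀ i ∈ I, IsAdmissible S L' (N / L') ρ (fun k => w (N + k)) (candidate S sp N L w) I i →
        excess S μφ μξ xs (candidate S sp N L w i) ≤ Q) :
    excess S μφ μξ xs xbar ≤ Q := by
  obtain ⟨i₀, I, hc, hI, h⟩ := hagg
  obtain ⟨h1, h2⟩ := hsel i₀ I hc hI
  rcases h with ⟨i, hi, hadm, rfl⟩ | ⟨hno, -⟩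
  · exact h2 i hi hadm
  · exact absurd h1 hno

end Selection

/-! ### Sizes of the subsamples -/

section Sizes

theorem half_le_log_one_div {ε : ℝ} (hε : 0 < ε) (hε2 : ε ≤ 1 / 2) : 1 / 2 ≤ Real.log (1 / ε) := by
  have h1 := Real.log_two_gt_d9
  have h2 : (2 : ℝ) ≤ 1 / ε := by rw [le_div_iff₀ hε]; linarith
  have h3 := Real.log_le_log two_pos h2
  linarith

/-- The lower bound on y turns the rounding error 1 into 2y. -/
theorem ceil_mul_le {β y : ℝ} (hβ : 0 ≤ β) (hy : 1 / 2 ≤ y) : (⌈β * y⌉₊ : ℝ) ≤ (β + 2) * y := by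
  have := (Nat.ceil_lt_add_one (by positivity : 0 ≤ β * y)).le
  linarith

theorem half_div_le_natDiv {N L : ℕ} (hL : 0 < L) (h : L ≤ N) :
    (N : ℝ) / (2 * L) ≤ ((N / L : ℕ) : ℝ) := by
  have h1 := Nat.lt_mul_div_succ N hL
  have h2 : 1 ≤ N / L := Nat.div_pos h hL
  have h3 : N ≤ (N / L) * (2 * L) := by nlinarith
  have hL' : (0 : ℝ) < L := by exact_mod_cast hL
  rw [div_le_iff₀ (by positivity)]
  exact_mod_cast h3

/-- The length of each of `⌈β y⌉` subsamples of a sample of length `N`. -/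
theorem le_subsample_length {β y K : ℝ} (hβ : 0 < β) (hy : 1 / 2 ≤ y) {N L : ℕ}
    (hL : L = ⌈β * y⌉₊) (hN : (β + 2) * y ≤ N) (hK : 2 * (β + 2) * y * K ≤ N) :
    (N : ℝ) / (2 * (β + 2) * y) ≤ ((N / L : ℕ) : ℝ) ∧ K ≤ ((N / L : ℕ) : ℝ) := by
  have hLle : (L : ℝ) ≤ (β + 2) * y := by rw [hL]; exact ceil_mul_le hβ.le hy
  have hL0 : 0 < L := by rw [hL]; exact Nat.ceil_pos.2 (by positivity)
  have hL0' : (0 : ℝ) < L := by exact_mod_cast hL0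
  have h1 := half_div_le_natDiv hL0 (by exact_mod_cast hLle.trans hN : L ≤ N)
  have h2 : (N : ℝ) / (2 * (β + 2) * y) ≤ N / (2 * L) :=
    div_le_div_of_nonneg_left (Nat.cast_nonneg N) (by positivity) (by linarith)
  refine ⟨h2.trans h1, le_trans ?_ (h2.trans h1)⟩
  rw [le_div_iff₀ (by positivity)]
  linarith

theorem Theta_le (n : ℕ) : Theta n ≤ 4 * Real.log n := by
  have h1 : Real.exp 1 ^ 2 ≤ 2.7182818286 ^ 2 :=
    pow_le_pow_left₀ (Real.exp_pos 1).le Real.exp_one_lt_d9.le 2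
  have h2 : 1 / 2 * Real.exp 1 ^ 2 ≤ 4 := by norm_num at h1 ⊢; linarith
  exact mul_le_mul_of_nonneg_right h2 (Real.log_natCast_nonneg n)

/-- With y = ln(1/ε), each term is made at most e^(-2y) = ε² ≤ ε/2. For the first, L ≥ 20y and 2/3 ≤
e^(-1/3). For the second, L² ≤ e^(2(α+2)y) must be beaten by (7/8)^L' ≤ e^(-α'y/8), which is the
reason for α' ≥ 16α + 64. -/
theorem failure_prob_le {α α' ε : ℝ} (hα : 20 ≤ α) (hα' : 16 * α + 64 ≤ α') (hε : 0 < ε)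
    (hε2 : ε ≤ 1 / 2) {L L' : ℕ} (hL : L = ⌈α * Real.log (1 / ε)⌉₊)
    (hL' : L' = ⌈α' * Real.log (1 / ε)⌉₊) :
    (2 / 3 : ℝ) ^ L + L ^ 2 * (7 / 8) ^ L' ≤ ε := by
  have hy := half_le_log_one_div hε hε2
  set y := Real.log (1 / ε) with hyd
  have hexp : Real.exp (-y) = ε := by
    rw [hyd, one_div, Real.log_inv, neg_neg, Real.exp_log hε]
  have hsq : Real.exp (-(2 * y)) ≤ ε / 2 := by
    have : -(2 * y) = -y + -y := by ring
    rw [this, Real.exp_add, hexp]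
    nlinarith
  have hLge : α * y ≤ L := by rw [hL]; exact Nat.le_ceil _
  have hLle : (L : ℝ) ≤ (α + 2) * y := by rw [hL]; exact ceil_mul_le (by linarith) hy
  have hL'ge : α' * y ≤ L' := by rw [hL']; exact Nat.le_ceil _
  have h1 : (2 / 3 : ℝ) ^ L ≤ ε / 2 := by
    calc (2 / 3 : ℝ) ^ L ≤ Real.exp (-(1 / 3)) ^ L :=
          pow_le_pow_left₀ (by norm_num) (by linarith [Real.add_one_le_exp (-(1 / 3) : ℝ)]) L
      _ = Real.exp (-(L / 3)) := by rw [← Real.exp_nat_mul]; congr 1; ring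
      _ ≤ Real.exp (-(2 * y)) := Real.exp_le_exp.2 (by nlinarith)
      _ ≤ ε / 2 := hsq
  have h2 : (7 / 8 : ℝ) ^ L' ≤ Real.exp (-((2 * α + 8) * y)) := by
    calc (7 / 8 : ℝ) ^ L' ≤ Real.exp (-(1 / 8)) ^ L' :=
          pow_le_pow_left₀ (by norm_num) (by linarith [Real.add_one_le_exp (-(1 / 8) : ℝ)]) L'
      _ = Real.exp (-(L' / 8)) := by rw [← Real.exp_nat_mul]; congr 1; ring
      _ ≤ _ := Real.exp_le_exp.2 (by nlinarith)
  have h3 : (L : ℝ) ^ 2 ≤ Real.exp (2 * ((α + 2) * y)) := by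
    calc (L : ℝ) ^ 2 ≤ Real.exp ((α + 2) * y) ^ 2 := by
          refine pow_le_pow_left₀ (Nat.cast_nonneg L) (hLle.trans ?_) 2
          linarith [Real.add_one_le_exp ((α + 2) * y)]
      _ = _ := by rw [← Real.exp_nat_mul]; push_cast; rfl
  have h4 : (L : ℝ) ^ 2 * (7 / 8) ^ L' ≤ ε / 2 := by
    calc (L : ℝ) ^ 2 * (7 / 8) ^ L'
        ≤ Real.exp (2 * ((α + 2) * y)) * Real.exp (-((2 * α + 8) * y)) :=
          mul_le_mul h3 h2 (by positivity) (by positivity)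
      _ = Real.exp (-(4 * y)) := by rw [← Real.exp_add]; congr 1; ring
      _ ≤ Real.exp (-(2 * y)) := Real.exp_le_exp.2 (by linarith)
      _ ≤ ε / 2 := hsq
  linarith

end Sizes

/-! ### The risk of the aggregated estimate -/

section Risk

variable {n : ℕ} {S : Setup n} {μφ : Measure (E n)} {μξ : Measure ℝ} {xs : E n}

/-- At x = x_* the variance condition reads σ² E‖φ‖_∞² ≤ ϰ'νσ², and E‖φ‖_∞² ≥ Σ_ii ≥ κ_Σ. -/
theorem sig_sq_mul_kap_le (hn : 3 ≤ n) (hS : S.Valid) (hL : LawAssumptions S μφ μξ)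
    (hxs : xs ∈ S.X) (hV : VarianceCond S μφ μξ xs) :
    S.sig ^ 2 * S.kap ≤ S.vk' * S.nu * S.sig ^ 2 := by
  have h1 := (hV xs hxs).2
  have h0 : matNorm (secondMoment μφ) (0 : E n) = 0 := by simp [matNorm]
  rw [optValue_eq hS hL hxs, sub_self, sub_self, h0] at h1
  simp only [inner_zero_right, ne_eq, OfNat.ofNat_ne_zero, not_false_eq_true, zero_pow, mul_zero,
    integral_zero, Real.sqrt_zero, zero_add] at h1
  rw [mul_pow, Real.sq_sqrt (integral_nonneg fun f => sq_nonneg _)] at h1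
  have i : Fin n := ⟨0, by omega⟩
  have h2 := kap_mul_norm_sq_le hL (EuclideanSpace.single i (1 : ℝ))
  rw [PiLp.norm_single, norm_one, matNorm_sq_eq_integral hL] at h2
  have h3 : ∫ f : E n, (inner ℝ f (EuclideanSpace.single i (1 : ℝ))) ^ 2 ∂μφ
      ≤ ∫ f, linfNorm f ^ 2 ∂μφ := by
    refine integral_mono (hL.memLp_inner _).integrable_sq (integrable_linfNorm_sq hL) fun f => ?_
    have h4 := abs_coord_le_linfNorm f i
    simp only [EuclideanSpace.inner_single_right, one_mul, conj_trivial]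
    rw [← sq_abs]
    exact pow_le_pow_left₀ (abs_nonneg _) h4 2
  have h5 := mul_le_mul_of_nonneg_right (h2.trans h3) (sq_nonneg S.sig)
  unfold Setup.varStar at h1
  linarith

/-- The constant `c` of the rate of convergence. -/
def rateConst (α : ℝ) : ℝ := 1 / 2048 / (8 * (α + 2))

/-- The factor in the bound on the accuracy of the approximate solutions and of the comparisons. -/
def levelConst (α α' : ℝ) : ℝ := 8 * (α + 2) * 2654208 + 2 * (α' + 2)

/-- The factor in the lower bound on the sample size. -/
def sampleConst (α α' : ℝ) : ℝ := 2 ^ 17 * (α + 2) + 2 ^ 17 * (α' + 2)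

/-- The second term of the risk bound. -/
def noiseTerm (S : Setup n) (y : ℝ) (N : ℕ) : ℝ :=
  S.vk' * S.sig ^ 2 * S.nu * S.sBar * y * Real.log n / (S.kLow * N)

/-- What the sample size guarantees. -/
structure SampleSize (S : Setup n) (σ₁ α α' ε : ℝ) (N L L' : ℕ) : Prop where
  eight_le : 8 ≤ L
  m_pos : 0 < N / L'
  stage_le : 8192 * stageUnit S ≤ ((N / L : ℕ) : ℝ)
  cond_le : S.chi * (S.uHi * σ₁) / ((N / L' : ℕ) : ℝ) ≤ S.kLow / 65536
  M_ge : (N : ℝ) / (2 * (α + 2) * Real.log (1 / ε)) ≤ ((N / L : ℕ) : ℝ)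
  m_ge : (N : ℝ) / (2 * (α' + 2) * Real.log (1 / ε)) ≤ ((N / L' : ℕ) : ℝ)
  N_pos : 0 < N

theorem sampleSize_of_le (hn : 3 ≤ n) (hS : S.Valid) (hnuk : S.kLow ≤ S.nu) {σ₁ α α' ε : ℝ}
    (hα : 20 ≤ α) (hα' : 20 ≤ α') (hε : 0 < ε) (hε2 : ε ≤ 1 / 2) {N L L' : ℕ}
    (hL : L = ⌈α * Real.log (1 / ε)⌉₊) (hL' : L' = ⌈α' * Real.log (1 / ε)⌉₊)
    (hN : sampleConst α α' * max (S.vk * S.nu * S.sBar / (S.uLo * S.kap) * Real.log (1 / ε)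
      * Real.log n) (S.chi * (S.uHi * σ₁) / (S.uLo * S.kap) * Real.log (1 / ε)) ≤ N) :
    SampleSize S σ₁ α α' ε N L L' := by
  have hy := half_le_log_one_div hε hε2
  have hlog2 : 69 / 100 ≤ Real.log (1 / ε) := by
    have h1 := Real.log_two_gt_d9
    have h2 : (2 : ℝ) ≤ 1 / ε := by rw [le_div_iff₀ hε]; linarith
    have h3 := Real.log_le_log two_pos h2
    norm_num at h1
    linarith
  set y := Real.log (1 / ε) with hyd
  have hk := hS.kLow_pos
  have hlog := one_lt_log hn
  have hkd : S.uLo * S.kap = S.kLow := rfl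
  rw [hkd] at hN
  set a := S.vk * S.nu * S.sBar / S.kLow with ha
  have hy0 : 0 < y := by linarith
  have ha1 : 1 ≤ a := by
    have h1 : (1 : ℝ) ≤ S.sBar := by exact_mod_cast hS.one_le_sBar
    rw [ha, le_div_iff₀ hk, one_mul]
    calc S.kLow ≤ 1 * S.nu * 1 := by linarith
      _ ≤ S.vk * S.nu * S.sBar := by
        have := hS.one_le_vk
        have : 0 ≤ S.nu := by linarith
        gcongr
  set b := S.chi * (S.uHi * σ₁) / S.kLow with hb
  have hc0 : 0 < sampleConst α α' := by unfold sampleConst; nlinarith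
  have hN1 : sampleConst α α' * (a * y * Real.log n) ≤ N :=
    (mul_le_mul_of_nonneg_left (le_max_left _ _) hc0.le).trans hN
  have hN2 : sampleConst α α' * (b * y) ≤ N :=
    (mul_le_mul_of_nonneg_left (le_max_right _ _) hc0.le).trans hN
  have hal : 1 ≤ a * Real.log n := by nlinarith
  have hN3 : sampleConst α α' * y ≤ N := by
    refine le_trans ?_ hN1
    have h1 : y * 1 ≤ y * (a * Real.log n) := by gcongr
    calc sampleConst α α' * y = sampleConst α α' * (y * 1) := by ring
      _ ≤ sampleConst α α' * (y * (a * Real.log n)) := by gcongr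
      _ = _ := by ring
  have hαy : 0 < (α + 2) * y := by positivity
  have hαy' : 0 < (α' + 2) * y := by positivity
  have hle : 2 ^ 17 * (α + 2) ≤ sampleConst α α' := by unfold sampleConst; linarith
  have hle' : 2 ^ 17 * (α' + 2) ≤ sampleConst α α' := by unfold sampleConst; linarith
  have hA : 2 ^ 17 * ((α + 2) * y) ≤ N := by
    have := mul_le_mul_of_nonneg_right hle hy0.le
    linarith
  have hA' : 2 ^ 17 * ((α' + 2) * y) ≤ N := by
    have := mul_le_mul_of_nonneg_right hle' hy0.le
    linarith
  have hM := le_subsample_length (K := 2 ^ 16 * (a * Real.log n)) (by linarith : 0 < α) hy hL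
    (by linarith) (by
      have := mul_le_mul_of_nonneg_right hle (by positivity : 0 ≤ a * y * Real.log n)
      linarith)
  have hm1 := le_subsample_length (N := N) (K := 2 ^ 16) (by linarith : 0 < α') hy hL'
    (by linarith) (by linarith)
  have hm0 : (0 : ℝ) < ((N / L' : ℕ) : ℝ) := lt_of_lt_of_le (by norm_num) hm1.2
  refine ⟨?_, by exact_mod_cast hm0, ?_, ?_, hM.1, hm1.1, ?_⟩
  · have h1 : α * y ≤ L := by rw [hL]; exact Nat.le_ceil _
    have h2 : (8 : ℝ) ≤ L := by nlinarith
    exact_mod_cast h2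
  · refine le_trans ?_ hM.2
    have e : stageUnit S = Theta n * a := by rw [stageUnit, ha]; ring
    rw [e]
    have h1 := mul_le_mul_of_nonneg_right (Theta_le n) (by linarith : 0 ≤ a)
    have h2 : 0 ≤ a * Real.log n := by linarith
    linarith
  -- The parameter σ₁ is an arbitrary real here, so b may be nonpositive; the claim is then trivial.
  · rcases le_or_gt b 0 with hb0 | hb0
    · have : S.chi * (S.uHi * σ₁) ≤ 0 := by
        by_contra! h
        exact absurd hb0 (not_le.2 (by rw [hb]; positivity))
      exact (div_nonpos_of_nonpos_of_nonneg this hm0.le).trans (by positivity)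
    · have hm2 := (le_subsample_length (N := N) (K := 2 ^ 16 * b) (by linarith : 0 < α') hy hL'
        (by linarith) (by
          have := mul_le_mul_of_nonneg_right hle' (by positivity : 0 ≤ b * y)
          linarith)).2
      have e : S.chi * (S.uHi * σ₁) = b * S.kLow := by rw [hb]; field_simp
      rw [e, div_le_iff₀ hm0]
      have := mul_le_mul_of_nonneg_right hm2 hk.le
      linarith
  · have h1 : (0 : ℝ) < N := by linarith
    exact_mod_cast h1

theorem noiseTerm_nonneg (hS : S.Valid) (hnu : 0 < S.nu) {y : ℝ} (hy : 0 ≤ y) (N : ℕ) :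
    0 ≤ noiseTerm S y N := by
  have hk := hS.kLow_pos
  have hv : 0 < S.vk' := by linarith [hS.one_le_vk']
  have hlog := Real.log_natCast_nonneg n
  unfold noiseTerm
  positivity

variable {σ₁ α α' ε : ℝ} {N L L' : ℕ}

theorem noiseTerm_le_riskBound (hS : S.Valid) (c : ℝ) (ε : ℝ) (N : ℕ) :
    noiseTerm S (Real.log (1 / ε)) N ≤ riskBound S c ε N := by
  have hk := hS.kLow_pos
  unfold noiseTerm riskBound
  have : 0 ≤ S.kLow * S.R ^ 2 / S.sBar * Real.exp (-(c * N * S.kLow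
      / (S.vk * S.sBar * S.nu * Real.log (1 / ε) * Real.log n))) := by positivity
  linarith

/-- Subsamples of length at least N/(2(α+2) ln(1/ε)) and Θ ≤ 4 ln n together cost the factor 8(α+2),
which divides the exponential rate and multiplies the noise term. -/
theorem tauSq_le (hn : 3 ≤ n) (hS : S.Valid) (hnu : 0 < S.nu) (hα : 20 ≤ α)
    (hε : 0 < ε) (hε2 : ε ≤ 1 / 2) (h : SampleSize S σ₁ α α' ε N L L') :
    tauSq S (1 / 2048) 2654208 (N / L)
      ≤ 8 * (α + 2) * 2654208 * riskBound S (rateConst α) ε N := by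
  have hy := half_le_log_one_div hε hε2
  have hM := h.M_ge
  have hNp : (0 : ℝ) < N := by exact_mod_cast h.N_pos
  have hk := hS.kLow_pos
  have hlog := one_lt_log hn
  have hΘ := Theta_le n
  have hΘ0 := Theta_pos hn
  have hv : 0 < S.vk := by linarith [hS.one_le_vk]
  have hv' : 0 < S.vk' := by linarith [hS.one_le_vk']
  have hsB : (0 : ℝ) < S.sBar := by exact_mod_cast hS.one_le_sBar
  have hnoise := noiseTerm_nonneg hS hnu (by linarith : 0 ≤ Real.log (1 / ε)) N
  unfold tauSq riskBound
  rw [← noiseTerm]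
  set y := Real.log (1 / ε) with hyd
  set l := Real.log n with hl
  set M : ℝ := ((N / L : ℕ) : ℝ) with hMd
  have hy0 : 0 < y := by linarith
  have hl0 : 0 < l := by linarith
  have hα0 : 0 < α + 2 := by linarith
  have hM0 : 0 < M := lt_of_lt_of_le (by positivity) hM
  have hMN : (N : ℝ) ≤ M * (2 * (α + 2) * y) := (div_le_iff₀ (by positivity)).1 hM
  have h1 : rateConst α * N * S.kLow / (S.vk * S.sBar * S.nu * y * l)
      ≤ 1 / 2048 * M * S.kLow / (Theta n * S.vk * S.sBar * S.nu) := by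
    unfold rateConst
    rw [div_le_div_iff₀ (by positivity) (by positivity)]
    have h2 : (N : ℝ) * Theta n ≤ M * (2 * (α + 2) * y) * (4 * l) :=
      mul_le_mul hMN hΘ hΘ0.le (by positivity)
    have h3 : 0 ≤ 1 / 2048 / (8 * (α + 2)) * S.kLow * (S.vk * S.sBar * S.nu) := by positivity
    calc 1 / 2048 / (8 * (α + 2)) * N * S.kLow * (Theta n * S.vk * S.sBar * S.nu)
        = 1 / 2048 / (8 * (α + 2)) * S.kLow * (S.vk * S.sBar * S.nu) * (N * Theta n) := by ring
      _ ≤ 1 / 2048 / (8 * (α + 2)) * S.kLow * (S.vk * S.sBar * S.nu)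
          * (M * (2 * (α + 2) * y) * (4 * l)) := by gcongr
      _ = _ := by field_simp; ring
  have h4 : S.kLow * S.R ^ 2 / S.sBar * Real.exp (-(1 / 2048 * M * S.kLow
        / (Theta n * S.vk * S.sBar * S.nu)))
      ≤ S.kLow * S.R ^ 2 / S.sBar * Real.exp (-(rateConst α * N * S.kLow
        / (S.vk * S.sBar * S.nu * y * l))) := by
    have : 0 ≤ S.kLow * S.R ^ 2 / S.sBar := by positivity
    exact mul_le_mul_of_nonneg_left (Real.exp_le_exp.2 (neg_le_neg h1)) this
  have h5 : 2654208 * (S.varStar * S.sBar * S.vk' * Theta n / (S.kLow * M))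
      ≤ 8 * (α + 2) * 2654208 * noiseTerm S y N := by
    unfold noiseTerm Setup.varStar
    have h6 : Theta n / M ≤ 8 * (α + 2) * (y * l) / N := by
      rw [div_le_div_iff₀ hM0 hNp]
      have h2 : Theta n * N ≤ (4 * l) * (M * (2 * (α + 2) * y)) :=
        mul_le_mul hΘ hMN hNp.le (by positivity)
      linarith
    have h7 : 0 ≤ 2654208 * (S.nu * S.sig ^ 2 * S.sBar * S.vk' / S.kLow) := by positivity
    calc _ = 2654208 * (S.nu * S.sig ^ 2 * S.sBar * S.vk' / S.kLow) * (Theta n / M) := by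
          field_simp
      _ ≤ 2654208 * (S.nu * S.sig ^ 2 * S.sBar * S.vk' / S.kLow)
          * (8 * (α + 2) * (y * l) / N) := by gcongr
      _ = _ := by rw [hl]; field_simp
  have h8 : 0 ≤ S.kLow * S.R ^ 2 / S.sBar * Real.exp (-(rateConst α * N * S.kLow
      / (S.vk * S.sBar * S.nu * y * l))) := by positivity
  have h9 : 1 ≤ 8 * (α + 2) * 2654208 := by linarith
  have h10 := mul_le_mul_of_nonneg_right h9 h8
  linarith

theorem noise_over_m_le (hS : S.Valid) (hnu : 0 < S.nu) (hα' : 20 ≤ α') (hε : 0 < ε)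
    (hε2 : ε ≤ 1 / 2) (h : SampleSize S σ₁ α α' ε N L L') {q : ℝ} (hq0 : 0 ≤ q)
    (hq : q ≤ S.vk' * S.sig ^ 2 * S.nu * S.sBar * Real.log n) :
    q / (S.kLow * ((N / L' : ℕ) : ℝ)) ≤ 2 * (α' + 2) * noiseTerm S (Real.log (1 / ε)) N := by
  have hy := half_le_log_one_div hε hε2
  have hm := h.m_ge
  have hNp : (0 : ℝ) < N := by exact_mod_cast h.N_pos
  have hmp : (0 : ℝ) < ((N / L' : ℕ) : ℝ) := by exact_mod_cast h.m_pos
  have hk := hS.kLow_pos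
  unfold noiseTerm
  set y := Real.log (1 / ε) with hyd
  set m : ℝ := ((N / L' : ℕ) : ℝ)
  have hy0 : 0 < y := by linarith
  have hmN : (N : ℝ) ≤ m * (2 * (α' + 2) * y) := (div_le_iff₀ (by positivity)).1 hm
  have h1 : 1 / m ≤ 2 * (α' + 2) * y / N := by
    rw [div_le_div_iff₀ hmp hNp]; linarith
  have h2 := hq0.trans hq
  calc q / (S.kLow * m) = q / S.kLow * (1 / m) := by field_simp
    _ ≤ (S.vk' * S.sig ^ 2 * S.nu * S.sBar * Real.log n) / S.kLow * (2 * (α' + 2) * y / N) := by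
        gcongr
    _ = _ := by field_simp

variable {Ω : Type*} [MeasurableSpace Ω] {P : Measure Ω} [IsProbabilityMeasure P]
  {φ : ℕ → Ω → E n} {ξ : ℕ → Ω → ℝ}

/-- The risk is an infimum over levels with a non-strict event, while the tail bound is for a strict
one; every level above Q is admitted, and the infimum does the rest. -/
theorem predictionRisk_le (hS : S.Valid) (hL : LawAssumptions S μφ μξ)
    {est : (ℕ → E n × ℝ) → E n} {Q : ℝ} (hε : 0 ≤ ε)
    (h : ∀ xs ∈ signals S μφ μξ,
      P.real {ω | Q < excess S μφ μξ xs (est (observations S φ ξ xs ω))} ≤ ε) :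
    predictionRisk S P φ ξ μφ μξ est ε ≤ ENNReal.ofReal Q := by
  refine le_of_forall_gt fun r hr => ?_
  obtain ⟨r', h1, h2⟩ := exists_between hr
  refine lt_of_le_of_lt (sInf_le ?_) h2
  rw [Set.mem_ofPred_eq]
  refine iSup₂_le fun xs hxs => ?_
  have h3 := (ENNReal.le_ofReal_iff_toReal_le (measure_ne_top P _) hε).2 (h xs hxs)
  refine (measure_mono fun ω hω => ?_).trans h3
  simp only [Set.mem_ofPred_eq] at hω ⊢
  by_contra! hle
  rw [optValue_eq hS hL hxs.1] at hω
  exact absurd (hω.trans (ENNReal.ofReal_le_ofReal hle)) (not_le.2 h1)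

/-- The risk of the aggregated estimate under a reliable selection rule. -/
theorem predictionRisk_aggregate_le (hn : 3 ≤ n) (hS : S.Valid) (hL : LawAssumptions S μφ μξ)
    (hiid : IsIIDSample P φ ξ μφ μξ) {sp : E n → E n} (hspm : Measurable sp)
    (hsp : ∀ x ∈ S.X, IsSparseApprox S.X S.s x (sp x)) (hα : 20 ≤ α) (hα' : 16 * α + 64 ≤ α')
    (hε : 0 < ε) (hε2 : ε ≤ 1 / 2)
    (hLd : L = ⌈α * Real.log (1 / ε)⌉₊) (hL'd : L' = ⌈α' * Real.log (1 / ε)⌉₊)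
    (hsize : S.kLow ≤ S.nu → SampleSize S σ₁ α α' ε N L L') {ρ : ℝ → ℝ} {Q : ℝ}
    (hsel : ∀ xs ∈ signals S μφ μξ, ∀ (x : ℕ → E n) (I : Finset ℕ) (med : ℕ → ℕ → ℝ),
      (∀ i ∈ I, ∀ j ∈ I, S.kLow * ‖x i - x j‖ ^ 2 ≤ 32 * tauSq S (1 / 2048) 2654208 (N / L)) →
      (∃ j ∈ I, excess S μφ μξ xs (x j) ≤ tauSq S (1 / 2048) 2654208 (N / L)) →
      (∀ i ∈ I, ∀ j ∈ I, |med j i - (excess S μφ μξ xs (x i) - excess S μφ μξ xs (x j))|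
        ≤ cmpErr S μφ μξ xs (N / L') (x j) (x i)) →
      (∃ i ∈ I, ∀ j ∈ I, j ≠ i → med j i - ρ ‖x i - x j‖ ≤ 0) ∧
      ∀ i ∈ I, (∀ j ∈ I, j ≠ i → med j i - ρ ‖x i - x j‖ ≤ 0) →
        excess S μφ μξ xs (x i) ≤ Q)
    {est : (ℕ → E n × ℝ) → E n} (hest : ∀ w, IsAggregate S sp N L L' ρ w (est w)) :
    predictionRisk S P φ ξ μφ μξ est ε ≤ ENNReal.ofReal Q := by
  refine predictionRisk_le hS hL hε.le fun xs hxs => ?_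
  -- The inequality κ̲ ≤ ν comes from the existence of a signal; if there is none, there is nothing
  -- to prove.
  have hz := hsize (hxs.2.2.2.1.kLow_le_nu (by omega) hS hL)
  refine le_trans ?_ ((aggregation_event_bound hn hS hL hxs hspm hsp (hiid.isIIDSeq hS xs) L'
    hz.m_pos hz.stage_le).trans (failure_prob_le hα hα' hε hε2 hLd hL'd))
  -- Only an inclusion of events is used, so the estimator, with its arbitrary choices among ties,
  -- need not be measurable.
  refine measureReal_mono fun ω hω hgood => ?_
  refine absurd hω (not_lt.2 ((hest _).excess_le fun i₀ I hc hI => ?_))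
  obtain ⟨hg1, hg2⟩ := closestSet_of_few_bad hS hL hz.eight_le hgood.1 hc hI
  exact hsel xs hxs _ I _ hg1 hg2 fun i hi j hj =>
    hgood.2 i (Finset.mem_range.1 (hI.1 hi)) j (Finset.mem_range.1 (hI.1 hj))

/-- A threshold built from the target accuracy. -/
def levelRho (α α' : ℝ) (n : ℕ) (S : Setup n) (N : ℕ) (ε r : ℝ) : ℝ :=
  |23 * (levelConst α α' * riskBound S (rateConst α) ε N)|
    + (if 0 < S.kLow then S.kLow else 1) * r ^ 2

/-- Positivity is demanded for every setup, valid or not; the absolute value and the conditional in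
the threshold serve this alone. -/
theorem levelRho_pos (α α' : ℝ) (n : ℕ) (S : Setup n) (N : ℕ) (ε : ℝ) {r : ℝ} (hr : 0 < r) :
    0 < levelRho α α' n S N ε r := by
  unfold levelRho
  split_ifs <;> positivity

theorem tauSq_le_level (hn : 3 ≤ n) (hS : S.Valid) (hnu : 0 < S.nu) (hα : 20 ≤ α) (hα' : 20 ≤ α')
    (hε : 0 < ε) (hε2 : ε ≤ 1 / 2) (h : SampleSize S σ₁ α α' ε N L L') :
    tauSq S (1 / 2048) 2654208 (N / L) ≤ levelConst α α' * riskBound S (rateConst α) ε N := by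
  have hy := half_le_log_one_div hε hε2
  have h1 := tauSq_le hn hS hnu hα hε hε2 h
  have h2 := (noiseTerm_nonneg hS hnu (by linarith : 0 ≤ Real.log (1 / ε)) N).trans
    (noiseTerm_le_riskBound hS (rateConst α) ε N)
  have h3 : 0 ≤ 2 * (α' + 2) * riskBound S (rateConst α) ε N := by positivity
  unfold levelConst
  linarith

theorem noise_over_m_le_level (hS : S.Valid) (hnu : 0 < S.nu) (hα : 20 ≤ α)
    (hα' : 20 ≤ α') (hε : 0 < ε) (hε2 : ε ≤ 1 / 2) (h : SampleSize S σ₁ α α' ε N L L') {q : ℝ}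
    (hq0 : 0 ≤ q) (hq : q ≤ S.vk' * S.sig ^ 2 * S.nu * S.sBar * Real.log n) :
    q / (S.kLow * ((N / L' : ℕ) : ℝ)) ≤ levelConst α α' * riskBound S (rateConst α) ε N := by
  have hy := half_le_log_one_div hε hε2
  have h1 := noise_over_m_le hS hnu hα' hε hε2 h hq0 hq
  have h2 := noiseTerm_nonneg hS hnu (by linarith : 0 ≤ Real.log (1 / ε)) N
  have h3 := noiseTerm_le_riskBound hS (rateConst α) ε N
  have h4 : 2 * (α' + 2) * noiseTerm S (Real.log (1 / ε)) N
      ≤ 2 * (α' + 2) * riskBound S (rateConst α) ε N := by gcongr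
  have h5 : 0 ≤ 8 * (α + 2) * 2654208 * riskBound S (rateConst α) ε N := by
    have := h2.trans h3
    positivity
  unfold levelConst
  linarith

/-- The noise of the comparisons is kept in the Σ-norm, so only σ²/(u̲m) has to be below the level.
`sig_sq_mul_kap_le` provides this without any bound on σ₁. -/
theorem predictionRisk_levelRho_le (hn : 3 ≤ n) (hS : S.Valid) (hL : LawAssumptions S μφ μξ)
    (hiid : IsIIDSample P φ ξ μφ μξ) {sp : E n → E n} (hspm : Measurable sp)
    (hsp : ∀ x ∈ S.X, IsSparseApprox S.X S.s x (sp x)) (hα : 20 ≤ α) (hα' : 16 * α + 64 ≤ α')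
    (hε : 0 < ε) (hε2 : ε ≤ 1 / 2)
    (hLd : L = ⌈α * Real.log (1 / ε)⌉₊) (hL'd : L' = ⌈α' * Real.log (1 / ε)⌉₊)
    (hsize : S.kLow ≤ S.nu → SampleSize S (sigma1 (secondMoment μφ)) α α' ε N L L')
    {est : (ℕ → E n × ℝ) → E n}
    (hest : ∀ w, IsAggregate S sp N L L' (levelRho α α' n S N ε) w (est w)) :
    predictionRisk S P φ ξ μφ μξ est ε
      ≤ ENNReal.ofReal (104 * levelConst α α' * riskBound S (rateConst α) ε N) := by
  refine predictionRisk_aggregate_le hn hS hL hiid hspm hsp hα hα' hε hε2 hLd hL'd hsize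
    (fun xs hxs x I med hr hgood hmed => ?_) hest
  have hk := hS.kLow_pos
  have hnuk := hxs.2.2.2.1.kLow_le_nu (by omega) hS hL
  have hnu : 0 < S.nu := hk.trans_le hnuk
  have hz := hsize hnuk
  have hσ : S.sig ^ 2 / (S.uLo * ((N / L' : ℕ) : ℝ))
      ≤ levelConst α α' * riskBound S (rateConst α) ε N := by
    have h1 := sig_sq_mul_kap_le hn hS hL hxs.1 hxs.2.2.2.2.1
    have hlog := one_lt_log hn
    have hsB : (1 : ℝ) ≤ S.sBar := by exact_mod_cast hS.one_le_sBar
    have hv : 0 < S.vk' := by linarith [hS.one_le_vk']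
    have h2 : S.sig ^ 2 * S.kap ≤ S.vk' * S.sig ^ 2 * S.nu * S.sBar * Real.log n := by
      calc S.sig ^ 2 * S.kap ≤ S.vk' * S.sig ^ 2 * S.nu * 1 * 1 := by linarith
        _ ≤ _ := by gcongr
    have hkap := hS.kap_pos
    have h3 := noise_over_m_le_level hS hnu hα (by linarith) hε hε2 hz (by positivity) h2
    refine le_trans (le_of_eq ?_) h3
    have hul := hS.uLo_pos
    have hm : (0 : ℝ) < ((N / L' : ℕ) : ℝ) := by exact_mod_cast hz.m_pos
    unfold Setup.kLow
    field_simp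
  have hT := tauSq_le_level hn hS hnu hα (by linarith) hε hε2 hz
  have hB0 : 0 ≤ levelConst α α' * riskBound S (rateConst α) ε N :=
    le_trans (by have := hS.uLo_pos; positivity) hσ
  rw [mul_assoc]
  refine selection_of_threshold hS hL hr hgood hT hz.cond_le hσ hmed fun r _ => ?_
  unfold levelRho
  rw [if_pos hk, abs_of_nonneg (by positivity)]
  exact ⟨le_add_of_nonneg_right (by positivity), le_rfl⟩

/-- The explicit thresholds see only Euclidean distances, so σ²σ₁/(κ̲m) takes the place of σ²/(u̲m);
the hypothesis on σ₁ brings it below the noise term of the risk bound. -/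
theorem predictionRisk_explicitRho_le (hn : 3 ≤ n) (hS : S.Valid) (hL : LawAssumptions S μφ μξ)
    (hiid : IsIIDSample P φ ξ μφ μξ) {sp : E n → E n} (hspm : Measurable sp)
    (hsp : ∀ x ∈ S.X, IsSparseApprox S.X S.s x (sp x)) (hα : 20 ≤ α) (hα' : 16 * α + 64 ≤ α')
    (hε : 0 < ε) (hε2 : ε ≤ 1 / 2)
    (hLd : L = ⌈α * Real.log (1 / ε)⌉₊) (hL'd : L' = ⌈α' * Real.log (1 / ε)⌉₊)
    (hsize : S.kLow ≤ S.nu → SampleSize S (sigma1 (secondMoment μφ)) α α' ε N L L')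
    (hσ₁ : sigma1 (secondMoment μφ) ≤ S.vk' * S.nu * S.sBar * Real.log n)
    {est : (ℕ → E n × ℝ) → E n}
    (hest : ∀ w, IsAggregate S sp N L L' (explicitRho S (sigma1 (secondMoment μφ))
      (Real.sqrt (tauSq S (1 / 2048) 2654208 (N / L))) (N / L')) w (est w)) :
    predictionRisk S P φ ξ μφ μξ est ε
      ≤ ENNReal.ofReal (104 * levelConst α α' * riskBound S (rateConst α) ε N) := by
  refine predictionRisk_aggregate_le hn hS hL hiid hspm hsp hα hα' hε hε2 hLd hL'd hsize
    (fun xs hxs x I med hr hgood hmed => ?_) hest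
  have hnuk := hxs.2.2.2.1.kLow_le_nu (by omega) hS hL
  have hnu : 0 < S.nu := hS.kLow_pos.trans_le hnuk
  have hz := hsize hnuk
  have hσ := noise_over_m_le_level hS hnu hα (by linarith) hε hε2 hz
    (q := S.sig ^ 2 * sigma1 (secondMoment μφ))
    (mul_nonneg (sq_nonneg _) (sigma1_nonneg _)) (by
      have := mul_le_mul_of_nonneg_left hσ₁ (sq_nonneg S.sig)
      linarith)
  have hT := tauSq_le_level hn hS hnu hα (by linarith) hε hε2 hz
  rw [mul_assoc]
  exact selection_of_explicitRho hS hL hr hgood hT hz.cond_le hσ hmed rfl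

end Risk

end SparseGLM

end

theorem proposition4 :
    ∃ α₀ : ℝ, 0 < α₀ ∧ ∀ α : ℝ, α₀ ≤ α →
    ∃ α₁ : ℝ, 0 < α₁ ∧ ∀ α' : ℝ, α₁ ≤ α' →
    ∃ c₀ c C c₁ C₁ : ℝ, 0 < c₀ ∧ 0 < c ∧ 0 < C ∧ 0 < c₁ ∧ 0 < C₁ ∧
    ∃ ρ : (n : ℕ) → SparseGLM.Setup n → (N : ℕ) → (ε : ℝ) → (r : ℝ) → ℝ,
    (∀ n S N ε r, 0 < r → 0 < ρ n S N ε r) ∧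
    ∀ (n : ℕ) (_ : 3 ≤ n) (S : SparseGLM.Setup n) (_ : S.Valid)
      (μφ : MeasureTheory.Measure (SparseGLM.E n)) (μξ : MeasureTheory.Measure ℝ)
      (_ : SparseGLM.LawAssumptions S μφ μξ)
      (Ω : Type*) [MeasurableSpace Ω] (P : MeasureTheory.Measure Ω)
      [MeasureTheory.IsProbabilityMeasure P]
      (φ : ℕ → Ω → SparseGLM.E n) (ξ : ℕ → Ω → ℝ)
      (_ : SparseGLM.IsIIDSample P φ ξ μφ μξ)
      (sp : SparseGLM.E n → SparseGLM.E n) (_ : Measurable sp)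
      (_ : ∀ x ∈ S.X, SparseGLM.IsSparseApprox S.X S.s x (sp x))
      (ε : ℝ) (_ : 0 < ε) (_ : ε ≤ 1 / 2)
      (N L L' : ℕ) (_ : L = ⌈α * Real.log (1 / ε)⌉₊) (_ : L' = ⌈α' * Real.log (1 / ε)⌉₊)
      (σ₁ : ℝ) (_ : σ₁ = SparseGLM.sigma1 (SparseGLM.secondMoment μφ))
      (_ : c₀ * max (S.vk * S.nu * S.sBar / (S.uLo * S.kap) * Real.log (1 / ε) * Real.log n)
          (S.chi * (S.uHi * σ₁) / (S.uLo * S.kap) * Real.log (1 / ε)) ≤ N),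
      (∀ est : (ℕ → SparseGLM.E n × ℝ) → SparseGLM.E n,
        (∀ w, SparseGLM.IsAggregate S sp N L L' (ρ n S N ε) w (est w)) →
        SparseGLM.predictionRisk S P φ ξ μφ μξ est ε
          ≤ ENNReal.ofReal (C * SparseGLM.riskBound S c ε N)) ∧
      (σ₁ ≤ S.vk' * S.nu * S.sBar * Real.log n →
        ∀ est : (ℕ → SparseGLM.E n × ℝ) → SparseGLM.E n,
        (∀ w, SparseGLM.IsAggregate S sp N L L'
          (SparseGLM.explicitRho S σ₁ (Real.sqrt (SparseGLM.tauSq S c₁ C₁ (N / L))) (N / L'))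
          w (est w)) →
        SparseGLM.predictionRisk S P φ ξ μφ μξ est ε
          ≤ ENNReal.ofReal (C * SparseGLM.riskBound S c ε N)) := by
  -- The values 20 and 16α + 64 are those required by `failure_prob_le`, 1/2048 and 2654208 come
  -- from `algOne_tail_bound`, and 104 from the selection lemmas.
  refine ⟨20, by norm_num, fun α hα => ⟨16 * α + 64, by linarith, fun α' hα' => ?_⟩⟩
  have hα0 : 0 < α + 2 := by linarith
  have hα0' : 0 < α' + 2 := by linarith
  refine ⟨SparseGLM.sampleConst α α', SparseGLM.rateConst α, 104 * SparseGLM.levelConst α α',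
    1 / 2048, 2654208, by unfold SparseGLM.sampleConst; positivity,
    by unfold SparseGLM.rateConst; positivity, by unfold SparseGLM.levelConst; positivity,
    by norm_num, by norm_num, SparseGLM.levelRho α α',
    fun n S N ε r hr => SparseGLM.levelRho_pos α α' n S N ε hr, ?_⟩
  intro n hn S hS μφ μξ hL Ω _ P _ φ ξ hiid sp hspm hsp ε hε hε2 N L L' hLd hL'd σ₁ hσ₁ hN
  subst hσ₁
  have hsize : S.kLow ≤ S.nu →
      SparseGLM.SampleSize S (SparseGLM.sigma1 (SparseGLM.secondMoment μφ)) α α' ε N L L' :=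
    fun hnuk => SparseGLM.sampleSize_of_le hn hS hnuk hα (by linarith) hε hε2 hLd hL'd hN
  exact ⟨fun est hest => SparseGLM.predictionRisk_levelRho_le hn hS hL hiid hspm hsp hα hα' hε hε2
      hLd hL'd hsize hest,
    fun hσ est hest => SparseGLM.predictionRisk_explicitRho_le hn hS hL hiid hspm hsp hα hα' hε hε2
      hLd hL'd hsize hσ hest⟩
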